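/- Let $\Omega\subset\mathbb{C}$ be a nonempty bounded convex open set with boundary $\partial\Omega$, oriented counterclockwise. Write sequences as $\mathbf{a}=\langle a_0,a_{-1},a_{-2},\dots\rangle$ and let $\mathcal{L}\langle a_0,a_{-1},a_{-2},\dots\rangle=\langle a_{-1},a_{-2},\dots\rangle$ be the left translation, $\partial=(\partial_x-i\partial_y)/2$, $\overline\partial=(\partial_x+i\partial_y)/2$. Let $\mathbf{w}\in C(\overline\Omega;l^1)$ and let $\mathbf{v}\in C^1(\Omega;l^1)\cap C(\overline\Omega;l^1)$ satisfy $\overline\partial\mathbf{v}+\mathcal{L}^2\partial\mathbf{v}=\mathbf{w}$ in $\Omega$. For $n\ge 0$ put $$\mathcal{S}_{-n}(z)=\frac{1}{2\pi i}\sum_{j=1}^{\infty}\int_{\partial\Omega}\left\{\frac{d\zeta}{\zeta-z}-\frac{d\overline\zeta}{\overline\zeta-\overline z}\right\}v_{-n-2j}(\zeta)\left(\frac{\overline\zeta-\overline z}{\zeta-z}\right)^{j},$$ $$(\mathcal{B}[\mathbf{v}|_{\partial\Omega}])_{-n}(z)=\frac{1}{2\pi i}\int_{\partial\Omega}\frac{v_{-n}(\zeta)}{\zeta-z}\,d\zeta+\mathcal{S}_{-n}(z)\quad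 (z\in\Omega),$$ $$(\mathcal{T}\mathbf{w})_{-n}(z)=-\frac1\pi\sum_{j=0}^{\infty}\int_{\Omega}\frac{w_{-n-2j}(\zeta)}{\zeta-z}\left(\frac{\overline\zeta-\overline z}{\zeta-z}\right)^{j}d\xi\,d\eta\quad(\zeta=\xi+i\eta,\ z\in\overline\Omega).$$ Then all these integrals and series converge absolutely, $\mathcal{B}[\mathbf{v}|_{\partial\Omega}]$ extends from $\Omega$ to a map in $C(\overline\Omega;l^\infty)$, $\mathcal{T}\mathbf{w}\in C(\overline\Omega;l^\infty)$, and for every $z\in\Omega$ and $n\ge0$ $$v_{-n}(z)=(\mathcal{B}[\mathbf{v}|_{\partial\Omega}])_{-n}(z)+(\mathcal{T}\mathbf{w})_{-n}(z).$$ Moreover, for every point $z_0\in\partial\Omega$ at which $\partial\Omega$ has a tangent line (that is, $\Omega$ has exactly one outer unit normal at $z_0$) and every $n\ge0$, the integrals and the series in $\mathcal{S}_{-n}(z_0)$ converge absolutely, the principal value below exists, and $$\lim_{\Omega\ni z\to z_0}v_{-n}(z)=\frac{1}{2\pi i}\,\mathrm{p.v.}\!\int_{\partial\Omega}\frac{v_{-n}(\zeta)}{\zeta-z_0}\,d\zeta+\frac12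 v_{-n}(z_0)+\mathcal{S}_{-n}(z_0)+(\mathcal{T}\mathbf{w})_{-n}(z_0).$$ -/

import Mathlib

open Set Filter Topology MeasureTheory
open scoped ENNReal ComplexConjugate

noncomputable section

namespace BukhgeimPompeiu

/-- The Banach space `l¹` of absolutely summable complex sequences. A sequence
`⟨v₀, v₋₁, v₋₂, …⟩` is written with its entry `v₋ₙ` at the index `n : ℕ`. -/
abbrev EllOne : Type := lp (fun _ : ℕ => ℂ) 1

/-- The Banach space `l^∞` of bounded complex sequences, indexed in the same way. -/
abbrev EllInfty : Type := lp (fun _ : ℕ => ℂ) ∞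

/-- The left translation `⟨a₀, a₋₁, a₋₂, …⟩ ↦ ⟨a₋₁, a₋₂, …⟩` on `l¹`. -/
def leftShift (a : EllOne) : EllOne :=
  ⟨fun n => a (n + 1), by
    have h := (memℓp_gen_iff (p := 1) (by simp)).1 (lp.memℓp a)
    exact memℓp_gen ((summable_nat_add_iff 1).2 h)⟩

/-- The Cauchy-Riemann operator `∂ = (∂ₓ - i ∂ᵧ) / 2` on `l¹`-valued maps. -/
def dz (v : ℂ → EllOne) (z : ℂ) : EllOne :=
  (1 / 2 : ℂ) • (fderiv ℝ v z 1 - Complex.I • fderiv ℝ v z Complex.I)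

/-- The Cauchy-Riemann operator `∂̄ = (∂ₓ + i ∂ᵧ) / 2` on `l¹`-valued maps. -/
def dzbar (v : ℂ → EllOne) (z : ℂ) : EllOne :=
  (1 / 2 : ℂ) • (fderiv ℝ v z 1 + Complex.I • fderiv ℝ v z Complex.I)

/-- The boundary of the bounded open convex set `Ω`, run through once counterclockwise for
`θ ∈ [0, 2π]`, as seen from a point `c ∈ Ω`: the inverse of the Minkowski gauge of `Ω - c` at
`e^{iθ}` is the length of the ray from `c` to `∂Ω` in the direction `e^{iθ}`. This curve is
Lipschitz continuous, hence differentiable at almost every `θ`. -/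
def boundaryCurve (Ω : Set ℂ) (c : ℂ) (θ : ℝ) : ℂ :=
  c + ((gauge {x : ℂ | c + x ∈ Ω} (Complex.exp (θ * Complex.I)))⁻¹ : ℝ) *
    Complex.exp (θ * Complex.I)

/-- The integrand of `∫_{∂Ω} g₋ₙ(ζ) / (ζ - z) dζ`, pulled back to the parameter `θ`. -/
def cauchyIntegrand (Ω : Set ℂ) (c : ℂ) (g : ℂ → EllOne) (n : ℕ) (z : ℂ) (θ : ℝ) : ℂ :=
  g (boundaryCurve Ω c θ) n / (boundaryCurve Ω c θ - z) * deriv (boundaryCurve Ω c) θ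

/-- The integrand of
`∫_{∂Ω} {dζ / (ζ - z) - dζ̄ / (ζ̄ - z̄)} g₋ₙ₋₂ⱼ(ζ) ((ζ̄ - z̄) / (ζ - z)) ^ j`,
pulled back to the parameter `θ`. -/
def angularIntegrand (Ω : Set ℂ) (c : ℂ) (g : ℂ → EllOne) (n j : ℕ) (z : ℂ) (θ : ℝ) : ℂ :=
  (deriv (boundaryCurve Ω c) θ / (boundaryCurve Ω c θ - z) -
      conj (deriv (boundaryCurve Ω c) θ) / conj (boundaryCurve Ω c θ - z)) *
    g (boundaryCurve Ω c θ) (n + 2 * j) *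
    (conj (boundaryCurve Ω c θ - z) / (boundaryCurve Ω c θ - z)) ^ j

/-- The series part
`1/(2πi) ∑_{j ≥ 1} ∫_{∂Ω} {dζ/(ζ - z) - dζ̄/(ζ̄ - z̄)} g₋ₙ₋₂ⱼ(ζ) ((ζ̄ - z̄)/(ζ - z)) ^ j`
of the Bukhgeim-Cauchy operator. -/
def angularSeries (Ω : Set ℂ) (c : ℂ) (g : ℂ → EllOne) (n : ℕ) (z : ℂ) : ℂ :=
  1 / (2 * Real.pi * Complex.I) *
    ∑' j : ℕ, ∫ θ in (0 : ℝ)..(2 * Real.pi), angularIntegrand Ω c g n (j + 1) z θ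

/-- All the integrals in `angularSeries` converge absolutely, and so does the series. -/
def AngularSeriesConverges (Ω : Set ℂ) (c : ℂ) (g : ℂ → EllOne) (n : ℕ) (z : ℂ) : Prop :=
  (∀ j : ℕ, IntervalIntegrable (angularIntegrand Ω c g n (j + 1) z) volume 0 (2 * Real.pi)) ∧
    Summable fun j : ℕ =>
      ∫ θ in (0 : ℝ)..(2 * Real.pi), angularIntegrand Ω c g n (j + 1) z θ

/-- The component `(𝓑 g)₋ₙ(z)` of the Bukhgeim-Cauchy operator, for `z ∈ Ω`. It depends only on
the values of `g` on `∂Ω`. -/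
def bukhgeimCauchy (Ω : Set ℂ) (c : ℂ) (g : ℂ → EllOne) (n : ℕ) (z : ℂ) : ℂ :=
  1 / (2 * Real.pi * Complex.I) *
      (∫ θ in (0 : ℝ)..(2 * Real.pi), cauchyIntegrand Ω c g n z θ) +
    angularSeries Ω c g n z

/-- The Cauchy integral `∫_{∂Ω} g₋ₙ(ζ) / (ζ - z₀) dζ` at a point `z₀ ∈ ∂Ω` exists in the sense of
the principal value (the limit as `ε → 0⁺` of the integrals over the part of `∂Ω` at a distance
more than `ε` from `z₀`), and is equal to `P`. -/
def HasCauchyPV (Ω : Set ℂ) (c : ℂ) (g : ℂ → EllOne) (n : ℕ) (z₀ P : ℂ) : Prop :=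
  Tendsto
    (fun ε : ℝ => ∫ θ in {θ : ℝ | θ ∈ Ioc 0 (2 * Real.pi) ∧ ε < ‖boundaryCurve Ω c θ - z₀‖},
      cauchyIntegrand Ω c g n z₀ θ)
    (𝓝[>] 0) (𝓝 P)

/-- The integrand of the area integrals in `𝓣`. -/
def areaIntegrand (w : ℂ → EllOne) (n j : ℕ) (z ζ : ℂ) : ℂ :=
  w ζ (n + 2 * j) * (1 / (ζ - z)) * (conj (ζ - z) / (ζ - z)) ^ j

/-- The component `(𝓣 w)₋ₙ(z)`, for `z` in the closure of `Ω`. -/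
def areaOperator (Ω : Set ℂ) (w : ℂ → EllOne) (n : ℕ) (z : ℂ) : ℂ :=
  -(1 / Real.pi) * ∑' j : ℕ, ∫ ζ in Ω, areaIntegrand w n j z ζ

/-- All the integrals in `areaOperator` converge absolutely, and so does the series. -/
def AreaOperatorConverges (Ω : Set ℂ) (w : ℂ → EllOne) (n : ℕ) (z : ℂ) : Prop :=
  (∀ j : ℕ, IntegrableOn (areaIntegrand w n j z) Ω volume) ∧
    Summable fun j : ℕ => ∫ ζ in Ω, areaIntegrand w n j z ζ

/-- The convex set `Ω` has a tangent line at its boundary point `z₀` (that is, `z₀` is not a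
corner): exactly one unit vector `ν` is an outer normal of `Ω` at `z₀`. -/
def HasTangentAt (Ω : Set ℂ) (z₀ : ℂ) : Prop :=
  ∃! ν : ℂ, ‖ν‖ = 1 ∧ ∀ ζ ∈ Ω, (conj ν * (ζ - z₀)).re ≤ 0

end BukhgeimPompeiu

end

open Set Filter Topology MeasureTheory
open scoped ENNReal ComplexConjugate

noncomputable section

namespace BukhgeimPompeiu

/-! Write `t = ζ - z` and `φ = t̄ / t`. For `j ≥ 1` the one-form `f φʲ (dζ/t - dζ̄/t̄)` has exterior
derivative `2i (∂̄f φʲ/t + ∂f φʲ⁻¹/t) dξ dη` off `z`: the two terms that differentiate the kernel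
are `± j f t̄ʲ⁻¹ t⁻ʲ⁻¹` and cancel. For `j = 0` the form `f dζ/t` gives `2i ∂̄f/t dξ dη`. Taking `f
= v₋ₙ₋₂ⱼ` and summing over `j`, the term with `∂v₋ₙ₋₂ⱼ₋₂` joins the term with `∂̄v₋ₙ₋₂ⱼ`, and the
equation turns the sum into `2i ∑ w₋ₙ₋₂ⱼ φʲ/t`, the integrand of the area operator.

The singularity at `z` is handled by a factor `X(|t|²)` that vanishes near `z`. Its derivative
contributes `X'(|t|²) (v₋ₙ + 2 ∑_{j≥1} v₋ₙ₋₂ⱼ φʲ)`. In polar coordinates at `z` one has `φ =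
e^{-2iα}`, and `∫ r X'(r²) dr = 1/2`, so this term is half an average of `circleMean` over small
radii. If `circleMean` tends to `M`, then letting `X` tend to the indicator of `|t| > ε` and then `ε
→ 0` gives: boundary terms minus area term tend to `iM` (`tendsto_removed_disc`).

At an interior point the powers `φʲ`, `j ≥ 1`, average to zero over the circle and `M = 2π v₋ₙ(z)`.
At a boundary point with a tangent the small circles fill exactly half of the directions; since `φ`
has period `π` in `α`, the powers still average to zero and `M = π v₋ₙ(z)`. The first case is the
representation formula. The second is the boundary formula, read off at `z₀` itself: since `v` is
continuous up to the boundary, the limit is just `v₋ₙ(z₀)` and no jump relation is needed.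

Absolute convergence of the boundary series rests on convexity: `dζ/t - dζ̄/t̄ = 2i Im(dζ/t)`, and
`Im(dζ/t) ≥ 0` for `z` in the closure. The identity for the constant sequence `⟨1, 0, 0, …⟩` with `w
= 0` shows that the truncated integrals of this nonnegative quantity converge, hence
`integrable_angularKernel`. The area kernel is dominated by `1/|t|`, which is integrable in the
plane.

Two reductions support this. The map `v` is `C¹` only inside, so the cut-off identity is proved for
the dilates `v(c + s(x - c))` and `s → 1⁻`. And `green` is proved on the convex domain directly, in
the coordinates `c + r(γ(θ) - c)` with `γ` Lipschitz. Finally, the Bukhgeim-Cauchy operator extends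
continuously because inside it equals `v - 𝓣w`. -/

/-- A bounded convex open set together with one of its points. -/
structure IsConvexDomain (Ω : Set ℂ) (c : ℂ) : Prop where
  isOpen : IsOpen Ω
  convex : Convex ℝ Ω
  bounded : Bornology.IsBounded Ω
  mem : c ∈ Ω

/-! ### The boundary curve: Lipschitz regularity, orientation and convexity. -/

/-- The distance from `c` to the boundary of `Ω` in the direction `e^{iθ}`. -/
def radius (Ω : Set ℂ) (c : ℂ) (θ : ℝ) : ℝ :=
  (gauge {x : ℂ | c + x ∈ Ω} (Complex.exp (θ * Complex.I)))⁻¹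

theorem boundaryCurve_eq (Ω : Set ℂ) (c : ℂ) (θ : ℝ) :
    boundaryCurve Ω c θ = c + radius Ω c θ * Complex.exp (θ * Complex.I) := rfl

theorem lipschitzWith_exp_mul_I : LipschitzWith 1 fun θ : ℝ => Complex.exp (θ * Complex.I) := by
  have h : ∀ θ : ℝ, HasDerivAt (fun θ : ℝ => Complex.exp (θ * Complex.I))
      (Complex.exp (θ * Complex.I) * (1 * Complex.I)) θ := fun θ =>
    ((Complex.ofRealCLM.hasDerivAt (x := θ)).mul_const Complex.I).cexp
  refine lipschitzWith_of_nnnorm_deriv_le (fun θ => (h θ).differentiableAt) fun θ => ?_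
  rw [(h θ).deriv, ← NNReal.coe_le_coe]
  simp

/-- The product of two bounded Lipschitz maps is Lipschitz. -/
theorem exists_lipschitzOnWith_mul {α : Type*} [PseudoMetricSpace α] {f g : α → ℂ} {s : Set α}
    {A B : NNReal} {a b : ℝ} (hf : LipschitzOnWith A f s) (hg : LipschitzOnWith B g s)
    (ha : ∀ x ∈ s, ‖f x‖ ≤ a) (hb : ∀ x ∈ s, ‖g x‖ ≤ b) :
    ∃ K, LipschitzOnWith K (fun x => f x * g x) s := by
  refine ⟨Real.toNNReal (a * B + b * A), LipschitzOnWith.of_dist_le_mul fun x hx y hy => ?_⟩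
  have h1 := hf.dist_le_mul x hx y hy
  have h2 := hg.dist_le_mul x hx y hy
  rw [dist_eq_norm] at *
  have h3 : f x * g x - f y * g y = f x * (g x - g y) + (f x - f y) * g y := by ring
  have ha0 : 0 ≤ a := (norm_nonneg _).trans (ha x hx)
  have hb0 : 0 ≤ b := (norm_nonneg _).trans (hb x hx)
  rw [h3, Real.coe_toNNReal _ (by positivity)]
  calc ‖f x * (g x - g y) + (f x - f y) * g y‖
      ≤ ‖f x‖ * ‖g x - g y‖ + ‖f x - f y‖ * ‖g y‖ :=
        (norm_add_le _ _).trans (by simp)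
    _ ≤ a * (B * dist x y) + (A * dist x y) * b := by
        gcongr
        · exact ha x hx
        · exact hb y hy
    _ = _ := by ring

/-- A complex-valued Lipschitz function on an interval is the integral of its derivative. -/
theorem integral_deriv_of_lipschitzOnWith {f : ℝ → ℂ} {K : NNReal} {a b : ℝ}
    (hab : a ≤ b) (hf : LipschitzOnWith K f (uIcc a b)) {f' : ℝ → ℂ}
    (hf' : ∀ᵐ θ : ℝ, θ ∈ Ioc a b → HasDerivAt f (f' θ) θ)
    (hi : IntervalIntegrable f' volume a b) :
    ∫ θ in a..b, f' θ = f b - f a := by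
  -- The real functions `L ∘ f` are Lipschitz, hence absolutely continuous; the real and imaginary
  -- parts then determine the integral.
  have key : ∀ L : ℂ →L[ℝ] ℝ, L (∫ θ in a..b, f' θ) = L (f b - f a) := by
    intro L
    have h1 : LipschitzOnWith (‖L‖₊ * K) (fun θ => L (f θ)) (uIcc a b) :=
      L.lipschitz.comp_lipschitzOnWith hf
    have h2 := h1.absolutelyContinuousOnInterval.integral_deriv_eq_sub
    rw [map_sub, ← h2, ← L.intervalIntegral_comp_comm hi]
    refine intervalIntegral.integral_congr_ae ?_
    filter_upwards [hf'] with θ hθ hm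
    rw [uIoc_of_le hab] at hm
    exact ((L.hasFDerivAt.comp_hasDerivAt θ (hθ hm)).deriv).symm
  exact Complex.ext (key Complex.reCLM) (key Complex.imCLM)

/-- Every real-linear functional on `ℂ` is of the form `h ↦ Re (ν̄ h)`. -/
theorem exists_eq_re_conj_mul (f : ℂ →L[ℝ] ℝ) : ∃ ν : ℂ, ∀ u, f u = (conj ν * u).re := by
  refine ⟨f 1 + f Complex.I * Complex.I, fun u => ?_⟩
  conv_lhs => rw [show u = u.re • (1 : ℂ) + u.im • Complex.I by
    simp only [Complex.real_smul, mul_one]; exact (Complex.re_add_im _).symm]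
  rw [map_add, map_smul, map_smul, smul_eq_mul, smul_eq_mul]
  simp only [map_add, map_mul, Complex.conj_ofReal, Complex.conj_I, Complex.mul_re,
    Complex.add_re, Complex.add_im, Complex.ofReal_re, Complex.ofReal_im, Complex.mul_im,
    Complex.neg_re, Complex.neg_im, Complex.I_re, Complex.I_im]
  ring

namespace IsConvexDomain

variable {Ω : Set ℂ} {c : ℂ}

theorem translate_mem_nhds (h : IsConvexDomain Ω c) : {x : ℂ | c + x ∈ Ω} ∈ 𝓝 (0 : ℂ) := by
  have : Continuous fun x : ℂ => c + x := by fun_prop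
  exact this.continuousAt.preimage_mem_nhds (h.isOpen.mem_nhds (by simpa using h.mem))

theorem translate_isOpen (h : IsConvexDomain Ω c) : IsOpen {x : ℂ | c + x ∈ Ω} :=
  h.isOpen.preimage (by fun_prop : Continuous fun x : ℂ => c + x)

theorem translate_convex (h : IsConvexDomain Ω c) : Convex ℝ {x : ℂ | c + x ∈ Ω} :=
  h.convex.translate_preimage_right c

theorem translate_eq (Ω : Set ℂ) (c : ℂ) :
    {x : ℂ | c + x ∈ Ω} = (Homeomorph.addLeft c) ⁻¹' Ω := rfl

theorem gauge_lt_one_iff (h : IsConvexDomain Ω c) (x : ℂ) :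
    gauge {x : ℂ | c + x ∈ Ω} x < 1 ↔ c + x ∈ Ω := by
  rw [gauge_lt_one_iff_mem_interior h.translate_convex h.translate_mem_nhds,
    h.translate_isOpen.interior_eq]
  rfl

theorem gauge_eq_one_iff (h : IsConvexDomain Ω c) (x : ℂ) :
    gauge {x : ℂ | c + x ∈ Ω} x = 1 ↔ c + x ∈ frontier Ω := by
  rw [gauge_eq_one_iff_mem_frontier h.translate_convex h.translate_mem_nhds, translate_eq,
    ← Homeomorph.preimage_frontier]
  rfl

theorem exists_gauge_ge (h : IsConvexDomain Ω c) :
    ∃ a : ℝ, 0 < a ∧ ∀ θ : ℝ, a ≤ gauge {x : ℂ | c + x ∈ Ω} (Complex.exp (θ * Complex.I)) := by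
  obtain ⟨ρ, hρ0, hρ⟩ := h.bounded.subset_ball_lt 0 c
  refine ⟨1 / ρ, by positivity, fun θ => ?_⟩
  have hs : {x : ℂ | c + x ∈ Ω} ⊆ Metric.ball 0 ρ := by
    intro x hx
    have := hρ hx
    simpa using this
  have := gauge_mono (absorbent_nhds_zero h.translate_mem_nhds) hs
    (Complex.exp (θ * Complex.I))
  rwa [gauge_ball hρ0.le, Complex.norm_exp_ofReal_mul_I] at this

theorem radius_pos (h : IsConvexDomain Ω c) (θ : ℝ) : 0 < radius Ω c θ := by
  obtain ⟨a, ha, hg⟩ := h.exists_gauge_ge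
  exact inv_pos.2 (ha.trans_le (hg θ))

theorem exists_radius_le (h : IsConvexDomain Ω c) :
    ∃ D : ℝ, 0 < D ∧ ∀ θ : ℝ, radius Ω c θ ≤ D := by
  obtain ⟨a, ha, hg⟩ := h.exists_gauge_ge
  exact ⟨a⁻¹, inv_pos.2 ha, fun θ => inv_anti₀ ha (hg θ)⟩

/-- The gauge is Lipschitz because a neighbourhood of `c` lies in `Ω`, and bounded below on the unit
circle because `Ω` is bounded; so its reciprocal is Lipschitz there. -/
theorem exists_lipschitzWith_radius (h : IsConvexDomain Ω c) :
    ∃ K, LipschitzWith K (radius Ω c) := by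
  obtain ⟨a, ha, hg⟩ := h.exists_gauge_ge
  obtain ⟨K, hK⟩ := h.translate_convex.lipschitz_gauge h.translate_mem_nhds
  have h1 := hK.comp lipschitzWith_exp_mul_I
  refine ⟨Real.toNNReal (K / a ^ 2), LipschitzWith.of_dist_le_mul fun x y => ?_⟩
  have h2 := h1.dist_le_mul x y
  have hx := hg x
  have hy := hg y
  rw [Real.coe_toNNReal _ (by positivity)]
  simp only [radius, Function.comp_apply, mul_one, Real.dist_eq] at *
  set u := gauge {x : ℂ | c + x ∈ Ω} (Complex.exp (x * Complex.I))
  set w := gauge {x : ℂ | c + x ∈ Ω} (Complex.exp (y * Complex.I))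
  have hu : 0 < u := ha.trans_le hx
  have hw : 0 < w := ha.trans_le hy
  have : u⁻¹ - w⁻¹ = -(u - w) / (u * w) := by field_simp; ring
  rw [this, abs_div, abs_neg, abs_of_pos (mul_pos hu hw), div_mul_eq_mul_div, sq]
  gcongr

theorem exists_lipschitzWith_boundaryCurve (h : IsConvexDomain Ω c) :
    ∃ K, LipschitzWith K (boundaryCurve Ω c) := by
  obtain ⟨A, hA⟩ := h.exists_lipschitzWith_radius
  obtain ⟨D, hD, hR⟩ := h.exists_radius_le
  have hA' : LipschitzWith A fun θ => (radius Ω c θ : ℂ) := by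
    have := Complex.isometry_ofReal.lipschitz.comp hA
    rwa [one_mul] at this
  obtain ⟨K, hK⟩ := exists_lipschitzOnWith_mul (s := univ) (a := D) (b := 1)
    hA'.lipschitzOnWith lipschitzWith_exp_mul_I.lipschitzOnWith
    (fun θ _ => by
      rw [Complex.norm_real, Real.norm_of_nonneg (h.radius_pos θ).le]
      exact hR θ) (fun θ _ => (Complex.norm_exp_ofReal_mul_I θ).le)
  refine ⟨K, fun x y => ?_⟩
  rw [boundaryCurve_eq, boundaryCurve_eq, edist_add_left]
  exact lipschitzOnWith_univ.1 hK x y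

theorem continuous_boundaryCurve (h : IsConvexDomain Ω c) : Continuous (boundaryCurve Ω c) :=
  h.exists_lipschitzWith_boundaryCurve.choose_spec.continuous

theorem ae_differentiableAt_boundaryCurve (h : IsConvexDomain Ω c) :
    ∀ᵐ θ : ℝ, DifferentiableAt ℝ (boundaryCurve Ω c) θ :=
  h.exists_lipschitzWith_boundaryCurve.choose_spec.ae_differentiableAt_real

theorem exists_norm_deriv_boundaryCurve_le (h : IsConvexDomain Ω c) :
    ∃ K : ℝ, 0 ≤ K ∧ ∀ θ, ‖deriv (boundaryCurve Ω c) θ‖ ≤ K := by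
  obtain ⟨K, hK⟩ := h.exists_lipschitzWith_boundaryCurve
  exact ⟨K, K.2, fun θ => norm_deriv_le_of_lipschitz hK⟩

theorem add_smul_exp_mem_iff (h : IsConvexDomain Ω c) {ρ : ℝ} (hρ : 0 ≤ ρ) (θ : ℝ) :
    c + ρ * Complex.exp (θ * Complex.I) ∈ Ω ↔ ρ < radius Ω c θ := by
  obtain ⟨a, ha, hg⟩ := h.exists_gauge_ge
  rw [← h.gauge_lt_one_iff, ← Complex.real_smul, gauge_smul_of_nonneg hρ, radius, smul_eq_mul,
    ← lt_div_iff₀ (ha.trans_le (hg θ)), one_div]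

theorem boundaryCurve_mem_frontier (h : IsConvexDomain Ω c) (θ : ℝ) :
    boundaryCurve Ω c θ ∈ frontier Ω := by
  obtain ⟨a, ha, hg⟩ := h.exists_gauge_ge
  rw [boundaryCurve_eq, ← h.gauge_eq_one_iff, ← Complex.real_smul,
    gauge_smul_of_nonneg (h.radius_pos θ).le, radius, smul_eq_mul,
    inv_mul_cancel₀ (ha.trans_le (hg θ)).ne']

theorem boundaryCurve_mem_closure (h : IsConvexDomain Ω c) (θ : ℝ) :
    boundaryCurve Ω c θ ∈ closure Ω :=
  frontier_subset_closure (h.boundaryCurve_mem_frontier θ)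

theorem isCompact_closure (h : IsConvexDomain Ω c) : IsCompact (closure Ω) :=
  h.bounded.isCompact_closure

/-- Contraction towards an interior point moves the closure into the open set. This makes the
dilates of a map that is `C¹` on `Ω` regular up to the boundary. -/
theorem shrink_mem (h : IsConvexDomain Ω c) {s : ℝ} (hs0 : 0 ≤ s) (hs1 : s < 1) {x : ℂ}
    (hx : x ∈ closure Ω) : c + s * (x - c) ∈ Ω := by
  have := h.convex.combo_interior_closure_mem_interior
    (h.isOpen.interior_eq.symm ▸ h.mem) hx (a := 1 - s) (b := s) (by linarith) hs0 (by ring)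
  rw [h.isOpen.interior_eq] at this
  convert this using 1
  simp only [Complex.real_smul]
  push_cast
  ring

theorem shrink_mem_closure (h : IsConvexDomain Ω c) {s : ℝ} (hs0 : 0 ≤ s) (hs1 : s ≤ 1) {x : ℂ}
    (hx : x ∈ closure Ω) : c + s * (x - c) ∈ closure Ω := by
  rcases hs1.lt_or_eq with h1 | rfl
  · exact subset_closure (h.shrink_mem hs0 h1 hx)
  · simpa using hx

end IsConvexDomain

theorem boundaryCurve_periodic (Ω : Set ℂ) (c : ℂ) :
    Function.Periodic (boundaryCurve Ω c) (2 * Real.pi) := by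
  intro θ
  have : Complex.exp ((θ + 2 * Real.pi : ℝ) * Complex.I) = Complex.exp (θ * Complex.I) := by
    rw [Complex.exp_eq_exp_iff_exists_int]
    exact ⟨1, by push_cast; ring⟩
  simp only [boundaryCurve, this]

namespace IsConvexDomain
variable {Ω : Set ℂ} {c : ℂ}

/-- The area form `Im(conj η · η')` of the boundary curve, seen from the centre. -/
theorem conj_mul_deriv_sub {θ : ℝ}
    (hd : DifferentiableAt ℝ (boundaryCurve Ω c) θ) :
    conj (boundaryCurve Ω c θ - c) * deriv (boundaryCurve Ω c) θ -
      (boundaryCurve Ω c θ - c) * conj (deriv (boundaryCurve Ω c) θ) =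
      2 * Complex.I * (radius Ω c θ : ℂ) ^ 2 := by
  have hexp : ∀ θ : ℝ, HasDerivAt (fun θ : ℝ => Complex.exp (-θ * Complex.I))
      (Complex.exp (-θ * Complex.I) * (-1 * Complex.I)) θ := fun θ =>
    ((Complex.ofRealCLM.hasDerivAt (x := θ)).neg.mul_const Complex.I).cexp
  have hexp' : ∀ θ : ℝ, HasDerivAt (fun θ : ℝ => Complex.exp (θ * Complex.I))
      (Complex.exp (θ * Complex.I) * (1 * Complex.I)) θ := fun θ =>
    ((Complex.ofRealCLM.hasDerivAt (x := θ)).mul_const Complex.I).cexp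
  have hmul : ∀ θ : ℝ, Complex.exp (θ * Complex.I) * Complex.exp (-θ * Complex.I) = 1 := by
    intro θ; rw [← Complex.exp_add]; simp
  -- Differentiability of the radius is inherited from the curve by undoing the rotation. The `R'`
  -- contributions then cancel in the area form, since they are real multiples of the position
  -- vector.
  have hR : (fun θ => (radius Ω c θ : ℂ)) =
      fun θ => (boundaryCurve Ω c θ - c) * Complex.exp (-θ * Complex.I) := by
    funext θ
    rw [boundaryCurve_eq, add_sub_cancel_left, mul_assoc, hmul, mul_one]
  have hRd : DifferentiableAt ℝ (fun θ => (radius Ω c θ : ℂ)) θ := by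
    rw [hR]; exact (hd.sub_const c).mul (hexp θ).differentiableAt
  have hRr : DifferentiableAt ℝ (radius Ω c) θ := by
    have := Complex.reCLM.differentiableAt.comp θ hRd
    exact this
  have hc : HasDerivAt (fun θ => (radius Ω c θ : ℂ)) ((deriv (radius Ω c) θ : ℝ) : ℂ) θ :=
    hRr.hasDerivAt.ofReal_comp
  have hγ : HasDerivAt (boundaryCurve Ω c) ((deriv (radius Ω c) θ : ℝ) * Complex.exp (θ * Complex.I)
      + radius Ω c θ * (Complex.exp (θ * Complex.I) * (1 * Complex.I))) θ :=
    (hc.mul (hexp' θ)).const_add c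
  rw [hγ.deriv, boundaryCurve_eq, add_sub_cancel_left]
  simp only [map_mul, map_add, map_one, Complex.conj_ofReal, Complex.conj_I, ← Complex.exp_conj]
  have := hmul θ
  rw [show (-θ * Complex.I : ℂ) = θ * -Complex.I by ring] at this
  set e := Complex.exp (θ * Complex.I)
  set e' := Complex.exp (θ * -Complex.I)
  linear_combination (2 * Complex.I * (radius Ω c θ : ℂ) ^ 2) * this

theorem im_conj_mul_deriv_center {θ : ℝ}
    (hd : DifferentiableAt ℝ (boundaryCurve Ω c) θ) :
    (conj (boundaryCurve Ω c θ - c) * deriv (boundaryCurve Ω c) θ).im = radius Ω c θ ^ 2 := by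
  have := congrArg Complex.im (conj_mul_deriv_sub hd)
  simp only [Complex.sub_im, Complex.mul_im, Complex.conj_re, Complex.conj_im, Complex.mul_re,
    ← Complex.ofReal_pow, Complex.ofReal_re, Complex.ofReal_im, Complex.I_re, Complex.I_im,
    Complex.re_ofNat, Complex.im_ofNat] at this ⊢
  linarith

/-- A supporting line at a boundary point. -/
theorem exists_normal (h : IsConvexDomain Ω c) {z : ℂ} (hz : z ∈ frontier Ω) :
    ∃ ν : ℂ, ∀ ζ ∈ Ω, (conj ν * (ζ - z)).re < 0 := by
  rw [h.isOpen.frontier_eq] at hz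
  obtain ⟨f, hf⟩ := geometric_hahn_banach_open_point h.convex h.isOpen hz.2
  obtain ⟨ν, hν⟩ := exists_eq_re_conj_mul f
  refine ⟨ν, fun ζ hζ => ?_⟩
  rw [← hν, map_sub]
  linarith [hf ζ hζ]

/-- The boundary curve turns counterclockwise around every point of the closure. -/
theorem im_conj_mul_deriv_nonneg (h : IsConvexDomain Ω c) {z : ℂ} (hz : z ∈ closure Ω) (θ : ℝ) :
    0 ≤ (conj (boundaryCurve Ω c θ - z) * deriv (boundaryCurve Ω c) θ).im := by
  by_cases hd : DifferentiableAt ℝ (boundaryCurve Ω c) θ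
  swap
  · simp [deriv_zero_of_not_differentiableAt hd]
  obtain ⟨ν, hν⟩ := h.exists_normal (h.boundaryCurve_mem_frontier θ)
  have hcl : ∀ ζ ∈ closure Ω, (conj ν * (ζ - boundaryCurve Ω c θ)).re ≤ 0 := by
    intro ζ hζ
    refine closure_minimal (s := Ω)
      (t := {ζ | (conj ν * (ζ - boundaryCurve Ω c θ)).re ≤ 0}) (fun ζ hζ => (hν ζ hζ).le)
      (isClosed_le (by fun_prop) continuous_const) hζ
  set γ := boundaryCurve Ω c with hγ
  set γ' := deriv γ θ
  -- The curve stays in the supporting half-plane at `γ θ` and touches its edge there, so `γ'` is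
  -- orthogonal to `ν`.
  have hmax : IsLocalMax (fun θ' => (conj ν * (γ θ' - γ θ)).re) θ := by
    refine Filter.Eventually.of_forall fun θ' => ?_
    simpa using hcl _ (h.boundaryCurve_mem_closure θ')
  have hder : HasDerivAt (fun θ' => (conj ν * (γ θ' - γ θ)).re) ((conj ν * γ').re) θ :=
    Complex.reCLM.hasFDerivAt.comp_hasDerivAt θ ((hd.hasDerivAt.sub_const (γ θ)).const_mul (conj ν))
  have h0 : (conj ν * γ').re = 0 := hmax.hasDerivAt_eq_zero hder
  have hcen := im_conj_mul_deriv_center hd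
  have hcpos : 0 < (conj (γ θ - c) * γ').im := by
    rw [hcen]; exact pow_pos (h.radius_pos θ) 2
  have hc := hν c h.mem
  have hz' := hcl z hz
  simp only [Complex.mul_re, Complex.mul_im, Complex.sub_re, Complex.sub_im, Complex.conj_re,
    Complex.conj_im, ← hγ] at *
  set a := ν.re
  set b := ν.im
  set p := γ'.re
  set q := γ'.im
  -- `γ' = i κ ν` with `κ > 0`
  have key : ∀ x y : ℝ, (x * q + -y * p) * (a ^ 2 + b ^ 2) =
      (a * x - -b * y) * (a * q - b * p) := by
    intro x y
    linear_combination (b * x - a * y) * h0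
  have hab : 0 < a ^ 2 + b ^ 2 := by
    rcases eq_or_ne a 0 with ha | ha
    · rcases eq_or_ne b 0 with hb | hb
      · rw [ha, hb] at hc; simp at hc
      · positivity
    · positivity
  have k1 := key ((γ θ).re - c.re) ((γ θ).im - c.im)
  have k2 := key ((γ θ).re - z.re) ((γ θ).im - z.im)
  -- The sign is fixed at the centre, where the area form equals `R² > 0`; the same factor then
  -- serves for every `z` in the closure.
  have hκ : 0 < a * q - b * p := by
    have e1 : 0 < a * ((γ θ).re - c.re) - -b * ((γ θ).im - c.im) := by linarith
    have e2 : 0 < (a * ((γ θ).re - c.re) - -b * ((γ θ).im - c.im)) * (a * q - b * p) := by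
      rw [← k1]; exact mul_pos (by linarith) hab
    exact pos_of_mul_pos_right e2 e1.le
  have e3 : 0 ≤ (a * ((γ θ).re - z.re) - -b * ((γ θ).im - z.im)) * (a * q - b * p) :=
    mul_nonneg (by linarith) hκ.le
  rw [← k2] at e3
  have := nonneg_of_mul_nonneg_left e3 hab
  linarith

/-- A boundary point determines its direction from `c`, hence `θ` modulo `2π`. Consequently the
parameters with `ζ = z`, where division takes its default value, form a null set. -/
theorem countable_boundaryCurve_eq (h : IsConvexDomain Ω c) (z : ℂ) :
    {θ : ℝ | boundaryCurve Ω c θ = z}.Countable := by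
  rcases eq_empty_or_nonempty {θ : ℝ | boundaryCurve Ω c θ = z} with h0 | ⟨θ₀, h0⟩
  · rw [h0]; exact countable_empty
  refine (countable_range fun k : ℤ => θ₀ + k * (2 * Real.pi)).mono fun θ hθ => ?_
  have h1 : (radius Ω c θ : ℂ) * Complex.exp (θ * Complex.I) =
      radius Ω c θ₀ * Complex.exp (θ₀ * Complex.I) := by
    have : boundaryCurve Ω c θ = boundaryCurve Ω c θ₀ := by rw [mem_ofPred_eq] at hθ h0; rw [hθ, h0]
    rw [boundaryCurve_eq, boundaryCurve_eq] at this
    exact add_left_cancel this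
  have h2 : radius Ω c θ = radius Ω c θ₀ := by
    have := congrArg norm h1
    simpa [Complex.norm_exp_ofReal_mul_I, abs_of_pos (h.radius_pos _)] using this
  rw [h2] at h1
  have h3 := mul_left_cancel₀ (Complex.ofReal_ne_zero.2 (h.radius_pos θ₀).ne') h1
  obtain ⟨k, hk⟩ := Complex.exp_eq_exp_iff_exists_int.1 h3
  refine ⟨k, ?_⟩
  have := congrArg Complex.im hk
  simp at this
  simp [this]

theorem ae_boundaryCurve_ne (h : IsConvexDomain Ω c) (z : ℂ) :
    ∀ᵐ θ : ℝ, boundaryCurve Ω c θ - z ≠ 0 := by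
  have := (h.countable_boundaryCurve_eq z).measure_zero volume
  rw [← compl_mem_ae_iff] at this
  filter_upwards [this] with θ hθ h0
  exact hθ (sub_eq_zero.1 h0)

end IsConvexDomain

/-! ### Polar integration and Green's formula on the domain. -/

theorem measurable_indicator_of_continuousOn {X E : Type*} [TopologicalSpace X] [MeasurableSpace X]
    [OpensMeasurableSpace X] [TopologicalSpace E] [MeasurableSpace E] [BorelSpace E] [Zero E]
    {f : X → E} {s : Set X} (hs : MeasurableSet s) (hf : ContinuousOn f s) :
    Measurable (s.indicator f) := by
  classical
  rw [← piecewise_eq_indicator]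
  exact hf.measurable_piecewise continuousOn_const hs

theorem integrable_polar {f : ℂ → ℂ} (hf : Measurable f) {C D : ℝ} (hC : ∀ ζ, ‖f ζ‖ ≤ C) {z : ℂ}
    (hD : ∀ ζ, D < ‖ζ - z‖ → f ζ = 0) (a b : ℝ) :
    Integrable (fun p : ℝ × ℝ => (p.1 : ℂ) * f (z + p.1 * Complex.exp (p.2 * Complex.I)))
      ((volume.restrict (Ioi 0)).prod (volume.restrict (Ioc a b))) := by
  have hm : Measurable fun p : ℝ × ℝ => (p.1 : ℂ) * f (z + p.1 * Complex.exp (p.2 * Complex.I)) :=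
    Measurable.mul (by fun_prop) (hf.comp (by fun_prop))
  rw [Measure.prod_restrict]
  have hz : ∀ p ∈ (Ioi (0 : ℝ) ×ˢ Ioc a b) \ (Ioc 0 D ×ˢ Ioc a b),
      (p.1 : ℂ) * f (z + p.1 * Complex.exp (p.2 * Complex.I)) = 0 := by
    rintro ⟨r, θ⟩ ⟨⟨hr, hθ⟩, hn⟩
    have hr' : D < r := by
      by_contra! hle
      exact hn ⟨⟨hr, hle⟩, hθ⟩
    rw [hD, mul_zero]
    rw [add_sub_cancel_left, norm_mul, Complex.norm_exp_ofReal_mul_I, Complex.norm_real, mul_one,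
      Real.norm_of_nonneg (le_of_lt hr)]
    exact hr'
  have hfin : IntegrableOn (fun p : ℝ × ℝ =>
      (p.1 : ℂ) * f (z + p.1 * Complex.exp (p.2 * Complex.I))) (Ioc 0 D ×ˢ Ioc a b) volume := by
    refine IntegrableOn.of_bound ?_ hm.aestronglyMeasurable (D * C) ?_
    · rw [Measure.volume_eq_prod, Measure.prod_prod]
      exact ENNReal.mul_lt_top measure_Ioc_lt_top measure_Ioc_lt_top
    · refine ae_restrict_of_forall_mem (measurableSet_Ioc.prod measurableSet_Ioc) ?_
      rintro ⟨r, θ⟩ ⟨hr, -⟩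
      rw [norm_mul, Complex.norm_real, Real.norm_of_nonneg hr.1.le]
      exact mul_le_mul hr.2 (hC _) (norm_nonneg _) (hr.1.le.trans hr.2)
  exact hfin.of_forall_sdiff_eq_zero (measurableSet_Ioi.prod measurableSet_Ioc) hz

/-- Integration in polar coordinates around an arbitrary point. -/
theorem integral_polar {f : ℂ → ℂ} (hf : Measurable f) {C D : ℝ} (hC : ∀ ζ, ‖f ζ‖ ≤ C) {z : ℂ}
    (hD : ∀ ζ, D < ‖ζ - z‖ → f ζ = 0) :
    ∫ ζ, f ζ = ∫ θ in (0 : ℝ)..(2 * Real.pi), ∫ r in Ioi (0 : ℝ),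
      (r : ℂ) * f (z + r * Complex.exp (θ * Complex.I)) := by
  -- Periodicity moves the angular window from `(-π, π]` to `(0, 2π]`.
  have hper : Function.Periodic (fun θ : ℝ => ∫ r in Ioi (0 : ℝ),
      (r : ℂ) * f (z + r * Complex.exp (θ * Complex.I))) (2 * Real.pi) := by
    intro θ
    have : Complex.exp ((θ + 2 * Real.pi : ℝ) * Complex.I) = Complex.exp (θ * Complex.I) := by
      rw [Complex.exp_eq_exp_iff_exists_int]
      exact ⟨1, by push_cast; ring⟩
    simp only [this]
  have h2 := hper.intervalIntegral_add_eq 0 (-Real.pi)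
  rw [zero_add] at h2
  rw [h2, intervalIntegral.integral_of_le (by linarith [Real.pi_pos]),
    ← integral_prod_symm _ (integrable_polar hf hC hD _ _),
    ← integral_add_left_eq_self (μ := volume) f z, ← Complex.integral_comp_polarCoord_symm,
    polarCoord_target, Measure.prod_restrict]
  have hset : (Ioi (0 : ℝ) ×ˢ Ioo (-Real.pi) Real.pi : Set (ℝ × ℝ)) =ᵐ[volume]
      Ioi (0 : ℝ) ×ˢ Ioc (-Real.pi) (-Real.pi + 2 * Real.pi) := by
    rw [Measure.volume_eq_prod, show -Real.pi + 2 * Real.pi = Real.pi by ring]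
    exact Measure.set_prod_ae_eq (ae_eq_refl _) Ioo_ae_eq_Ioc
  rw [setIntegral_congr_set hset]
  refine integral_congr_ae (Filter.Eventually.of_forall fun p => ?_)
  simp only [Complex.polarCoord_symm_apply, Complex.real_smul]
  rw [Complex.ofReal_cos, Complex.ofReal_sin, ← Complex.exp_mul_I]

/-- The real-linear map `h ↦ a h + b h̄`. -/
def wirtinger (a b : ℂ) : ℂ →L[ℝ] ℂ :=
  a • ContinuousLinearMap.id ℝ ℂ + b • (Complex.conjCLE : ℂ →L[ℝ] ℂ)

@[simp] theorem wirtinger_apply (a b h : ℂ) : wirtinger a b h = a * h + b * conj h := by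
  simp [wirtinger]

theorem norm_wirtinger_le (a b : ℂ) : ‖wirtinger a b‖ ≤ ‖a‖ + ‖b‖ := by
  refine ContinuousLinearMap.opNorm_le_bound _ (by positivity) fun h => ?_
  rw [wirtinger_apply]
  refine (norm_add_le _ _).trans ?_
  rw [norm_mul, norm_mul, RCLike.norm_conj]
  linarith

namespace IsConvexDomain
variable {Ω : Set ℂ} {c : ℂ}

theorem exists_norm_sub_le (h : IsConvexDomain Ω c) (z : ℂ) :
    ∃ D : ℝ, 0 < D ∧ ∀ ζ ∈ closure Ω, ‖ζ - z‖ ≤ D := by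
  obtain ⟨D, hD0, hD⟩ := h.bounded.closure.subset_closedBall_lt 0 z
  exact ⟨D, hD0, fun ζ hζ => by simpa [dist_eq_norm] using hD hζ⟩

/-- Integration over the domain in polar coordinates adapted to its boundary curve. -/
theorem setIntegral_eq (h : IsConvexDomain Ω c) {g : ℂ → ℂ} (hg : ContinuousOn g (closure Ω)) :
    ∫ ζ in Ω, g ζ = ∫ θ in (0 : ℝ)..(2 * Real.pi), ∫ r in (0 : ℝ)..1,
      (r : ℂ) * (radius Ω c θ : ℂ) ^ 2 * g (c + r * (boundaryCurve Ω c θ - c)) := by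
  obtain ⟨C, hC⟩ := h.isCompact_closure.exists_bound_of_continuousOn hg
  obtain ⟨D, hD0, hD⟩ := h.exists_norm_sub_le c
  have hC0 : 0 ≤ C := (norm_nonneg _).trans (hC c (subset_closure h.mem))
  have hf := measurable_indicator_of_continuousOn h.isOpen.measurableSet (hg.mono subset_closure)
  rw [← integral_indicator h.isOpen.measurableSet,
    integral_polar hf (C := C) (D := D) (z := c)]
  · refine intervalIntegral.integral_congr fun θ _ => ?_
    have hR := h.radius_pos θ
    have h1 : ∀ r ∈ Ioi (0 : ℝ), (r : ℂ) * Ω.indicator g (c + r * Complex.exp (θ * Complex.I)) =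
        (Ioo 0 (radius Ω c θ)).indicator
          (fun r : ℝ => (r : ℂ) * g (c + r * Complex.exp (θ * Complex.I))) r := by
      intro r hr
      by_cases hr' : r < radius Ω c θ
      · rw [indicator_of_mem ((h.add_smul_exp_mem_iff (le_of_lt hr) θ).2 hr'),
          indicator_of_mem (show r ∈ Ioo 0 (radius Ω c θ) from ⟨hr, hr'⟩)]
      · rw [indicator_of_notMem (fun h' => hr' ((h.add_smul_exp_mem_iff (le_of_lt hr) θ).1 h')),
          indicator_of_notMem (fun h' : r ∈ Ioo 0 (radius Ω c θ) => hr' h'.2), mul_zero]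
    rw [setIntegral_congr_fun measurableSet_Ioi h1, setIntegral_indicator measurableSet_Ioo,
      inter_eq_self_of_subset_right Ioo_subset_Ioi_self, ← integral_Ioc_eq_integral_Ioo,
      ← intervalIntegral.integral_of_le hR.le]
    -- The substitution `r ↦ R(θ) r` normalises the ray to `[0, 1]` and produces the Jacobian `r
    -- R(θ)²`.
    have h2 := intervalIntegral.smul_integral_comp_mul_left (a := 0) (b := 1)
      (fun r : ℝ => (r : ℂ) * g (c + r * Complex.exp (θ * Complex.I))) (radius Ω c θ)
    rw [mul_zero, mul_one] at h2
    rw [← h2, ← intervalIntegral.integral_smul]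
    refine intervalIntegral.integral_congr fun r _ => ?_
    simp only [boundaryCurve_eq, add_sub_cancel_left, Complex.real_smul, Complex.ofReal_mul]
    rw [show (radius Ω c θ : ℂ) * r * Complex.exp (θ * Complex.I) =
      r * (radius Ω c θ * Complex.exp (θ * Complex.I)) by ring]
    ring
  · intro ζ
    by_cases hζ : ζ ∈ Ω
    · rw [indicator_of_mem hζ]; exact hC ζ (subset_closure hζ)
    · rw [indicator_of_notMem hζ, norm_zero]; exact hC0
  · intro ζ hζ
    refine indicator_of_notMem (fun h' => ?_) _
    exact (hD ζ (subset_closure h')).not_gt hζ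

theorem continuousOn_comp_shrink (h : IsConvexDomain Ω c) {Φ : ℂ → ℂ}
    (hΦ : ContinuousOn Φ (closure Ω)) :
    ContinuousOn (fun p : ℝ × ℝ => Φ (c + p.1 * (boundaryCurve Ω c p.2 - c)))
      (Icc 0 1 ×ˢ univ) := by
  have := h.continuous_boundaryCurve
  refine hΦ.comp (Continuous.continuousOn (by fun_prop)) ?_
  rintro ⟨r, θ⟩ ⟨hr, -⟩
  exact h.shrink_mem_closure hr.1 hr.2 (h.boundaryCurve_mem_closure θ)

theorem integrable_comp_shrink_mul (h : IsConvexDomain Ω c) {Φ : ℂ → ℂ}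
    (hΦ : ContinuousOn Φ (closure Ω)) {k : ℝ × ℝ → ℂ} (hk : Measurable k) {C : ℝ}
    (hC : ∀ p ∈ Ioc (0 : ℝ) 1 ×ˢ Ioc (0 : ℝ) (2 * Real.pi), ‖k p‖ ≤ C) :
    Integrable (fun p : ℝ × ℝ => Φ (c + p.1 * (boundaryCurve Ω c p.2 - c)) * k p)
      ((volume.restrict (Ioc (0 : ℝ) 1)).prod (volume.restrict (Ioc (0 : ℝ) (2 * Real.pi)))) := by
  obtain ⟨C', hC'⟩ := h.isCompact_closure.exists_bound_of_continuousOn hΦ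
  have hS : MeasurableSet (Ioc (0 : ℝ) 1 ×ˢ Ioc (0 : ℝ) (2 * Real.pi)) :=
    measurableSet_Ioc.prod measurableSet_Ioc
  rw [Measure.prod_restrict]
  refine IntegrableOn.of_bound ?_ ?_ (C' * C) ?_
  · rw [Measure.prod_prod]
    exact ENNReal.mul_lt_top measure_Ioc_lt_top measure_Ioc_lt_top
  · refine AEStronglyMeasurable.mul ?_ hk.aestronglyMeasurable
    refine ContinuousOn.aestronglyMeasurable ?_ hS
    exact (h.continuousOn_comp_shrink hΦ).mono (prod_mono Ioc_subset_Icc_self (subset_univ _))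
  · refine ae_restrict_of_forall_mem hS fun p hp => ?_
    have h1 := hC' _ (h.shrink_mem_closure hp.1.1.le hp.1.2 (h.boundaryCurve_mem_closure p.2))
    rw [norm_mul]
    exact mul_le_mul h1 (hC p hp) (norm_nonneg _) ((norm_nonneg _).trans h1)

set_option maxHeartbeats 400000 in
/-- Green's formula in complex notation. -/
theorem green (h : IsConvexDomain Ω c) {F A B : ℂ → ℂ}
    (hF : ∀ ζ ∈ closure Ω, HasFDerivAt F (wirtinger (A ζ) (B ζ)) ζ)
    (hA : ContinuousOn A (closure Ω)) (hB : ContinuousOn B (closure Ω)) (p q : ℂ) :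
    2 * Complex.I * ∫ ζ in Ω, (p * B ζ - q * A ζ) = ∫ θ in (0 : ℝ)..(2 * Real.pi),
      F (boundaryCurve Ω c θ) * (p * deriv (boundaryCurve Ω c) θ +
        q * conj (deriv (boundaryCurve Ω c) θ)) := by
  have hFc : ContinuousOn F (closure Ω) := fun ζ hζ => (hF ζ hζ).continuousAt.continuousWithinAt
  obtain ⟨K, hK0, hK⟩ := h.exists_norm_deriv_boundaryCurve_le
  obtain ⟨D, hD0, hD⟩ := h.exists_norm_sub_le c
  obtain ⟨CA, hCA⟩ := h.isCompact_closure.exists_bound_of_continuousOn hA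
  obtain ⟨CB, hCB⟩ := h.isCompact_closure.exists_bound_of_continuousOn hB
  obtain ⟨CF, hCF⟩ := h.isCompact_closure.exists_bound_of_continuousOn hFc
  have hD' : ∀ θ, ‖boundaryCurve Ω c θ - c‖ ≤ D := fun θ => hD _ (h.boundaryCurve_mem_closure θ)
  have hγc := h.continuous_boundaryCurve
  have hγ'm : Measurable (deriv (boundaryCurve Ω c)) := measurable_deriv _
  have hpi : (0 : ℝ) ≤ 2 * Real.pi := by positivity
  have hper := boundaryCurve_periodic Ω c
  have hdiff := h.ae_differentiableAt_boundaryCurve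
  obtain ⟨L, hL⟩ := h.exists_lipschitzWith_boundaryCurve
  have harea : ∀ᵐ θ : ℝ, conj (boundaryCurve Ω c θ - c) * deriv (boundaryCurve Ω c) θ -
      (boundaryCurve Ω c θ - c) * conj (deriv (boundaryCurve Ω c) θ) =
      2 * Complex.I * (radius Ω c θ : ℂ) ^ 2 := by
    filter_upwards [hdiff] with θ hθ using conj_mul_deriv_sub hθ
  have hset := h.setIntegral_eq (g := fun ζ => p * B ζ - q * A ζ)
    ((hB.const_mul p).sub (hA.const_mul q))
  have hmemcl : ∀ r ∈ Icc (0 : ℝ) 1, ∀ θ, c + r * (boundaryCurve Ω c θ - c) ∈ closure Ω :=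
    fun r hr θ => h.shrink_mem_closure hr.1 hr.2 (h.boundaryCurve_mem_closure θ)
  set γ := boundaryCurve Ω c
  set γ' := deriv γ with hγ'
  -- `ℓ` is the form `p dζ + q dζ̄`. Below, `G₁ = ∂ᵣ [r F ℓ(γ')]` and `G₂ = ∂_θ [F ℓ(γ - c)]`, with
  -- `F` taken at `c + r(γ - c)`. Their difference is the pullback of `d(F ℓ)`; it contains no
  -- derivative of `γ'`, so a Lipschitz curve suffices.
  let ℓ : ℂ → ℂ := fun u => p * u + q * conj u
  have hℓ : ∀ u, ‖ℓ u‖ ≤ (‖p‖ + ‖q‖) * ‖u‖ := fun u => by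
    refine (norm_add_le _ _).trans ?_
    rw [norm_mul, norm_mul, RCLike.norm_conj, add_mul]
  have hℓm : Continuous ℓ := by fun_prop
  let G₁ : ℝ × ℝ → ℂ := fun x => A (c + x.1 * (γ x.2 - c)) * (x.1 * (γ x.2 - c) * ℓ (γ' x.2)) +
    B (c + x.1 * (γ x.2 - c)) * (x.1 * conj (γ x.2 - c) * ℓ (γ' x.2)) +
    F (c + x.1 * (γ x.2 - c)) * ℓ (γ' x.2)
  let G₂ : ℝ × ℝ → ℂ := fun x => A (c + x.1 * (γ x.2 - c)) * (x.1 * γ' x.2 * ℓ (γ x.2 - c)) +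
    B (c + x.1 * (γ x.2 - c)) * (x.1 * conj (γ' x.2) * ℓ (γ x.2 - c)) +
    F (c + x.1 * (γ x.2 - c)) * ℓ (γ' x.2)
  have hb : ∀ (r : ℝ) (u w : ℂ) (a b : ℝ), r ∈ Ioc (0 : ℝ) 1 → ‖u‖ ≤ a → ‖w‖ ≤ b →
      ‖(r : ℂ) * u * ℓ w‖ ≤ 1 * a * ((‖p‖ + ‖q‖) * b) := by
    intro r u w a b hr hu hw
    rw [norm_mul, norm_mul, Complex.norm_real, Real.norm_of_nonneg hr.1.le]
    have hr2 := hr.2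
    have ha : 0 ≤ a := (norm_nonneg _).trans hu
    gcongr
    exact (hℓ w).trans (by gcongr)
  have hmγ' : Measurable fun x : ℝ × ℝ => γ' x.2 := hγ'm.comp measurable_snd
  have hG₁ : Integrable G₁ ((volume.restrict (Ioc (0 : ℝ) 1)).prod
      (volume.restrict (Ioc (0 : ℝ) (2 * Real.pi)))) := by
    refine ((h.integrable_comp_shrink_mul hA (C := 1 * D * ((‖p‖ + ‖q‖) * K)) ?_ ?_).add
      (h.integrable_comp_shrink_mul hB (C := 1 * D * ((‖p‖ + ‖q‖) * K)) ?_ ?_)).add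
      (h.integrable_comp_shrink_mul hFc (C := (‖p‖ + ‖q‖) * K) ?_ ?_)
    · exact Measurable.mul (by fun_prop) (hℓm.measurable.comp hmγ')
    · exact fun x hx => hb _ _ _ _ _ hx.1 (hD' _) (hK _)
    · exact Measurable.mul (by fun_prop) (hℓm.measurable.comp hmγ')
    · exact fun x hx => hb _ _ _ _ _ hx.1 (by rw [RCLike.norm_conj]; exact hD' _) (hK _)
    · exact hℓm.measurable.comp hmγ'
    · exact fun x hx => (hℓ _).trans (by gcongr; exact hK _)
  have hG₂ : Integrable G₂ ((volume.restrict (Ioc (0 : ℝ) 1)).prod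
      (volume.restrict (Ioc (0 : ℝ) (2 * Real.pi)))) := by
    refine ((h.integrable_comp_shrink_mul hA (C := 1 * K * ((‖p‖ + ‖q‖) * D)) ?_ ?_).add
      (h.integrable_comp_shrink_mul hB (C := 1 * K * ((‖p‖ + ‖q‖) * D)) ?_ ?_)).add
      (h.integrable_comp_shrink_mul hFc (C := (‖p‖ + ‖q‖) * K) ?_ ?_)
    · exact Measurable.mul (Measurable.mul (by fun_prop) hmγ') (by fun_prop)
    · exact fun x hx => hb _ _ _ _ _ hx.1 (hK _) (hD' _)
    · exact Measurable.mul (Measurable.mul (by fun_prop)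
        (Complex.continuous_conj.measurable.comp hmγ')) (by fun_prop)
    · exact fun x hx => hb _ _ _ _ _ hx.1 (by rw [RCLike.norm_conj]; exact hK _) (hD' _)
    · exact hℓm.measurable.comp hmγ'
    · exact fun x hx => (hℓ _).trans (by gcongr; exact hK _)
  -- radial integration
  have radial : ∀ θ, ∫ r in (0 : ℝ)..1, G₁ (r, θ) = F (γ θ) * ℓ (γ' θ) := by
    intro θ
    have hder : ∀ r ∈ uIcc (0 : ℝ) 1, HasDerivAt
        (fun r : ℝ => (r : ℂ) * F (c + r * (γ θ - c)) * ℓ (γ' θ)) (G₁ (r, θ)) r := by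
      intro r hr
      rw [uIcc_of_le zero_le_one] at hr
      have h1 : HasDerivAt (fun r : ℝ => c + (r : ℂ) * (γ θ - c)) (1 * (γ θ - c)) r :=
        (Complex.ofRealCLM.hasDerivAt.mul_const (γ θ - c)).const_add c
      have h2 := (hF _ (hmemcl r hr θ)).comp_hasDerivAt r h1
      have h3 := ((Complex.ofRealCLM.hasDerivAt (x := r)).mul h2).mul_const (ℓ (γ' θ))
      refine h3.congr_deriv ?_
      simp only [G₁, wirtinger_apply, Function.comp_apply, Complex.ofRealCLM_apply,
      Complex.ofReal_one, one_mul]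
      ring
    have hc : ContinuousOn (fun r : ℝ => G₁ (r, θ)) (uIcc (0 : ℝ) 1) := by
      rw [uIcc_of_le zero_le_one]
      have aux : ∀ Φ : ℂ → ℂ, ContinuousOn Φ (closure Ω) →
          ContinuousOn (fun r : ℝ => Φ (c + r * (γ θ - c))) (Icc 0 1) := fun Φ hΦ =>
        hΦ.comp (Continuous.continuousOn (by fun_prop)) fun r hr => hmemcl r hr θ
      change ContinuousOn (fun r : ℝ => A (c + r * (γ θ - c)) * (r * (γ θ - c) * ℓ (γ' θ)) +
        B (c + r * (γ θ - c)) * (r * conj (γ θ - c) * ℓ (γ' θ)) +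
        F (c + r * (γ θ - c)) * ℓ (γ' θ)) (Icc 0 1)
      have hA' := aux A hA
      have hB' := aux B hB
      have hF' := aux F hFc
      generalize ℓ (γ' θ) = u at *
      generalize γ θ - c = w at *
      refine ((hA'.mul ?_).add (hB'.mul ?_)).add (hF'.mul continuousOn_const)
      · exact Continuous.continuousOn (by fun_prop)
      · exact Continuous.continuousOn (by fun_prop)
    rw [intervalIntegral.integral_eq_sub_of_hasDerivAt hder hc.intervalIntegrable]
    simp
  -- angular integration
  have angular : ∀ r ∈ Ioc (0 : ℝ) 1, ∫ θ in (0 : ℝ)..(2 * Real.pi), G₂ (r, θ) = 0 := by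
    intro r hr
    have hr' : r ∈ Icc (0 : ℝ) 1 := Ioc_subset_Icc_self hr
    have hlipF : LipschitzOnWith (Real.toNNReal (CA + CB)) F (closure Ω) := by
      refine h.convex.closure.lipschitzOnWith_of_nnnorm_hasFDerivWithin_le
        (fun ζ hζ => (hF ζ hζ).hasFDerivWithinAt) fun ζ hζ => ?_
      rw [← NNReal.coe_le_coe]
      exact ((norm_wirtinger_le _ _).trans (add_le_add (hCA ζ hζ) (hCB ζ hζ))).trans
        (Real.le_coe_toNNReal _)
    have hlip1 : LipschitzOnWith (Real.toNNReal (CA + CB) * L)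
        (fun θ => F (c + r * (γ θ - c))) univ := by
      refine hlipF.comp (LipschitzOnWith.of_dist_le_mul fun x _ y _ => ?_)
        (fun θ _ => hmemcl r hr' θ)
      rw [dist_add_left, dist_eq_norm, ← mul_sub, sub_sub_sub_cancel_right, norm_mul,
        Complex.norm_real, Real.norm_of_nonneg hr.1.le, ← dist_eq_norm]
      calc r * dist (γ x) (γ y) ≤ 1 * dist (γ x) (γ y) := by gcongr; exact hr.2
        _ ≤ L * dist x y := by rw [one_mul]; exact hL.dist_le_mul x y
    have hlip2 : LipschitzOnWith (Real.toNNReal ((‖p‖ + ‖q‖) * L))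
        (fun θ => ℓ (γ θ - c)) univ := by
      refine LipschitzOnWith.of_dist_le_mul fun x _ y _ => ?_
      have h1 : ℓ (γ x - c) - ℓ (γ y - c) = ℓ (γ x - γ y) := by
        simp only [ℓ, map_sub]; ring
      rw [Real.coe_toNNReal _ (by positivity), dist_eq_norm, h1, mul_assoc]
      refine (hℓ _).trans ?_
      gcongr
      rw [← dist_eq_norm]
      exact hL.dist_le_mul x y
    -- The primitive of `G₂(r, ·)` is Lipschitz and `2π`-periodic, so its integral over a period
    -- vanishes.
    obtain ⟨M, hM⟩ := exists_lipschitzOnWith_mul (b := (‖p‖ + ‖q‖) * D) hlip1 hlip2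
      (fun θ _ => hCF _ (hmemcl r hr' θ)) (fun θ _ => (hℓ _).trans (by gcongr; exact hD' θ))
    have hder : ∀ᵐ θ : ℝ, θ ∈ Ioc 0 (2 * Real.pi) → HasDerivAt
        (fun θ => F (c + r * (γ θ - c)) * ℓ (γ θ - c)) (G₂ (r, θ)) θ := by
      filter_upwards [hdiff] with θ hθ _
      have h1 : HasDerivAt (fun θ => c + (r : ℂ) * (γ θ - c)) (r * γ' θ) θ :=
        ((hθ.hasDerivAt.sub_const c).const_mul (r : ℂ)).const_add c
      have h2 := (hF _ (hmemcl r hr' θ)).comp_hasDerivAt θ h1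
      have h3 : HasDerivAt (fun θ => ℓ (γ θ - c)) (wirtinger p q (γ' θ)) θ := by
        have := (wirtinger p q).hasFDerivAt.comp_hasDerivAt θ (hθ.hasDerivAt.sub_const c)
        refine this.congr_of_eventuallyEq (Filter.Eventually.of_forall fun θ => ?_)
        simp [ℓ, Function.comp]
      refine (h2.mul h3).congr_deriv ?_
      simp only [G₂, wirtinger_apply, Function.comp_apply, map_mul, Complex.conj_ofReal]
      ring
    have hint : IntervalIntegrable (fun θ => G₂ (r, θ)) volume 0 (2 * Real.pi) := by
      have aux : ∀ Φ : ℂ → ℂ, ContinuousOn Φ (closure Ω) → ∀ k : ℝ → ℂ, Measurable k → ∀ C : ℝ,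
          (∀ θ, ‖k θ‖ ≤ C) → IntegrableOn (fun θ : ℝ => Φ (c + r * (γ θ - c)) * k θ)
            (Ioc 0 (2 * Real.pi)) := by
        intro Φ hΦ k hk C hC
        have hcont : Continuous fun θ : ℝ => Φ (c + r * (γ θ - c)) :=
          hΦ.comp_continuous (by fun_prop) fun θ => hmemcl r hr' θ
        obtain ⟨C', hC'⟩ := h.isCompact_closure.exists_bound_of_continuousOn hΦ
        refine IntegrableOn.of_bound measure_Ioc_lt_top
          (hcont.aestronglyMeasurable.mul hk.aestronglyMeasurable) (C' * C)
          (Filter.Eventually.of_forall fun θ => ?_)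
        rw [norm_mul]
        have := hC' _ (hmemcl r hr' θ)
        exact mul_le_mul this (hC θ) (norm_nonneg _) ((norm_nonneg _).trans this)
      rw [intervalIntegrable_iff_integrableOn_Ioc_of_le hpi]
      refine ((aux A hA (fun θ => r * γ' θ * ℓ (γ θ - c)) ?_ (1 * K * ((‖p‖ + ‖q‖) * D)) ?_).add
        (aux B hB (fun θ => r * conj (γ' θ) * ℓ (γ θ - c)) ?_ (1 * K * ((‖p‖ + ‖q‖) * D)) ?_)).add
        (aux F hFc (fun θ => ℓ (γ' θ)) ?_ ((‖p‖ + ‖q‖) * K) ?_)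
      · exact Measurable.mul (hγ'm.const_mul _) (by fun_prop)
      · exact fun θ => hb _ _ _ _ _ hr (hK _) (hD' _)
      · exact Measurable.mul ((Complex.continuous_conj.measurable.comp hγ'm).const_mul _)
          (by fun_prop)
      · exact fun θ => hb _ _ _ _ _ hr (by rw [RCLike.norm_conj]; exact hK _) (hD' _)
      · exact hℓm.measurable.comp hγ'm
      · exact fun θ => (hℓ _).trans (by gcongr; exact hK _)
    rw [integral_deriv_of_lipschitzOnWith hpi (hM.mono (subset_univ _)) hder hint]
    have := hper 0
    rw [zero_add] at this
    rw [this, sub_self]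
  have hswap₁ : ∫ θ in (0 : ℝ)..(2 * Real.pi), F (γ θ) * ℓ (γ' θ) =
      ∫ x, G₁ x ∂((volume.restrict (Ioc (0 : ℝ) 1)).prod
        (volume.restrict (Ioc (0 : ℝ) (2 * Real.pi)))) := by
    rw [integral_prod_symm _ hG₁, intervalIntegral.integral_of_le hpi]
    refine integral_congr_ae (Filter.Eventually.of_forall fun θ => ?_)
    simp only
    rw [← radial θ, intervalIntegral.integral_of_le zero_le_one]
  have hswap₂ : ∫ x, G₂ x ∂((volume.restrict (Ioc (0 : ℝ) 1)).prod
        (volume.restrict (Ioc (0 : ℝ) (2 * Real.pi)))) = 0 := by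
    rw [integral_prod _ hG₂]
    refine setIntegral_eq_zero_of_forall_eq_zero fun r hr => ?_
    rw [← intervalIntegral.integral_of_le hpi]
    exact angular r hr
  have hdiffG : Integrable (fun x => G₁ x - G₂ x) ((volume.restrict (Ioc (0 : ℝ) 1)).prod
        (volume.restrict (Ioc (0 : ℝ) (2 * Real.pi)))) := hG₁.sub hG₂
  calc _ = ∫ θ in (0 : ℝ)..(2 * Real.pi), ∫ r in (0 : ℝ)..1, (G₁ (r, θ) - G₂ (r, θ)) := by
        rw [hset, ← intervalIntegral.integral_const_mul]
        refine intervalIntegral.integral_congr_ae ?_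
        filter_upwards [harea] with θ hθ _
        rw [← intervalIntegral.integral_const_mul]
        refine intervalIntegral.integral_congr fun r _ => ?_
        simp only [G₁, G₂, ℓ]
        -- The terms with `F` cancel, and by the area form `G₁ - G₂ = 2i r R² (p B - q A)`.
        linear_combination (-(r : ℂ) * (p * B (c + r * (γ θ - c)) - q * A (c + r * (γ θ - c)))) * hθ
    _ = ∫ x, (G₁ x - G₂ x) ∂((volume.restrict (Ioc (0 : ℝ) 1)).prod
        (volume.restrict (Ioc (0 : ℝ) (2 * Real.pi)))) := by
        rw [integral_prod_symm _ hdiffG, intervalIntegral.integral_of_le hpi]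
        simp only [intervalIntegral.integral_of_le zero_le_one]
    _ = ∫ θ in (0 : ℝ)..(2 * Real.pi), F (γ θ) * ℓ (γ' θ) := by
        rw [integral_sub hG₁ hG₂, hswap₂, sub_zero, hswap₁]

end IsConvexDomain

/-! ### Phase sums `∑ⱼ a₋ₙ₋₂ⱼ φʲ` and their integrals. -/

/-- The unimodular factor `t̄ / t`. -/
def phase (t : ℂ) : ℂ := conj t / t

/-- An inequality, since `phase 0 = 0` by the convention for division by zero; stated for all `t`,
it spares every later estimate an exceptional point. -/
theorem norm_phase_le (t : ℂ) : ‖phase t‖ ≤ 1 := by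
  rw [phase, norm_div, RCLike.norm_conj]
  exact div_self_le_one _

theorem measurable_phase : Measurable phase :=
  Complex.continuous_conj.measurable.div measurable_id

theorem phase_ofReal_mul_exp {r : ℝ} (hr : r ≠ 0) (α : ℝ) :
    phase (r * Complex.exp (α * Complex.I)) = Complex.exp (-2 * α * Complex.I) := by
  have hr' : (r : ℂ) ≠ 0 := Complex.ofReal_ne_zero.2 hr
  rw [phase, map_mul, Complex.conj_ofReal, ← Complex.exp_conj, map_mul, Complex.conj_ofReal,
    Complex.conj_I, mul_div_mul_left _ _ hr', ← Complex.exp_sub]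
  congr 1
  ring

theorem summable_norm_apply (a : EllOne) : Summable fun n => ‖a n‖ := by
  have := (memℓp_gen_iff (p := 1) (by simp)).1 (lp.memℓp a)
  simpa using this

theorem tsum_norm_apply (a : EllOne) : ∑' n, ‖a n‖ = ‖a‖ := by
  rw [lp.norm_eq_tsum_rpow (by simp)]
  simp

theorem norm_apply_le (a : EllOne) (n : ℕ) : ‖a n‖ ≤ ‖a‖ :=
  lp.norm_apply_le_norm one_ne_zero a n

theorem continuous_apply (n : ℕ) : Continuous fun a : EllOne => a n :=
  (lp.evalCLM ℂ (fun _ : ℕ => ℂ) 1 n).continuous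

theorem injective_add_two_mul (n : ℕ) : Function.Injective fun j : ℕ => n + 2 * j := by
  intro i j h
  simp only at h
  omega

theorem summable_norm_apply_add_two_mul (a : EllOne) (n : ℕ) :
    Summable fun j : ℕ => ‖a (n + 2 * j)‖ :=
  (summable_norm_apply a).comp_injective (injective_add_two_mul n)

theorem tsum_norm_apply_add_two_mul_le (a : EllOne) (n : ℕ) :
    ∑' j : ℕ, ‖a (n + 2 * j)‖ ≤ ‖a‖ := by
  rw [← tsum_norm_apply a]
  exact (summable_norm_apply_add_two_mul a n).tsum_le_tsum_of_inj _ (injective_add_two_mul n)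
    (fun _ _ => norm_nonneg _) (fun _ => le_rfl) (summable_norm_apply a)

/-- The sum `∑ⱼ a₋ₙ₋₂ⱼ φʲ`. -/
def phaseSum (n : ℕ) (φ : ℂ) (a : EllOne) : ℂ := ∑' j : ℕ, a (n + 2 * j) * φ ^ j

theorem norm_mul_pow_le {φ : ℂ} (hφ : ‖φ‖ ≤ 1) (b : ℂ) (j : ℕ) : ‖b * φ ^ j‖ ≤ ‖b‖ := by
  rw [norm_mul, norm_pow]
  exact mul_le_of_le_one_right (norm_nonneg _) (pow_le_one₀ (norm_nonneg _) hφ)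

theorem summable_norm_phaseSum {φ : ℂ} (hφ : ‖φ‖ ≤ 1) (n : ℕ) (a : EllOne) :
    Summable fun j : ℕ => ‖a (n + 2 * j) * φ ^ j‖ :=
  (summable_norm_apply_add_two_mul a n).of_nonneg_of_le (fun _ => norm_nonneg _)
    fun j => norm_mul_pow_le hφ _ j

theorem hasSum_phaseSum {φ : ℂ} (hφ : ‖φ‖ ≤ 1) (n : ℕ) (a : EllOne) :
    HasSum (fun j : ℕ => a (n + 2 * j) * φ ^ j) (phaseSum n φ a) :=
  (summable_norm_phaseSum hφ n a).of_norm.hasSum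

/-- The indices `n + 2j` are distinct, so the sum is a partial `l¹` norm. The bound does not depend
on `n`; this uniformity is what yields values in `l^∞`. -/
theorem norm_phaseSum_le {φ : ℂ} (hφ : ‖φ‖ ≤ 1) (n : ℕ) (a : EllOne) :
    ‖phaseSum n φ a‖ ≤ ‖a‖ := by
  refine (norm_tsum_le_tsum_norm (summable_norm_phaseSum hφ n a)).trans ?_
  refine le_trans ?_ (tsum_norm_apply_add_two_mul_le a n)
  exact (summable_norm_phaseSum hφ n a).tsum_le_tsum (fun j => norm_mul_pow_le hφ _ j)
    (summable_norm_apply_add_two_mul a n)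

theorem phaseSum_sub {φ : ℂ} (hφ : ‖φ‖ ≤ 1) (n : ℕ) (a b : EllOne) :
    phaseSum n φ (a - b) = phaseSum n φ a - phaseSum n φ b := by
  have h := (hasSum_phaseSum hφ n a).sub (hasSum_phaseSum hφ n b)
  simp only [← sub_mul] at h
  exact (hasSum_phaseSum hφ n (a - b)).unique h

theorem phaseSum_zero (n : ℕ) (φ : ℂ) : phaseSum n φ 0 = 0 := by
  simp [phaseSum]

theorem continuous_phaseSum {φ : ℂ} (hφ : ‖φ‖ ≤ 1) (n : ℕ) : Continuous (phaseSum n φ) := by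
  refine (LipschitzWith.of_dist_le_mul (K := 1) fun a b => ?_).continuous
  rw [dist_eq_norm, ← phaseSum_sub hφ, NNReal.coe_one, one_mul, dist_eq_norm]
  exact norm_phaseSum_le hφ n _

theorem measurable_phaseSum {X : Type*} [MeasurableSpace X] {φ : X → ℂ} {a : X → EllOne}
    (hφ : Measurable φ) (hφ1 : ∀ x, ‖φ x‖ ≤ 1) (ha : ∀ m, Measurable fun x => a x m) (n : ℕ) :
    Measurable fun x => phaseSum n (φ x) (a x) := by
  refine measurable_of_tendsto_metrizable
    (f := fun N x => ∑ j ∈ Finset.range N, a x (n + 2 * j) * φ x ^ j) (fun N => ?_) ?_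
  · exact Finset.measurable_fun_sum _ fun j _ => (ha _).mul (hφ.pow_const j)
  · exact tendsto_pi_nhds.2 fun x => (hasSum_phaseSum (hφ1 x) n (a x)).tendsto_sum_nat

theorem aestronglyMeasurable_phaseSum {X : Type*} [MeasurableSpace X] {μ : Measure X} {φ : X → ℂ}
    {a : X → EllOne} (hφ : AEStronglyMeasurable φ μ) (hφ1 : ∀ x, ‖φ x‖ ≤ 1)
    (ha : ∀ m, AEStronglyMeasurable (fun x => a x m) μ) (n : ℕ) :
    AEStronglyMeasurable (fun x => phaseSum n (φ x) (a x)) μ := by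
  refine aestronglyMeasurable_of_tendsto_ae atTop
    (f := fun N x => ∑ j ∈ Finset.range N, a x (n + 2 * j) * φ x ^ j) (fun N => ?_) ?_
  · exact Finset.aestronglyMeasurable_fun_sum _ fun j _ => (ha _).mul (hφ.pow j)
  · exact Filter.Eventually.of_forall fun x => (hasSum_phaseSum (hφ1 x) n (a x)).tendsto_sum_nat

/-- Each term of the integrated series is integrable. -/
theorem integrable_mul_apply_mul_pow {X : Type*} [MeasurableSpace X] {μ : Measure X}
    {φ k : X → ℂ} {a : X → EllOne} (hk : Integrable k μ)
    (hφ : AEStronglyMeasurable φ μ) (hφ1 : ∀ x, ‖φ x‖ ≤ 1)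
    (ha : ∀ m, AEStronglyMeasurable (fun x => a x m) μ) {C : ℝ} (hC : ∀ᵐ x ∂μ, ‖a x‖ ≤ C)
    (m j : ℕ) :
    Integrable (fun x => k x * (a x m * φ x ^ j)) μ := by
  refine hk.mul_bdd (c := C) ((ha _).mul (hφ.pow j)) ?_
  filter_upwards [hC] with x hx
  exact (norm_mul_pow_le (hφ1 x) _ j).trans ((norm_apply_le _ _).trans hx)

theorem integrable_mul_phaseSum {X : Type*} [MeasurableSpace X] {μ : Measure X}
    {φ k : X → ℂ} {a : X → EllOne} (hk : Integrable k μ)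
    (hφ : AEStronglyMeasurable φ μ) (hφ1 : ∀ x, ‖φ x‖ ≤ 1)
    (ha : ∀ m, AEStronglyMeasurable (fun x => a x m) μ) {C : ℝ} (hC : ∀ᵐ x ∂μ, ‖a x‖ ≤ C)
    (n : ℕ) :
    Integrable (fun x => k x * phaseSum n (φ x) (a x)) μ := by
  refine hk.mul_bdd (c := C) (aestronglyMeasurable_phaseSum hφ hφ1 ha n) ?_
  filter_upwards [hC] with x hx
  exact (norm_phaseSum_le (hφ1 x) n _).trans hx

/-- Integration and summation may be interchanged in a phase sum. -/
theorem hasSum_integral_phaseSum {X : Type*} [MeasurableSpace X] {μ : Measure X}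
    {φ k : X → ℂ} {a : X → EllOne} (hk : Integrable k μ)
    (hφ : AEStronglyMeasurable φ μ) (hφ1 : ∀ x, ‖φ x‖ ≤ 1)
    (ha : ∀ m, AEStronglyMeasurable (fun x => a x m) μ) {C : ℝ} (hC : ∀ᵐ x ∂μ, ‖a x‖ ≤ C)
    (n : ℕ) :
    HasSum (fun j : ℕ => ∫ x, k x * (a x (n + 2 * j) * φ x ^ j) ∂μ)
      (∫ x, k x * phaseSum n (φ x) (a x) ∂μ) := by
  have hs : ∀ x, Summable fun j : ℕ => ‖k x‖ * ‖a x (n + 2 * j)‖ := fun x =>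
    (summable_norm_apply_add_two_mul (a x) n).mul_left _
  refine hasSum_integral_of_dominated_convergence (fun j x => ‖k x‖ * ‖a x (n + 2 * j)‖)
    (fun j => (integrable_mul_apply_mul_pow hk hφ hφ1 ha hC _ j).aestronglyMeasurable)
    (fun j => Filter.Eventually.of_forall fun x => ?_) (Filter.Eventually.of_forall hs) ?_
    (Filter.Eventually.of_forall fun x => (hasSum_phaseSum (hφ1 x) n (a x)).mul_left _)
  · rw [norm_mul]
    gcongr
    exact norm_mul_pow_le (hφ1 x) _ j
  · refine Integrable.mono' (hk.norm.mul_const C) ?_ ?_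
    · refine aestronglyMeasurable_of_tendsto_ae atTop
        (f := fun N x => ∑ j ∈ Finset.range N, ‖k x‖ * ‖a x (n + 2 * j)‖) (fun N => ?_) ?_
      · exact Finset.aestronglyMeasurable_fun_sum _ fun j _ =>
          hk.aestronglyMeasurable.norm.mul (ha _).norm
      · exact Filter.Eventually.of_forall fun x => (hs x).hasSum.tendsto_sum_nat
    · filter_upwards [hC] with x hx
      rw [tsum_mul_left, Real.norm_of_nonneg
        (mul_nonneg (norm_nonneg _) (tsum_nonneg fun _ => norm_nonneg _))]
      gcongr
      exact (tsum_norm_apply_add_two_mul_le (a x) n).trans hx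

theorem integral_exp_neg_two_mul_pow {j : ℕ} (hj : j ≠ 0) :
    ∫ α in (0 : ℝ)..(2 * Real.pi), Complex.exp (-2 * α * Complex.I) ^ j = 0 := by
  have hc : (-2 * j * Complex.I : ℂ) ≠ 0 := by simp [hj]
  have := integral_exp_mul_complex (a := 0) (b := 2 * Real.pi) hc
  have h1 : Complex.exp (-2 * j * Complex.I * (2 * Real.pi : ℝ)) = 1 :=
    Complex.exp_eq_one_iff.2 ⟨-2 * j, by push_cast; ring⟩
  rw [h1] at this
  simp only [Complex.ofReal_zero, mul_zero, Complex.exp_zero, sub_self, zero_div] at this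
  rw [← this]
  refine intervalIntegral.integral_congr fun α _ => ?_
  rw [← Complex.exp_nat_mul]
  congr 1
  ring

theorem norm_exp_neg_two_mul (α : ℝ) : ‖Complex.exp (-2 * α * Complex.I)‖ = 1 := by
  rw [show (-2 * α * Complex.I : ℂ) = ((-2 * α : ℝ) : ℂ) * Complex.I by push_cast; ring]
  exact Complex.norm_exp_ofReal_mul_I _

/-- The mean of a phase sum over the circle is its leading coefficient. -/
theorem integral_phaseSum_exp (n : ℕ) (a : EllOne) :
    ∫ α in (0 : ℝ)..(2 * Real.pi), phaseSum n (Complex.exp (-2 * α * Complex.I)) a =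
      2 * Real.pi * a n := by
  have hpi : (0 : ℝ) ≤ 2 * Real.pi := by positivity
  have hcont : Continuous fun α : ℝ => Complex.exp (-2 * α * Complex.I) := by fun_prop
  have h := hasSum_integral_phaseSum (X := ℝ) (μ := volume.restrict (Ioc 0 (2 * Real.pi)))
    (φ := fun α => Complex.exp (-2 * α * Complex.I)) (k := fun _ => 1) (a := fun _ => a)
    (integrable_const _) hcont.aestronglyMeasurable (fun α => (norm_exp_neg_two_mul α).le)
    (fun m => aestronglyMeasurable_const) (Filter.Eventually.of_forall fun _ => le_rfl) n
  simp only [one_mul, ← intervalIntegral.integral_of_le hpi,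
    intervalIntegral.integral_const_mul] at h
  refine h.unique ?_
  -- Only `j = 0` survives: for `j ≥ 1` the function `e^{-2ijα}` has mean zero over the circle.
  have h0 := hasSum_single (f := fun j : ℕ => a (n + 2 * j) *
    ∫ α in (0 : ℝ)..(2 * Real.pi), Complex.exp (-2 * α * Complex.I) ^ j) 0
    fun j hj => by rw [integral_exp_neg_two_mul_pow hj, mul_zero]
  convert h0 using 1
  simp
  ring

theorem tendsto_integral_mul_of_bounded {X ι : Type*} [MeasurableSpace X] {μ : Measure X}
    {l : Filter ι} [l.IsCountablyGenerated] {k : X → ℂ} (hk : Integrable k μ) {g : ι → X → ℂ}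
    {g₀ : X → ℂ} (hg : ∀ᶠ s in l, AEStronglyMeasurable (g s) μ) {C : ℝ}
    (hC : ∀ᶠ s in l, ∀ᵐ x ∂μ, ‖g s x‖ ≤ C)
    (hlim : ∀ᵐ x ∂μ, Tendsto (fun s => g s x) l (𝓝 (g₀ x))) :
    Tendsto (fun s => ∫ x, k x * g s x ∂μ) l (𝓝 (∫ x, k x * g₀ x ∂μ)) := by
  refine tendsto_integral_filter_of_dominated_convergence (fun x => ‖k x‖ * C) ?_ ?_
    (hk.norm.mul_const C) ?_
  · filter_upwards [hg] with s hs using hk.aestronglyMeasurable.mul hs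
  · filter_upwards [hC] with s hs
    filter_upwards [hs] with x hx
    rw [norm_mul]
    gcongr
  · filter_upwards [hlim] with x hx using hx.const_mul _

/-! ### Wirtinger calculus of the cut-off kernels. -/

theorem hasFDerivAt_wirtinger_mul {F G : ℂ → ℂ} {a b a' b' ζ : ℂ}
    (hF : HasFDerivAt F (wirtinger a b) ζ) (hG : HasFDerivAt G (wirtinger a' b') ζ) :
    HasFDerivAt (fun ζ => F ζ * G ζ) (wirtinger (F ζ * a' + G ζ * a) (F ζ * b' + G ζ * b)) ζ := by
  refine (hF.mul hG).congr_fderiv ?_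
  ext h
  simp
  ring

theorem hasFDerivAt_wirtinger_of_hasDerivAt {F : ℂ → ℂ} {a ζ : ℂ} (hF : HasDerivAt F a ζ) :
    HasFDerivAt F (wirtinger a 0) ζ := by
  refine (hF.hasFDerivAt.restrictScalars ℝ).congr_fderiv ?_
  ext h
  simp [mul_comm]

theorem hasFDerivAt_wirtinger_conj {F : ℂ → ℂ} {a b ζ : ℂ} (hF : HasFDerivAt F (wirtinger a b) ζ) :
    HasFDerivAt (fun ζ => conj (F ζ)) (wirtinger (conj b) (conj a)) ζ := by
  refine (Complex.conjCLE.hasFDerivAt.comp ζ hF).congr_fderiv ?_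
  ext h
  simp
  ring

/-- A differentiable cut-off function that vanishes on a neighbourhood of `(-∞, 0]`. -/
structure IsCutoff (X X' : ℝ → ℝ) (κ : ℝ) : Prop where
  pos : 0 < κ
  hasDerivAt : ∀ q, HasDerivAt X (X' q) q
  continuous_deriv : Continuous X'
  eq_zero : ∀ q ≤ κ, X q = 0

theorem IsCutoff.deriv_eq_zero {X X' : ℝ → ℝ} {κ : ℝ} (h : IsCutoff X X' κ) {q : ℝ} (hq : q < κ) :
    X' q = 0 := by
  refine (h.hasDerivAt q).unique ?_
  refine (hasDerivAt_const q (0 : ℝ)).congr_of_eventuallyEq ?_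
  filter_upwards [Iio_mem_nhds hq] with x hx using h.eq_zero x (le_of_lt hx)

theorem IsCutoff.continuous {X X' : ℝ → ℝ} {κ : ℝ} (h : IsCutoff X X' κ) : Continuous X :=
  continuous_iff_continuousAt.2 fun q => (h.hasDerivAt q).continuousAt

/-- The kernel `X(|t|²) t̄ⁱ t⁻ᵏ`, `t = ζ - z`. -/
def cutKernel (X : ℝ → ℝ) (z : ℂ) (i k : ℕ) (ζ : ℂ) : ℂ :=
  X (Complex.normSq (ζ - z)) * (conj (ζ - z) ^ i * ((ζ - z)⁻¹) ^ k)

theorem cutKernel_eq_zero {X : ℝ → ℝ} {κ : ℝ} (h : ∀ q < κ, X q = 0) (z : ℂ) (i k : ℕ) {ζ : ℂ}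
    (hζ : Complex.normSq (ζ - z) < κ) : cutKernel X z i k ζ = 0 := by
  simp [cutKernel, h _ hζ]

theorem eventually_normSq_sub_lt {κ : ℝ} (hκ : 0 < κ) (z : ℂ) :
    ∀ᶠ ζ in 𝓝 z, Complex.normSq (ζ - z) < κ := by
  have : Continuous fun ζ : ℂ => Complex.normSq (ζ - z) :=
    Complex.continuous_normSq.comp (by fun_prop)
  refine this.continuousAt.eventually_lt continuousAt_const ?_
  simpa using hκ

theorem continuous_cutKernel {X : ℝ → ℝ} {κ : ℝ} (hκ : 0 < κ) (h : ∀ q < κ, X q = 0)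
    (hX : Continuous X) (z : ℂ) (i k : ℕ) : Continuous (cutKernel X z i k) := by
  refine continuous_iff_continuousAt.2 fun ζ => ?_
  rcases eq_or_ne ζ z with rfl | hne
  · refine (continuousAt_const (y := (0 : ℂ))).congr ?_
    filter_upwards [eventually_normSq_sub_lt hκ ζ] with x hx
    exact (cutKernel_eq_zero h ζ i k hx).symm
  · have hc : Continuous fun ζ : ℂ => Complex.normSq (ζ - z) :=
      Complex.continuous_normSq.comp (by fun_prop)
    have h1 : ContinuousAt (fun ζ : ℂ => (ζ - z)⁻¹) ζ :=
      ContinuousAt.inv₀ (by fun_prop) (sub_ne_zero.2 hne)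
    exact (Complex.continuous_ofReal.comp (hX.comp hc)).continuousAt.mul
      (ContinuousAt.mul (Continuous.continuousAt (by fun_prop)) (h1.pow k))

theorem IsCutoff.hasFDerivAt_normSq {X X' : ℝ → ℝ} {κ : ℝ} (h : IsCutoff X X' κ) (z ζ : ℂ) :
    HasFDerivAt (fun ζ => (X (Complex.normSq (ζ - z)) : ℂ))
      (wirtinger (X' (Complex.normSq (ζ - z)) * conj (ζ - z))
        (X' (Complex.normSq (ζ - z)) * (ζ - z))) ζ := by
  have h1 : HasFDerivAt (fun ζ : ℂ => ζ - z) (wirtinger 1 0) ζ :=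
    hasFDerivAt_wirtinger_of_hasDerivAt ((hasDerivAt_id ζ).sub_const z)
  have h2 := hasFDerivAt_wirtinger_mul h1 (hasFDerivAt_wirtinger_conj h1)
  have h3 := Complex.reCLM.hasFDerivAt.comp ζ h2
  have h4 : HasFDerivAt (fun ζ : ℂ => Complex.normSq (ζ - z)) _ ζ :=
    h3.congr_of_eventuallyEq (Filter.Eventually.of_forall fun x => by
      simp only [Function.comp_apply, Complex.mul_conj, Complex.reCLM_apply, Complex.ofReal_re])
  have h5 := Complex.ofRealCLM.hasFDerivAt.comp ζ ((h.hasDerivAt _).comp_hasFDerivAt ζ h4)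
  refine h5.congr_fderiv ?_
  ext u
  apply Complex.ext <;> (simp; ring)

/-- Since `∂|t|² = t̄` and `∂̄|t|² = t`, differentiating the cut-off raises the power of `t̄` in the
`∂` part and lowers that of `t⁻¹` in the `∂̄` part. At `i = 0` the truncated exponent `i - 1` is
harmless because its coefficient is `i`. At `ζ = z` everything vanishes, as the kernel is zero
nearby. -/
theorem IsCutoff.hasFDerivAt_cutKernel {X X' : ℝ → ℝ} {κ : ℝ} (h : IsCutoff X X' κ) (z ζ : ℂ)
    (i k : ℕ) :
    HasFDerivAt (cutKernel X z i (k + 1))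
      (wirtinger (cutKernel X' z (i + 1) (k + 1) ζ - (k + 1) * cutKernel X z i (k + 2) ζ)
        (cutKernel X' z i k ζ + i * cutKernel X z (i - 1) (k + 1) ζ)) ζ := by
  have hX' : ∀ q < κ, X' q = 0 := fun q hq => h.deriv_eq_zero hq
  have hX : ∀ q < κ, X q = 0 := fun q hq => h.eq_zero q hq.le
  rcases eq_or_ne ζ z with rfl | hne
  · have h0 : Complex.normSq (ζ - ζ) < κ := by simpa using h.pos
    rw [cutKernel_eq_zero hX' ζ _ _ h0, cutKernel_eq_zero hX ζ _ _ h0,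
      cutKernel_eq_zero hX' ζ _ _ h0, cutKernel_eq_zero hX ζ _ _ h0]
    refine ((hasFDerivAt_const (0 : ℂ) ζ).congr_of_eventuallyEq ?_).congr_fderiv ?_
    · filter_upwards [eventually_normSq_sub_lt h.pos ζ] with x hx
      exact cutKernel_eq_zero hX ζ _ _ hx
    · ext u
      simp
  have ht : ζ - z ≠ 0 := sub_ne_zero.2 hne
  have h1 : HasDerivAt (fun ζ : ℂ => ζ - z) 1 ζ := (hasDerivAt_id ζ).sub_const z
  have h2 := hasFDerivAt_wirtinger_conj (hasFDerivAt_wirtinger_of_hasDerivAt (h1.pow i))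
  have h3 := hasFDerivAt_wirtinger_of_hasDerivAt ((h1.inv ht).pow (k + 1))
  have h4 := hasFDerivAt_wirtinger_mul (h.hasFDerivAt_normSq z ζ)
    (hasFDerivAt_wirtinger_mul h2 h3)
  refine (h4.congr_of_eventuallyEq (Filter.Eventually.of_forall fun x => ?_)).congr_fderiv ?_
  · simp [cutKernel]
  · have e1 : (ζ - z)⁻¹ ^ k = (ζ - z) * (ζ - z)⁻¹ ^ (k + 1) := by
      rw [pow_succ]; field_simp
    simp only [cutKernel, map_mul, map_pow, map_zero, map_one, map_natCast, Pi.inv_apply,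
      Nat.add_sub_cancel, Pi.pow_apply, map_sub]
    congr 1
    · rw [show (-1 / (ζ - z) ^ 2) = -((ζ - z)⁻¹ ^ 2) by field_simp]
      push_cast
      ring
    · rw [e1]
      ring

theorem cutKernel_self (X : ℝ → ℝ) (z ζ : ℂ) (i : ℕ) :
    cutKernel X z i i ζ = X (Complex.normSq (ζ - z)) * phase (ζ - z) ^ i := by
  rw [cutKernel, ← mul_pow, phase, div_eq_mul_inv]

theorem cutKernel_succ (X : ℝ → ℝ) (z ζ : ℂ) (i : ℕ) :
    cutKernel X z i (i + 1) ζ =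
      X (Complex.normSq (ζ - z)) * (ζ - z)⁻¹ * phase (ζ - z) ^ i := by
  rw [cutKernel, phase, div_eq_mul_inv, mul_pow, pow_succ]
  ring

namespace IsConvexDomain
variable {Ω : Set ℂ} {c : ℂ}

theorem integrableOn_of_continuousOn (h : IsConvexDomain Ω c) {g : ℂ → ℂ}
    (hg : ContinuousOn g (closure Ω)) : IntegrableOn g Ω :=
  (hg.integrableOn_compact h.isCompact_closure).mono_set subset_closure

theorem integrableOn_boundary (h : IsConvexDomain Ω c) {g : ℂ → ℂ}
    (hg : ContinuousOn g (closure Ω)) {k : ℝ → ℂ} (hk : Measurable k) {C : ℝ}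
    (hC : ∀ θ, ‖k θ‖ ≤ C) :
    IntegrableOn (fun θ => g (boundaryCurve Ω c θ) * k θ) (Ioc 0 (2 * Real.pi)) := by
  have h1 : Continuous fun θ => g (boundaryCurve Ω c θ) :=
    hg.comp_continuous h.continuous_boundaryCurve h.boundaryCurve_mem_closure
  obtain ⟨C', hC'⟩ := h.isCompact_closure.exists_bound_of_continuousOn hg
  refine IntegrableOn.of_bound measure_Ioc_lt_top
    (h1.aestronglyMeasurable.mul hk.aestronglyMeasurable) (C' * C)
    (Filter.Eventually.of_forall fun θ => ?_)
  have h2 := hC' _ (h.boundaryCurve_mem_closure θ)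
  rw [norm_mul]
  exact mul_le_mul h2 (hC θ) (norm_nonneg _) ((norm_nonneg _).trans h2)

/-- Green's formula for the zeroth kernel. -/
theorem green_cutKernel_zero (h : IsConvexDomain Ω c) {X X' : ℝ → ℝ} {κ : ℝ}
    (hX : IsCutoff X X' κ) (z : ℂ) {f f₁ f₂ : ℂ → ℂ}
    (hf : ∀ ζ ∈ closure Ω, HasFDerivAt f (wirtinger (f₁ ζ) (f₂ ζ)) ζ)
    (hf₁ : ContinuousOn f₁ (closure Ω)) (hf₂ : ContinuousOn f₂ (closure Ω)) :
    2 * Complex.I * ((∫ ζ in Ω, cutKernel X' z 0 0 ζ * f ζ) +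
        ∫ ζ in Ω, cutKernel X z 0 1 ζ * f₂ ζ) =
      ∫ θ in (0 : ℝ)..(2 * Real.pi), cutKernel X z 0 1 (boundaryCurve Ω c θ) *
        f (boundaryCurve Ω c θ) * deriv (boundaryCurve Ω c) θ := by
  have hfc : ContinuousOn f (closure Ω) := fun ζ hζ => (hf ζ hζ).continuousAt.continuousWithinAt
  have hc : ∀ i k, ContinuousOn (cutKernel X z i k) (closure Ω) := fun i k =>
    (continuous_cutKernel hX.pos (fun q hq => hX.eq_zero q hq.le) hX.continuous z i k).continuousOn
  have hc' : ∀ i k, ContinuousOn (cutKernel X' z i k) (closure Ω) := fun i k =>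
    (continuous_cutKernel hX.pos (fun q hq => hX.deriv_eq_zero hq)
      hX.continuous_deriv z i k).continuousOn
  have hG := h.green (fun ζ hζ => hasFDerivAt_wirtinger_mul (hX.hasFDerivAt_cutKernel z ζ 0 0)
    (hf ζ hζ)) (((hc 0 1).mul hf₁).add (hfc.mul (((hc' _ _).sub (continuousOn_const.mul (hc _ _))))))
    (((hc 0 1).mul hf₂).add (hfc.mul (((hc' _ _).add (continuousOn_const.mul (hc _ _)))))) 1 0
  have hI₁ : IntegrableOn (fun ζ => cutKernel X' z 0 0 ζ * f ζ) Ω :=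
    h.integrableOn_of_continuousOn ((hc' 0 0).mul hfc)
  have hI₂ : IntegrableOn (fun ζ => cutKernel X z 0 1 ζ * f₂ ζ) Ω :=
    h.integrableOn_of_continuousOn ((hc 0 1).mul hf₂)
  rw [← integral_add hI₁ hI₂]
  simp only [one_mul, zero_mul, sub_zero, add_zero, Nat.cast_zero, zero_add] at hG
  rw [← hG]
  congr 1
  refine integral_congr_ae (Filter.Eventually.of_forall fun ζ => ?_)
  simp only
  ring

/-- Green's formula for a pair of consecutive kernels. -/
theorem green_cutKernel_succ (h : IsConvexDomain Ω c) {X X' : ℝ → ℝ} {κ : ℝ}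
    (hX : IsCutoff X X' κ) (z : ℂ) {f f₁ f₂ : ℂ → ℂ}
    (hf : ∀ ζ ∈ closure Ω, HasFDerivAt f (wirtinger (f₁ ζ) (f₂ ζ)) ζ)
    (hf₁ : ContinuousOn f₁ (closure Ω)) (hf₂ : ContinuousOn f₂ (closure Ω)) (i : ℕ) :
    2 * Complex.I * (2 * (∫ ζ in Ω, cutKernel X' z (i + 1) (i + 1) ζ * f ζ) +
        (∫ ζ in Ω, cutKernel X z (i + 1) (i + 2) ζ * f₂ ζ) +
        ∫ ζ in Ω, cutKernel X z i (i + 1) ζ * f₁ ζ) =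
      ∫ θ in (0 : ℝ)..(2 * Real.pi), (cutKernel X z (i + 1) (i + 2) (boundaryCurve Ω c θ) *
          deriv (boundaryCurve Ω c) θ - cutKernel X z i (i + 1) (boundaryCurve Ω c θ) *
          conj (deriv (boundaryCurve Ω c) θ)) * f (boundaryCurve Ω c θ) := by
  have hpi : (0 : ℝ) ≤ 2 * Real.pi := by positivity
  have hfc : ContinuousOn f (closure Ω) := fun ζ hζ => (hf ζ hζ).continuousAt.continuousWithinAt
  have hc : ∀ i k, ContinuousOn (cutKernel X z i k) (closure Ω) := fun i k =>
    (continuous_cutKernel hX.pos (fun q hq => hX.eq_zero q hq.le) hX.continuous z i k).continuousOn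
  have hc' : ∀ i k, ContinuousOn (cutKernel X' z i k) (closure Ω) := fun i k =>
    (continuous_cutKernel hX.pos (fun q hq => hX.deriv_eq_zero hq)
      hX.continuous_deriv z i k).continuousOn
  obtain ⟨K, hK0, hK⟩ := h.exists_norm_deriv_boundaryCurve_le
  have hm : Measurable (deriv (boundaryCurve Ω c)) := measurable_deriv _
  have hA : ∀ k, ContinuousOn (fun ζ => cutKernel X z k (k + 1) ζ * f₁ ζ +
      f ζ * (cutKernel X' z (k + 1) (k + 1) ζ - (k + 1) * cutKernel X z k (k + 2) ζ)) (closure Ω) :=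
    fun k => ((hc _ _).mul hf₁).add
      (hfc.mul (((hc' _ _).sub (continuousOn_const.mul (hc _ _)))))
  have hB : ∀ k, ContinuousOn (fun ζ => cutKernel X z k (k + 1) ζ * f₂ ζ +
      f ζ * (cutKernel X' z k k ζ + k * cutKernel X z (k - 1) (k + 1) ζ)) (closure Ω) :=
    fun k => ((hc _ _).mul hf₂).add
      (hfc.mul (((hc' _ _).add (continuousOn_const.mul (hc _ _)))))
  -- One kernel is integrated against `dζ`, the other against `-dζ̄`. Their contributions `± (i + 1)
  -- f t̄ⁱ t⁻ⁱ⁻²` cancel, while the two cut-off terms `X' φⁱ⁺¹ f` coincide and give the factor 2.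
  have hG₁ := h.green (fun ζ hζ => hasFDerivAt_wirtinger_mul
    (hX.hasFDerivAt_cutKernel z ζ (i + 1) (i + 1)) (hf ζ hζ)) (hA (i + 1)) (hB (i + 1)) 1 0
  have hG₂ := h.green (fun ζ hζ => hasFDerivAt_wirtinger_mul
    (hX.hasFDerivAt_cutKernel z ζ i i) (hf ζ hζ)) (hA i) (hB i) 0 (-1)
  simp only [one_mul, zero_mul, sub_zero, add_zero, zero_add, zero_sub, neg_mul, neg_neg]
    at hG₁ hG₂
  have hI₁ : IntegrableOn (fun ζ => cutKernel X' z (i + 1) (i + 1) ζ * f ζ) Ω :=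
    h.integrableOn_of_continuousOn ((hc' (i + 1) (i + 1)).mul hfc)
  have hI₂ : IntegrableOn (fun ζ => cutKernel X z (i + 1) (i + 2) ζ * f₂ ζ) Ω :=
    h.integrableOn_of_continuousOn ((hc (i + 1) (i + 2)).mul hf₂)
  have hI₃ : IntegrableOn (fun ζ => cutKernel X z i (i + 1) ζ * f₁ ζ) Ω :=
    h.integrableOn_of_continuousOn ((hc i (i + 1)).mul hf₁)
  have hJ₁ : IntegrableOn (fun θ => cutKernel X z (i + 1) (i + 2) (boundaryCurve Ω c θ) *
      f (boundaryCurve Ω c θ) * deriv (boundaryCurve Ω c) θ) (Ioc 0 (2 * Real.pi)) :=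
    h.integrableOn_boundary ((hc (i + 1) (i + 2)).mul hfc) hm hK
  have hJ₂ : IntegrableOn (fun θ => cutKernel X z i (i + 1) (boundaryCurve Ω c θ) *
      f (boundaryCurve Ω c θ) * -conj (deriv (boundaryCurve Ω c) θ)) (Ioc 0 (2 * Real.pi)) :=
    h.integrableOn_boundary ((hc i (i + 1)).mul hfc)
    (k := fun θ => -conj (deriv (boundaryCurve Ω c) θ))
    (Complex.continuous_conj.measurable.comp hm).neg
    (fun θ => by rw [norm_neg, RCLike.norm_conj]; exact hK θ)
  have hsum := congrArg₂ (· + ·) hG₁ hG₂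
  rw [← mul_add, ← integral_add (h.integrableOn_of_continuousOn (hB (i + 1)))
    (h.integrableOn_of_continuousOn (hA i)), intervalIntegral.integral_of_le hpi,
    intervalIntegral.integral_of_le hpi, ← integral_add hJ₁ hJ₂,
    ← intervalIntegral.integral_of_le hpi] at hsum
  calc _ = _ := by
        have hI₄ : IntegrableOn (fun ζ => 2 * (cutKernel X' z (i + 1) (i + 1) ζ * f ζ) +
          cutKernel X z (i + 1) (i + 2) ζ * f₂ ζ) Ω := (hI₁.const_mul 2).add hI₂
        rw [← integral_const_mul, ← integral_add (hI₁.const_mul 2) hI₂, ← integral_add hI₄ hI₃]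
        congr 1
        refine integral_congr_ae (Filter.Eventually.of_forall fun ζ => ?_)
        simp only [Nat.add_sub_cancel]
        push_cast
        ring
    _ = _ := hsum
    _ = _ := by
        refine intervalIntegral.integral_congr fun θ _ => ?_
        ring

end IsConvexDomain

/-! ### The Bukhgeim-Pompeiu identity with a cut-off. -/

/-- Every real-linear map of `ℂ` is of the form `h ↦ a h + b h̄`. -/
theorem eq_wirtinger (M : ℂ →L[ℝ] ℂ) :
    M = wirtinger (1 / 2 * (M 1 - Complex.I * M Complex.I))
      (1 / 2 * (M 1 + Complex.I * M Complex.I)) := by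
  ext u
  have h1 : M u = u.re * M 1 + u.im * M Complex.I := by
    conv_lhs => rw [show u = u.re • (1 : ℂ) + u.im • Complex.I by
      simp only [Complex.real_smul, mul_one]; exact (Complex.re_add_im _).symm]
    rw [map_add, map_smul, map_smul, Complex.real_smul, Complex.real_smul]
  have h2 : conj u = u.re - u.im * Complex.I := by
    apply Complex.ext <;> simp
  rw [h1, wirtinger_apply, h2]
  conv_rhs => rw [← Complex.re_add_im u]
  simp only [Complex.add_re, Complex.add_im, Complex.ofReal_re, Complex.ofReal_im, Complex.mul_re,
    Complex.mul_im, Complex.I_re, Complex.I_im, mul_zero, mul_one, sub_zero, add_zero, zero_add]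
  linear_combination ((u.im : ℂ) * M Complex.I) * Complex.I_mul_I

/-- The components of a differentiable map into `l¹`. -/
theorem hasFDerivAt_apply {v : ℂ → EllOne} {ζ : ℂ} (hv : DifferentiableAt ℝ v ζ) (m : ℕ) :
    HasFDerivAt (fun ζ => v ζ m) (wirtinger (dz v ζ m) (dzbar v ζ m)) ζ := by
  let L : EllOne →L[ℝ] ℂ := (lp.evalCLM ℂ (fun _ : ℕ => ℂ) 1 m).restrictScalars ℝ
  have h1 : HasFDerivAt (fun ζ => v ζ m) (L.comp (fderiv ℝ v ζ)) ζ :=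
    L.hasFDerivAt.comp ζ hv.hasFDerivAt
  rw [eq_wirtinger (L.comp (fderiv ℝ v ζ))] at h1
  exact h1

/-- The kernel `X(|t|²) (dζ / t - dζ̄ / t̄)` on the boundary curve. -/
def cutAngular (Ω : Set ℂ) (c : ℂ) (X : ℝ → ℝ) (z : ℂ) (θ : ℝ) : ℂ :=
  X (Complex.normSq (boundaryCurve Ω c θ - z)) *
    (deriv (boundaryCurve Ω c) θ / (boundaryCurve Ω c θ - z) -
      conj (deriv (boundaryCurve Ω c) θ) / conj (boundaryCurve Ω c θ - z))

/-- The kernel `X(|t|²) dζ / t` on the boundary curve. -/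
def cutCauchy (Ω : Set ℂ) (c : ℂ) (X : ℝ → ℝ) (z : ℂ) (θ : ℝ) : ℂ :=
  X (Complex.normSq (boundaryCurve Ω c θ - z)) *
    (deriv (boundaryCurve Ω c) θ / (boundaryCurve Ω c θ - z))

theorem IsCutoff.continuous_cutKernel {X X' : ℝ → ℝ} {κ : ℝ} (hX : IsCutoff X X' κ) (z : ℂ)
    (i k : ℕ) : Continuous (cutKernel X z i k) :=
  BukhgeimPompeiu.continuous_cutKernel hX.pos (fun q hq => hX.eq_zero q hq.le) hX.continuous z i k

theorem IsCutoff.continuous_cutKernel_deriv {X X' : ℝ → ℝ} {κ : ℝ} (hX : IsCutoff X X' κ) (z : ℂ)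
    (i k : ℕ) : Continuous (cutKernel X' z i k) :=
  BukhgeimPompeiu.continuous_cutKernel hX.pos (fun _ hq => hX.deriv_eq_zero hq)
    hX.continuous_deriv z i k

namespace IsConvexDomain
variable {Ω : Set ℂ} {c : ℂ}

theorem aestronglyMeasurable_apply (h : IsConvexDomain Ω c) {a : ℂ → EllOne}
    (ha : ContinuousOn a Ω) (m : ℕ) :
    AEStronglyMeasurable (fun ζ => a ζ m) (volume.restrict Ω) :=
  ((continuous_apply m).comp_continuousOn ha).aestronglyMeasurable h.isOpen.measurableSet

theorem exists_bound (h : IsConvexDomain Ω c) {a : ℂ → EllOne} (ha : ContinuousOn a (closure Ω)) :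
    ∃ C : ℝ, 0 ≤ C ∧ ∀ ζ ∈ closure Ω, ‖a ζ‖ ≤ C := by
  obtain ⟨C, hC⟩ := h.isCompact_closure.exists_bound_of_continuousOn ha
  exact ⟨C, (norm_nonneg _).trans (hC c (subset_closure h.mem)), hC⟩

theorem ae_restrict_of_closure {p : ℂ → Prop} (h : IsConvexDomain Ω c)
    (hp : ∀ ζ ∈ closure Ω, p ζ) : ∀ᵐ ζ ∂volume.restrict Ω, p ζ :=
  ae_restrict_of_forall_mem h.isOpen.measurableSet fun ζ hζ => hp ζ (subset_closure hζ)

theorem continuous_comp_boundaryCurve (h : IsConvexDomain Ω c) {E : Type*} [TopologicalSpace E]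
    {a : ℂ → E} (ha : ContinuousOn a (closure Ω)) :
    Continuous fun θ => a (boundaryCurve Ω c θ) :=
  ha.comp_continuous h.continuous_boundaryCurve h.boundaryCurve_mem_closure

theorem measurable_phase_boundaryCurve (h : IsConvexDomain Ω c) (z : ℂ) :
    Measurable fun θ => phase (boundaryCurve Ω c θ - z) :=
  measurable_phase.comp (h.continuous_boundaryCurve.measurable.sub_const z)

theorem measurable_phase_sub (z : ℂ) : Measurable fun ζ : ℂ => phase (ζ - z) :=
  measurable_phase.comp (measurable_id.sub_const z)

theorem integrableOn_cutCauchy (h : IsConvexDomain Ω c) {X X' : ℝ → ℝ} {κ : ℝ}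
    (hX : IsCutoff X X' κ) (z : ℂ) :
    IntegrableOn (cutCauchy Ω c X z) (Ioc 0 (2 * Real.pi)) := by
  obtain ⟨K, hK0, hK⟩ := h.exists_norm_deriv_boundaryCurve_le
  refine (h.integrableOn_boundary (hX.continuous_cutKernel z 0 1).continuousOn
    (measurable_deriv (boundaryCurve Ω c)) hK).congr_fun (fun θ _ => ?_) measurableSet_Ioc
  simp only [cutKernel, cutCauchy, pow_zero, pow_one, one_mul, div_eq_mul_inv]
  ring

theorem integrableOn_cutAngular (h : IsConvexDomain Ω c) {X X' : ℝ → ℝ} {κ : ℝ}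
    (hX : IsCutoff X X' κ) (z : ℂ) :
    IntegrableOn (cutAngular Ω c X z) (Ioc 0 (2 * Real.pi)) := by
  have h1 := h.integrableOn_cutCauchy hX z
  have h2 := Complex.conjCLE.toContinuousLinearMap.integrable_comp h1
  refine (h1.sub h2).congr (Filter.Eventually.of_forall fun θ => ?_)
  simp [cutAngular, cutCauchy]
  ring

theorem integrableOn_cutKernel (h : IsConvexDomain Ω c) {X X' : ℝ → ℝ} {κ : ℝ}
    (hX : IsCutoff X X' κ) (z : ℂ) (i k : ℕ) : IntegrableOn (cutKernel X z i k) Ω :=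
  h.integrableOn_of_continuousOn (hX.continuous_cutKernel z i k).continuousOn

theorem integrableOn_cutKernel_deriv (h : IsConvexDomain Ω c) {X X' : ℝ → ℝ} {κ : ℝ}
    (hX : IsCutoff X X' κ) (z : ℂ) (i k : ℕ) : IntegrableOn (cutKernel X' z i k) Ω :=
  h.integrableOn_of_continuousOn (hX.continuous_cutKernel_deriv z i k).continuousOn

/-- The Bukhgeim-Pompeiu identity with a cut-off kernel, for maps that are continuously
differentiable up to the boundary. -/
theorem cutoff_identity_of_differentiableAt (h : IsConvexDomain Ω c) {X X' : ℝ → ℝ} {κ : ℝ}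
    (hX : IsCutoff X X' κ) (z : ℂ) {v w : ℂ → EllOne}
    (hv : ∀ ζ ∈ closure Ω, DifferentiableAt ℝ v ζ)
    (hdv : ContinuousOn (fderiv ℝ v) (closure Ω))
    (hw : ∀ ζ ∈ Ω, ∀ m, w ζ m = dzbar v ζ m + dz v ζ (m + 2)) (n : ℕ) :
    2 * Complex.I * (2 * (∫ ζ in Ω, cutKernel X' z 0 0 ζ * phaseSum n (phase (ζ - z)) (v ζ)) -
        (∫ ζ in Ω, cutKernel X' z 0 0 ζ * v ζ n) +
        ∫ ζ in Ω, cutKernel X z 0 1 ζ * phaseSum n (phase (ζ - z)) (w ζ)) =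
      (∫ θ in Ioc 0 (2 * Real.pi), cutAngular Ω c X z θ *
        phaseSum n (phase (boundaryCurve Ω c θ - z)) (v (boundaryCurve Ω c θ))) -
      (∫ θ in Ioc 0 (2 * Real.pi), cutAngular Ω c X z θ * v (boundaryCurve Ω c θ) n) +
      ∫ θ in Ioc 0 (2 * Real.pi), cutCauchy Ω c X z θ * v (boundaryCurve Ω c θ) n := by
  have hpi : (0 : ℝ) ≤ 2 * Real.pi := by positivity
  have hvc : ContinuousOn v (closure Ω) := fun ζ hζ => (hv ζ hζ).continuousAt.continuousWithinAt
  have hdz : ContinuousOn (dz v) (closure Ω) :=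
    ((hdv.clm_apply continuousOn_const).sub
      ((hdv.clm_apply continuousOn_const).const_smul Complex.I)).const_smul (1 / 2 : ℂ)
  have hdzbar : ContinuousOn (dzbar v) (closure Ω) :=
    ((hdv.clm_apply continuousOn_const).add
      ((hdv.clm_apply continuousOn_const).const_smul Complex.I)).const_smul (1 / 2 : ℂ)
  obtain ⟨C, -, hC⟩ := h.exists_bound hvc
  obtain ⟨C₁, -, hC₁⟩ := h.exists_bound hdz
  obtain ⟨C₂, -, hC₂⟩ := h.exists_bound hdzbar
  have hφ : AEStronglyMeasurable (fun ζ => phase (ζ - z)) (volume.restrict Ω) :=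
    (measurable_phase_sub z).aestronglyMeasurable
  have S₁ := hasSum_integral_phaseSum (h.integrableOn_cutKernel_deriv hX z 0 0) hφ
    (fun _ => norm_phase_le _) (h.aestronglyMeasurable_apply (hvc.mono subset_closure))
    (h.ae_restrict_of_closure hC) n
  have S₂ := hasSum_integral_phaseSum (h.integrableOn_cutKernel hX z 0 1) hφ
    (fun _ => norm_phase_le _) (h.aestronglyMeasurable_apply (hdzbar.mono subset_closure))
    (h.ae_restrict_of_closure hC₂) n
  have S₃ := hasSum_integral_phaseSum (h.integrableOn_cutKernel hX z 0 1) hφ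
    (fun _ => norm_phase_le _) (h.aestronglyMeasurable_apply (hdz.mono subset_closure))
    (h.ae_restrict_of_closure hC₁) (n + 2)
  have S₄ := hasSum_integral_phaseSum (h.integrableOn_cutAngular hX z)
    (h.measurable_phase_boundaryCurve z).aestronglyMeasurable (fun _ => norm_phase_le _)
    (fun m => ((continuous_apply m).comp
      (h.continuous_comp_boundaryCurve hvc)).aestronglyMeasurable)
    (Filter.Eventually.of_forall fun θ => hC _ (h.boundaryCurve_mem_closure θ)) n
  have hf : ∀ m, ∀ ζ ∈ closure Ω,
      HasFDerivAt (fun ζ => v ζ m) (wirtinger (dz v ζ m) (dzbar v ζ m)) ζ :=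
    fun m ζ hζ => hasFDerivAt_apply (hv ζ hζ) m
  have hf₁ : ∀ m, ContinuousOn (fun ζ => dz v ζ m) (closure Ω) := fun m =>
    (continuous_apply m).comp_continuousOn hdz
  have hf₂ : ∀ m, ContinuousOn (fun ζ => dzbar v ζ m) (closure Ω) := fun m =>
    (continuous_apply m).comp_continuousOn hdzbar
  have G₀ := h.green_cutKernel_zero hX z (hf n) (hf₁ n) (hf₂ n)
  have G := fun i : ℕ => h.green_cutKernel_succ hX z (hf (n + 2 * (i + 1)))
    (hf₁ (n + 2 * (i + 1))) (hf₂ (n + 2 * (i + 1))) i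
  -- The double shift in the equation becomes the change from `n` to `n + 2` in the phase sum of
  -- `∂v`.
  have hw' : ∀ ζ ∈ Ω, phaseSum n (phase (ζ - z)) (w ζ) =
      phaseSum n (phase (ζ - z)) (dzbar v ζ) + phaseSum (n + 2) (phase (ζ - z)) (dz v ζ) := by
    intro ζ hζ
    refine (hasSum_phaseSum (norm_phase_le _) n (w ζ)).unique ?_
    have := (hasSum_phaseSum (norm_phase_le (ζ - z)) n (dzbar v ζ)).add
      (hasSum_phaseSum (norm_phase_le (ζ - z)) (n + 2) (dz v ζ))
    refine this.congr_fun fun j => ?_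
    rw [hw ζ hζ, show n + 2 + 2 * j = n + 2 * j + 2 by ring]
    ring
  have hWint : ∫ ζ in Ω, cutKernel X z 0 1 ζ * phaseSum n (phase (ζ - z)) (w ζ) =
      (∫ ζ in Ω, cutKernel X z 0 1 ζ * phaseSum n (phase (ζ - z)) (dzbar v ζ)) +
      ∫ ζ in Ω, cutKernel X z 0 1 ζ * phaseSum (n + 2) (phase (ζ - z)) (dz v ζ) := by
    rw [← integral_add]
    · refine setIntegral_congr_fun h.isOpen.measurableSet fun ζ hζ => ?_
      rw [hw' ζ hζ]
      ring
    · exact integrable_mul_phaseSum (h.integrableOn_cutKernel hX z 0 1) hφ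
        (fun _ => norm_phase_le _) (h.aestronglyMeasurable_apply (hdzbar.mono subset_closure))
        (h.ae_restrict_of_closure hC₂) n
    · exact integrable_mul_phaseSum (h.integrableOn_cutKernel hX z 0 1) hφ
        (fun _ => norm_phase_le _) (h.aestronglyMeasurable_apply (hdz.mono subset_closure))
        (h.ae_restrict_of_closure hC₁) (n + 2)
  -- The `j = 0` terms are split off here and treated by `G₀`. The series `S₃` is kept whole: its
  -- `i`-th term, with `∂v₋ₙ₋₂₍ᵢ₊₁₎ φⁱ`, belongs to the Green identity for `j = i + 1`.
  have T₁ := (hasSum_nat_add_iff' 1).2 S₁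
  have T₂ := (hasSum_nat_add_iff' 1).2 S₂
  have T₄ := (hasSum_nat_add_iff' 1).2 S₄
  have hT := (((T₁.mul_left 2).add T₂).add S₃).mul_left (2 * Complex.I)
  have hterm : ∀ i : ℕ, 2 * Complex.I * (2 * (∫ ζ in Ω, cutKernel X' z 0 0 ζ *
        (v ζ (n + 2 * (i + 1)) * phase (ζ - z) ^ (i + 1))) +
        (∫ ζ in Ω, cutKernel X z 0 1 ζ *
          (dzbar v ζ (n + 2 * (i + 1)) * phase (ζ - z) ^ (i + 1))) +
        ∫ ζ in Ω, cutKernel X z 0 1 ζ * (dz v ζ (n + 2 + 2 * i) * phase (ζ - z) ^ i)) =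
      ∫ θ in Ioc 0 (2 * Real.pi), cutAngular Ω c X z θ *
        (v (boundaryCurve Ω c θ) (n + 2 * (i + 1)) *
          phase (boundaryCurve Ω c θ - z) ^ (i + 1)) := by
    intro i
    have hi := G i
    rw [intervalIntegral.integral_of_le hpi] at hi
    convert hi using 1
    · rw [show n + 2 + 2 * i = n + 2 * (i + 1) by ring]
      congr 2
      · congr 1
        · congr 1
          refine integral_congr_ae (Filter.Eventually.of_forall fun ζ => ?_)
          simp only [cutKernel_self, pow_zero]
          ring
        · refine integral_congr_ae (Filter.Eventually.of_forall fun ζ => ?_)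
          have e₁ : cutKernel X z (i + 1) (i + 2) ζ = _ := cutKernel_succ X z ζ (i + 1)
          have e₂ : cutKernel X z 0 1 ζ = _ := cutKernel_succ X z ζ 0
          beta_reduce
          rw [e₁, e₂]
          ring
      · refine integral_congr_ae (Filter.Eventually.of_forall fun ζ => ?_)
        have e₁ : cutKernel X z i (i + 1) ζ = _ := cutKernel_succ X z ζ i
        have e₂ : cutKernel X z 0 1 ζ = _ := cutKernel_succ X z ζ 0
        beta_reduce
        rw [e₁, e₂]
        ring
    · refine integral_congr_ae ?_
      filter_upwards [ae_restrict_of_ae (h.ae_boundaryCurve_ne z)] with θ hθ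
      rw [cutKernel_succ X z _ (i + 1), cutKernel_succ X z _ i, cutAngular, phase]
      have hθ' : conj (boundaryCurve Ω c θ - z) ≠ 0 := (map_ne_zero _).2 hθ
      generalize conj (boundaryCurve Ω c θ - z) = t' at *
      generalize boundaryCurve Ω c θ - z = t at *
      rw [pow_succ (t' / t) i]
      field_simp
  simp only [hterm] at hT
  have key := hT.unique T₄
  simp only [Finset.sum_range_one, mul_zero, add_zero, pow_zero, mul_one] at key
  have hG₀' : ∫ θ in (0 : ℝ)..(2 * Real.pi), cutKernel X z 0 1 (boundaryCurve Ω c θ) *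
        v (boundaryCurve Ω c θ) n * deriv (boundaryCurve Ω c) θ =
      ∫ θ in Ioc 0 (2 * Real.pi), cutCauchy Ω c X z θ * v (boundaryCurve Ω c θ) n := by
    rw [intervalIntegral.integral_of_le hpi]
    refine integral_congr_ae (Filter.Eventually.of_forall fun θ => ?_)
    simp only [cutKernel_succ X z _ 0, cutCauchy]
    ring
  rw [hG₀'] at G₀
  rw [hWint]
  linear_combination key + G₀

theorem shrink_fderiv {v : ℂ → EllOne} {s : ℝ} {x : ℂ}
    (hv : DifferentiableAt ℝ v (c + s * (x - c))) :
    HasFDerivAt (fun x : ℂ => v (c + s * (x - c))) (s • fderiv ℝ v (c + s * (x - c))) x := by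
  have h1 : HasFDerivAt (fun x : ℂ => c + s * (x - c)) (s • ContinuousLinearMap.id ℝ ℂ) x := by
    have := (((hasFDerivAt_id (𝕜 := ℝ) x).sub_const c).const_smul s).const_add c
    exact this
  refine (hv.hasFDerivAt.comp x h1).congr_fderiv ?_
  ext u
  simp

/-- The Bukhgeim-Pompeiu identity with a cut-off kernel. -/
theorem cutoff_identity (h : IsConvexDomain Ω c) {X X' : ℝ → ℝ} {κ : ℝ}
    (hX : IsCutoff X X' κ) (z : ℂ) {v w : ℂ → EllOne} (hwc : ContinuousOn w (closure Ω))
    (hv1 : ContDiffOn ℝ 1 v Ω) (hvc : ContinuousOn v (closure Ω))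
    (hw : ∀ ζ ∈ Ω, ∀ m, w ζ m = dzbar v ζ m + dz v ζ (m + 2)) (n : ℕ) :
    2 * Complex.I * (2 * (∫ ζ in Ω, cutKernel X' z 0 0 ζ * phaseSum n (phase (ζ - z)) (v ζ)) -
        (∫ ζ in Ω, cutKernel X' z 0 0 ζ * v ζ n) +
        ∫ ζ in Ω, cutKernel X z 0 1 ζ * phaseSum n (phase (ζ - z)) (w ζ)) =
      (∫ θ in Ioc 0 (2 * Real.pi), cutAngular Ω c X z θ *
        phaseSum n (phase (boundaryCurve Ω c θ - z)) (v (boundaryCurve Ω c θ))) -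
      (∫ θ in Ioc 0 (2 * Real.pi), cutAngular Ω c X z θ * v (boundaryCurve Ω c θ) n) +
      ∫ θ in Ioc 0 (2 * Real.pi), cutCauchy Ω c X z θ * v (boundaryCurve Ω c θ) n := by
  obtain ⟨C, hC0, hC⟩ := h.exists_bound hvc
  obtain ⟨C', hC'0, hC'⟩ := h.exists_bound hwc
  have hs : ∀ᶠ s : ℝ in 𝓝[<] 1, 0 < s ∧ s < 1 := by
    filter_upwards [Ioo_mem_nhdsLT (zero_lt_one' ℝ)] with s hs using hs
  have hmaps : ∀ s : ℝ, 0 < s ∧ s < 1 →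
      MapsTo (fun x : ℂ => c + s * (x - c)) (closure Ω) (closure Ω) := fun s hs x hx =>
    h.shrink_mem_closure hs.1.le hs.2.le hx
  have hcont : ∀ (a : ℂ → EllOne), ContinuousOn a (closure Ω) → ∀ s : ℝ, 0 < s ∧ s < 1 →
      ContinuousOn (fun x : ℂ => a (c + s * (x - c))) (closure Ω) := fun a ha s hs =>
    ha.comp (Continuous.continuousOn (by fun_prop)) (hmaps s hs)
  have hlim : ∀ (a : ℂ → EllOne), ContinuousOn a (closure Ω) → ∀ x ∈ closure Ω,
      Tendsto (fun s : ℝ => a (c + s * (x - c))) (𝓝[<] 1) (𝓝 (a x)) := by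
    intro a ha x hx
    refine (ha x hx).tendsto.comp (tendsto_nhdsWithin_iff.2 ⟨?_, ?_⟩)
    · have : Continuous fun s : ℝ => c + (s : ℂ) * (x - c) := by fun_prop
      have h1 := this.tendsto 1
      simp only [Complex.ofReal_one, one_mul, add_sub_cancel] at h1
      exact h1.mono_left nhdsWithin_le_nhds
    · filter_upwards [hs] with s hs using hmaps s hs hx
  have hφ : AEStronglyMeasurable (fun ζ => phase (ζ - z)) (volume.restrict Ω) :=
    (measurable_phase_sub z).aestronglyMeasurable
  have hφ' := (h.measurable_phase_boundaryCurve z).aestronglyMeasurable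
    (μ := volume.restrict (Ioc 0 (2 * Real.pi)))
  have hmeas' : ∀ (a : ℂ → EllOne), ContinuousOn a (closure Ω) → ∀ m, AEStronglyMeasurable
      (fun θ => a (boundaryCurve Ω c θ) m) (volume.restrict (Ioc 0 (2 * Real.pi))) :=
    fun a ha m => ((continuous_apply m).comp
      (h.continuous_comp_boundaryCurve ha)).aestronglyMeasurable
  have hws : ∀ s : ℝ, 0 < s ∧ s < 1 → ContinuousOn (fun x : ℂ => s • w (c + s * (x - c)))
      (closure Ω) := fun s hs => (hcont w hwc s hs).const_smul s
  have A₁ : Tendsto (fun s : ℝ => ∫ ζ in Ω, cutKernel X' z 0 0 ζ *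
      phaseSum n (phase (ζ - z)) (v (c + s * (ζ - c)))) (𝓝[<] 1)
      (𝓝 (∫ ζ in Ω, cutKernel X' z 0 0 ζ * phaseSum n (phase (ζ - z)) (v ζ))) := by
    refine tendsto_integral_mul_of_bounded (h.integrableOn_cutKernel_deriv hX z 0 0) (C := C)
      ?_ ?_ ?_
    · filter_upwards [hs] with s hs
      exact aestronglyMeasurable_phaseSum hφ (fun _ => norm_phase_le _)
        (h.aestronglyMeasurable_apply ((hcont v hvc s hs).mono subset_closure)) n
    · filter_upwards [hs] with s hs
      exact h.ae_restrict_of_closure fun ζ hζ =>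
        (norm_phaseSum_le (norm_phase_le _) n _).trans (hC _ (hmaps s hs hζ))
    · exact h.ae_restrict_of_closure fun ζ hζ =>
        ((continuous_phaseSum (norm_phase_le _) n).tendsto _).comp (hlim v hvc ζ hζ)
  have A₂ : Tendsto (fun s : ℝ => ∫ ζ in Ω, cutKernel X' z 0 0 ζ * v (c + s * (ζ - c)) n)
      (𝓝[<] 1) (𝓝 (∫ ζ in Ω, cutKernel X' z 0 0 ζ * v ζ n)) := by
    refine tendsto_integral_mul_of_bounded (h.integrableOn_cutKernel_deriv hX z 0 0) (C := C)
      ?_ ?_ ?_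
    · filter_upwards [hs] with s hs
      exact h.aestronglyMeasurable_apply ((hcont v hvc s hs).mono subset_closure) n
    · filter_upwards [hs] with s hs
      exact h.ae_restrict_of_closure fun ζ hζ => (norm_apply_le _ n).trans (hC _ (hmaps s hs hζ))
    · exact h.ae_restrict_of_closure fun ζ hζ =>
        ((continuous_apply n).tendsto _).comp (hlim v hvc ζ hζ)
  have A₃ : Tendsto (fun s : ℝ => ∫ ζ in Ω, cutKernel X z 0 1 ζ *
      phaseSum n (phase (ζ - z)) (s • w (c + s * (ζ - c)))) (𝓝[<] 1)
      (𝓝 (∫ ζ in Ω, cutKernel X z 0 1 ζ * phaseSum n (phase (ζ - z)) (w ζ))) := by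
    refine tendsto_integral_mul_of_bounded (h.integrableOn_cutKernel hX z 0 1) (C := C')
      ?_ ?_ ?_
    · filter_upwards [hs] with s hs
      exact aestronglyMeasurable_phaseSum hφ (fun _ => norm_phase_le _)
        (h.aestronglyMeasurable_apply ((hws s hs).mono subset_closure)) n
    · filter_upwards [hs] with s hs
      refine h.ae_restrict_of_closure fun ζ hζ =>
        (norm_phaseSum_le (norm_phase_le _) n _).trans ?_
      rw [norm_smul, Real.norm_of_nonneg hs.1.le]
      exact (mul_le_of_le_one_left (norm_nonneg _) hs.2.le).trans (hC' _ (hmaps s hs hζ))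
    · refine h.ae_restrict_of_closure fun ζ hζ =>
        ((continuous_phaseSum (norm_phase_le _) n).tendsto _).comp ?_
      have h1 : Tendsto (fun s : ℝ => s) (𝓝[<] 1) (𝓝 1) := nhdsWithin_le_nhds
      simpa using h1.smul (hlim w hwc ζ hζ)
  have B₁ : Tendsto (fun s : ℝ => ∫ θ in Ioc 0 (2 * Real.pi), cutAngular Ω c X z θ *
        phaseSum n (phase (boundaryCurve Ω c θ - z)) (v (c + s * (boundaryCurve Ω c θ - c))))
      (𝓝[<] 1) (𝓝 (∫ θ in Ioc 0 (2 * Real.pi), cutAngular Ω c X z θ *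
        phaseSum n (phase (boundaryCurve Ω c θ - z)) (v (boundaryCurve Ω c θ)))) := by
    refine tendsto_integral_mul_of_bounded (h.integrableOn_cutAngular hX z) (C := C)
      ?_ ?_ ?_
    · filter_upwards [hs] with s hs
      exact aestronglyMeasurable_phaseSum hφ' (fun _ => norm_phase_le _)
        (hmeas' _ (hcont v hvc s hs)) n
    · filter_upwards [hs] with s hs
      exact Filter.Eventually.of_forall fun θ => (norm_phaseSum_le (norm_phase_le _) n _).trans
        (hC _ (hmaps s hs (h.boundaryCurve_mem_closure θ)))
    · exact Filter.Eventually.of_forall fun θ =>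
        ((continuous_phaseSum (norm_phase_le _) n).tendsto _).comp
          (hlim v hvc _ (h.boundaryCurve_mem_closure θ))
  have B₂ : ∀ k : ℝ → ℂ, IntegrableOn k (Ioc 0 (2 * Real.pi)) →
      Tendsto (fun s : ℝ => ∫ θ in Ioc 0 (2 * Real.pi), k θ *
        v (c + s * (boundaryCurve Ω c θ - c)) n)
      (𝓝[<] 1) (𝓝 (∫ θ in Ioc 0 (2 * Real.pi), k θ * v (boundaryCurve Ω c θ) n)) := by
    intro k hk
    refine tendsto_integral_mul_of_bounded hk (C := C) ?_ ?_ ?_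
    · filter_upwards [hs] with s hs using hmeas' _ (hcont v hvc s hs) n
    · filter_upwards [hs] with s hs
      exact Filter.Eventually.of_forall fun θ => (norm_apply_le _ n).trans
        (hC _ (hmaps s hs (h.boundaryCurve_mem_closure θ)))
    · exact Filter.Eventually.of_forall fun θ =>
        ((continuous_apply n).tendsto _).comp (hlim v hvc _ (h.boundaryCurve_mem_closure θ))
  have hL := (((A₁.const_mul 2).sub A₂).add A₃).const_mul (2 * Complex.I)
  have hR := (B₁.sub (B₂ _ (h.integrableOn_cutAngular hX z))).add
    (B₂ _ (h.integrableOn_cutCauchy hX z))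
  -- For each `s < 1` the dilate of `v` is regular up to the boundary and solves the same equation
  -- with right-hand side `s w(c + s(x - c))`, the factor `s` coming from the chain rule.
  refine tendsto_nhds_unique_of_eventuallyEq hL hR ?_
  filter_upwards [hs] with s hs
  have hmem : ∀ x ∈ closure Ω, c + s * (x - c) ∈ Ω := fun x hx => h.shrink_mem hs.1.le hs.2 hx
  have hdiff : ∀ ζ ∈ Ω, DifferentiableAt ℝ v ζ := fun ζ hζ =>
    (hv1.differentiableOn one_ne_zero).differentiableAt (h.isOpen.mem_nhds hζ)
  have hfd : ∀ x ∈ closure Ω, HasFDerivAt (fun x : ℂ => v (c + s * (x - c)))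
      (s • fderiv ℝ v (c + s * (x - c))) x := fun x hx => shrink_fderiv (hdiff _ (hmem x hx))
  refine h.cutoff_identity_of_differentiableAt hX z (v := fun x : ℂ => v (c + s * (x - c)))
    (w := fun x => s • w (c + s * (x - c))) (fun x hx => (hfd x hx).differentiableAt) ?_ ?_ n
  · have h1 : ContinuousOn (fderiv ℝ v) Ω := hv1.continuousOn_fderiv_of_isOpen h.isOpen le_rfl
    refine ContinuousOn.congr (f := fun x : ℂ => s • fderiv ℝ v (c + s * (x - c))) ?_
      fun x hx => (hfd x hx).fderiv
    exact (h1.comp (Continuous.continuousOn (by fun_prop)) hmem).const_smul s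
  · intro ζ hζ m
    have h1 := hw _ (hmem ζ (subset_closure hζ)) m
    simp only [dz, dzbar, (hfd ζ (subset_closure hζ)).fderiv, lp.coeFn_smul, Pi.smul_apply,
      lp.coeFn_add, lp.coeFn_sub, Pi.add_apply, Pi.sub_apply, smul_eq_mul, Complex.real_smul,
      smul_apply] at h1 ⊢
    rw [h1]
    ring

end IsConvexDomain

/-! ### Smooth steps and circle means. -/

/-- A smooth monotone step from `0` to `1` between `a` and `a + δ`. -/
def smoothStep (a δ q : ℝ) : ℝ := Real.smoothTransition ((q - a) / δ)

theorem smoothStep_contDiff (a δ : ℝ) : ContDiff ℝ 1 (smoothStep a δ) :=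
  (Real.smoothTransition.contDiff (n := 1)).comp (by fun_prop)

theorem isCutoff_smoothStep {a δ : ℝ} (ha : 0 < a) (hδ : 0 < δ) :
    IsCutoff (smoothStep a δ) (deriv (smoothStep a δ)) a where
  pos := ha
  hasDerivAt q := ((smoothStep_contDiff a δ).differentiable one_ne_zero q).hasDerivAt
  continuous_deriv := (smoothStep_contDiff a δ).continuous_deriv le_rfl
  eq_zero q hq := Real.smoothTransition.zero_of_nonpos
    (div_nonpos_of_nonpos_of_nonneg (by linarith) hδ.le)

theorem smoothStep_eq_one {a δ q : ℝ} (hδ : 0 < δ) (hq : a + δ ≤ q) : smoothStep a δ q = 1 :=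
  Real.smoothTransition.one_of_one_le ((one_le_div hδ).2 (by linarith))

theorem abs_smoothStep_le (a δ q : ℝ) : |smoothStep a δ q| ≤ 1 := by
  rw [smoothStep, abs_of_nonneg (Real.smoothTransition.nonneg _)]
  exact Real.smoothTransition.le_one _

theorem deriv_smoothStep_nonneg {a δ : ℝ} (hδ : 0 < δ) (q : ℝ) : 0 ≤ deriv (smoothStep a δ) q := by
  refine Monotone.deriv_nonneg fun x y hxy => Real.smoothTransition.monotone ?_
  exact div_le_div_of_nonneg_right (by linarith) hδ.le

theorem deriv_smoothStep_eq_zero {a δ q : ℝ} (hδ : 0 < δ) (hq : a + δ < q) :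
    deriv (smoothStep a δ) q = 0 := by
  have : smoothStep a δ =ᶠ[𝓝 q] fun _ => (1 : ℝ) := by
    filter_upwards [Ioi_mem_nhds hq] with x hx using smoothStep_eq_one hδ (le_of_lt hx)
  rw [this.deriv_eq, deriv_const]

/-- The step vanishes at `q = a` itself, so the limit is the indicator of the open ray; with `a =
ε²` this matches the strict inequality `ε < |t|` of the principal value. -/
theorem tendsto_smoothStep (a q : ℝ) :
    Tendsto (fun δ => smoothStep a δ q) (𝓝[>] 0) (𝓝 ((Ioi a).indicator (fun _ => (1 : ℝ)) q)) := by
  by_cases hq : a < q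
  · rw [indicator_of_mem (show q ∈ Ioi a from hq)]
    refine tendsto_const_nhds.congr' ?_
    filter_upwards [Ioo_mem_nhdsGT (sub_pos.2 hq)] with δ hδ
    exact (smoothStep_eq_one hδ.1 (by linarith [hδ.2])).symm
  · rw [indicator_of_notMem (show q ∉ Ioi a from hq)]
    refine tendsto_const_nhds.congr' ?_
    filter_upwards [self_mem_nhdsWithin] with δ hδ
    refine (Real.smoothTransition.zero_of_nonpos
      (div_nonpos_of_nonpos_of_nonneg (by linarith) (le_of_lt hδ))).symm

/-- The radial weight `r X'(r²)` has the primitive `X(r²)/2`, which rises from `0` to `1/2`; so it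
is a nonnegative weight of total mass `1/2`. -/
theorem hasDerivAt_smoothStep_sq {a δ : ℝ} (ha : 0 < a) (hδ : 0 < δ) (r : ℝ) :
    HasDerivAt (fun r => smoothStep a δ (r ^ 2) / 2) (r * deriv (smoothStep a δ) (r ^ 2)) r := by
  have := (((isCutoff_smoothStep ha hδ).hasDerivAt (r ^ 2)).comp r (hasDerivAt_pow 2 r)).div_const 2
  refine this.congr_deriv ?_
  push_cast
  ring

theorem tendsto_smoothStep_sq {a δ : ℝ} (hδ : 0 < δ) :
    Tendsto (fun r => smoothStep a δ (r ^ 2) / 2) atTop (𝓝 (1 / 2)) := by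
  refine tendsto_const_nhds.congr' ?_
  filter_upwards [(tendsto_pow_atTop (two_ne_zero)).eventually_ge_atTop (a + δ)] with r hr
  rw [smoothStep_eq_one hδ hr]

theorem integrableOn_deriv_smoothStep_sq {a δ : ℝ} (ha : 0 < a) (hδ : 0 < δ) :
    IntegrableOn (fun r => r * deriv (smoothStep a δ) (r ^ 2)) (Ioi 0) :=
  integrableOn_Ioi_deriv_of_nonneg' (fun r _ => hasDerivAt_smoothStep_sq ha hδ r)
    (fun _ hr => mul_nonneg (le_of_lt hr) (deriv_smoothStep_nonneg hδ _)) (tendsto_smoothStep_sq hδ)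

theorem integral_deriv_smoothStep_sq {a δ : ℝ} (ha : 0 < a) (hδ : 0 < δ) :
    ∫ r in Ioi (0 : ℝ), r * deriv (smoothStep a δ) (r ^ 2) = 1 / 2 := by
  rw [integral_Ioi_of_hasDerivAt_of_nonneg' (fun r _ => hasDerivAt_smoothStep_sq ha hδ r)
    (fun r hr => mul_nonneg (le_of_lt hr) (deriv_smoothStep_nonneg hδ _)) (tendsto_smoothStep_sq hδ)]
  rw [(isCutoff_smoothStep ha hδ).eq_zero _ (by simpa using ha.le)]
  simp

/-- The sum `a₋ₙ + 2 ∑_{j ≥ 1} a₋ₙ₋₂ⱼ φʲ`. -/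
def meanSum (n : ℕ) (φ : ℂ) (a : EllOne) : ℂ := 2 * phaseSum n φ a - a n

theorem norm_meanSum_le {φ : ℂ} (hφ : ‖φ‖ ≤ 1) (n : ℕ) (a : EllOne) :
    ‖meanSum n φ a‖ ≤ 3 * ‖a‖ := by
  refine (norm_sub_le _ _).trans ?_
  rw [norm_mul, Complex.norm_ofNat]
  linarith [norm_phaseSum_le hφ n a, norm_apply_le a n]

theorem meanSum_zero (n : ℕ) (φ : ℂ) : meanSum n φ 0 = 0 := by
  simp [meanSum, phaseSum_zero]

theorem continuous_meanSum {φ : ℂ} (hφ : ‖φ‖ ≤ 1) (n : ℕ) : Continuous (meanSum n φ) :=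
  (continuous_const.mul (continuous_phaseSum hφ n)).sub (continuous_apply n)

/-- The integral of the mean sum over the part of a circle that lies in `Ω`. -/
def circleMean (Ω : Set ℂ) (v : ℂ → EllOne) (n : ℕ) (z : ℂ) (r : ℝ) : ℂ :=
  ∫ α in (0 : ℝ)..(2 * Real.pi), meanSum n (Complex.exp (-2 * α * Complex.I))
    (Ω.indicator v (z + r * Complex.exp (α * Complex.I)))

namespace IsConvexDomain
variable {Ω : Set ℂ} {c : ℂ}

theorem measurable_indicator_apply (h : IsConvexDomain Ω c) {v : ℂ → EllOne}
    (hv : ContinuousOn v Ω) (m : ℕ) : Measurable fun ζ => Ω.indicator v ζ m := by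
  have h1 := measurable_indicator_of_continuousOn h.isOpen.measurableSet
    ((continuous_apply m).comp_continuousOn hv)
  convert h1 using 2 with ζ
  by_cases hζ : ζ ∈ Ω <;> simp [hζ]

theorem norm_indicator_le {v : ℂ → EllOne} {C : ℝ} (hC0 : 0 ≤ C)
    (hC : ∀ ζ ∈ closure Ω, ‖v ζ‖ ≤ C) (ζ : ℂ) : ‖Ω.indicator v ζ‖ ≤ C := by
  by_cases hζ : ζ ∈ Ω
  · rw [indicator_of_mem hζ]; exact hC ζ (subset_closure hζ)
  · rw [indicator_of_notMem hζ, norm_zero]; exact hC0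

/-- The mean term of the cut-off identity is an average of the circle means near the point. -/
theorem norm_integral_deriv_smoothStep_sub_le (h : IsConvexDomain Ω c) {v : ℂ → EllOne}
    (hvc : ContinuousOn v (closure Ω)) (n : ℕ) (z : ℂ) {a δ ρ η : ℝ} (ha : 0 < a) (hδ : 0 < δ)
    (hρ : 0 < ρ) (haδ : a + δ < ρ ^ 2) {M : ℂ}
    (hM : ∀ r ∈ Ioo 0 ρ, ‖circleMean Ω v n z r - M‖ ≤ η) :
    ‖(2 * (∫ ζ in Ω, cutKernel (deriv (smoothStep a δ)) z 0 0 ζ *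
        phaseSum n (phase (ζ - z)) (v ζ)) -
        ∫ ζ in Ω, cutKernel (deriv (smoothStep a δ)) z 0 0 ζ * v ζ n) - M / 2‖ ≤ η / 2 := by
  have hpi : (0 : ℝ) ≤ 2 * Real.pi := by positivity
  obtain ⟨C, hC0, hC⟩ := h.exists_bound hvc
  obtain ⟨D, hD0, hD⟩ := h.exists_norm_sub_le z
  have hX := isCutoff_smoothStep ha hδ
  set X' := deriv (smoothStep a δ)
  have hφ : AEStronglyMeasurable (fun ζ => phase (ζ - z)) (volume.restrict Ω) :=
    (measurable_phase_sub z).aestronglyMeasurable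
  have hΩ := h.isOpen.measurableSet
  have hk := h.integrableOn_cutKernel_deriv hX z 0 0
  have hI₁ : IntegrableOn (fun ζ => cutKernel X' z 0 0 ζ * phaseSum n (phase (ζ - z)) (v ζ)) Ω :=
    integrable_mul_phaseSum hk hφ (fun _ => norm_phase_le _)
      (h.aestronglyMeasurable_apply (hvc.mono subset_closure)) (h.ae_restrict_of_closure hC) n
  have hI₂ : IntegrableOn (fun ζ => cutKernel X' z 0 0 ζ * v ζ n) Ω :=
    hk.mul_bdd (c := C) (h.aestronglyMeasurable_apply (hvc.mono subset_closure) n)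
      (h.ae_restrict_of_closure fun ζ hζ => (norm_apply_le _ n).trans (hC ζ hζ))
  let f : ℂ → ℂ := fun ζ => cutKernel X' z 0 0 ζ * meanSum n (phase (ζ - z)) (Ω.indicator v ζ)
  have hf : Measurable f := by
    refine (hX.continuous_cutKernel_deriv z 0 0).measurable.mul (Measurable.sub ?_ ?_)
    · exact (measurable_phaseSum (measurable_phase_sub z) (fun _ => norm_phase_le _)
        (h.measurable_indicator_apply (hvc.mono subset_closure)) n).const_mul 2
    · exact h.measurable_indicator_apply (hvc.mono subset_closure) n
  have hfz : ∀ ζ ∉ Ω, f ζ = 0 := fun ζ hζ => by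
    simp only [f, indicator_of_notMem hζ, meanSum_zero, mul_zero]
  obtain ⟨B, hB⟩ := h.isCompact_closure.exists_bound_of_continuousOn
    (hX.continuous_cutKernel_deriv z 0 0).continuousOn
  have hB0 : 0 ≤ B := (norm_nonneg _).trans (hB c (subset_closure h.mem))
  have hfB : ∀ ζ, ‖f ζ‖ ≤ B * (3 * C) := by
    intro ζ
    by_cases hζ : ζ ∈ Ω
    · rw [norm_mul]
      have h1 := hB ζ (subset_closure hζ)
      gcongr
      exact (norm_meanSum_le (norm_phase_le _) n _).trans (by
        gcongr; exact norm_indicator_le hC0 hC ζ)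
    · rw [hfz ζ hζ, norm_zero]; positivity
  have hfD : ∀ ζ, D < ‖ζ - z‖ → f ζ = 0 := fun ζ hζ =>
    hfz ζ fun h' => (hD ζ (subset_closure h')).not_gt hζ
  have e₁ : 2 * (∫ ζ in Ω, cutKernel X' z 0 0 ζ * phaseSum n (phase (ζ - z)) (v ζ)) -
      (∫ ζ in Ω, cutKernel X' z 0 0 ζ * v ζ n) = ∫ ζ, f ζ := by
    rw [← setIntegral_eq_integral_of_forall_compl_eq_zero hfz, ← integral_const_mul,
      ← integral_sub (hI₁.const_mul 2) hI₂]
    refine setIntegral_congr_fun hΩ fun ζ hζ => ?_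
    simp only [f, indicator_of_mem hζ, meanSum]
    ring
  have hint := integrable_polar hf hfB hfD 0 (2 * Real.pi)
  -- On the circle of radius `r` the cut-off derivative is constant and the phase is `e^{-2iθ}`, so
  -- the angular integral is a multiple of `circleMean`.
  have hin : ∀ r ∈ Ioi (0 : ℝ), ∫ θ in Ioc 0 (2 * Real.pi),
      (r : ℂ) * f (z + r * Complex.exp (θ * Complex.I)) =
      ((r * X' (r ^ 2) : ℝ) : ℂ) * circleMean Ω v n z r := by
    intro r hr
    rw [circleMean, intervalIntegral.integral_of_le hpi, ← integral_const_mul]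
    refine integral_congr_ae (Filter.Eventually.of_forall fun θ => ?_)
    have hq : Complex.normSq (r * Complex.exp (θ * Complex.I)) = r ^ 2 := by
      rw [Complex.normSq_eq_norm_sq, norm_mul, Complex.norm_exp_ofReal_mul_I, Complex.norm_real,
        mul_one, Real.norm_eq_abs, sq_abs]
    simp only [f, cutKernel_self, add_sub_cancel_left, pow_zero, mul_one, hq,
      phase_ofReal_mul_exp (ne_of_gt hr), Complex.ofReal_mul]
    ring
  have e₂ : ∫ ζ, f ζ = ∫ r in Ioi (0 : ℝ), ((r * X' (r ^ 2) : ℝ) : ℂ) * circleMean Ω v n z r := by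
    rw [integral_polar hf hfB hfD, intervalIntegral.integral_of_le hpi,
      ← integral_prod_symm _ hint, integral_prod _ hint]
    exact setIntegral_congr_fun measurableSet_Ioi hin
  have hint' : IntegrableOn (fun r : ℝ => ((r * X' (r ^ 2) : ℝ) : ℂ) * circleMean Ω v n z r)
      (Ioi 0) :=
    (integrableOn_congr_fun hin measurableSet_Ioi).1 hint.integral_prod_left
  have hX'i := integrableOn_deriv_smoothStep_sq ha hδ
  have hX'c : IntegrableOn (fun r : ℝ => ((r * X' (r ^ 2) : ℝ) : ℂ) * M) (Ioi 0) :=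
    hX'i.ofReal.mul_const M
  have e₃ : M / 2 = ∫ r in Ioi (0 : ℝ), ((r * X' (r ^ 2) : ℝ) : ℂ) * M := by
    rw [integral_mul_const, integral_complex_ofReal, integral_deriv_smoothStep_sq ha hδ]
    push_cast
    ring
  rw [e₁, e₂, e₃, ← integral_sub hint' hX'c]
  have e₄ : η / 2 = ∫ r in Ioi (0 : ℝ), r * X' (r ^ 2) * η := by
    rw [integral_mul_const, integral_deriv_smoothStep_sq ha hδ]
    ring
  rw [e₄]
  refine norm_integral_le_of_norm_le (hX'i.mul_const η) ?_
  refine ae_restrict_of_forall_mem measurableSet_Ioi fun r hr => ?_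
  rw [← mul_sub, norm_mul, Complex.norm_real, Real.norm_of_nonneg
    (mul_nonneg (le_of_lt hr) (deriv_smoothStep_nonneg hδ _))]
  -- Nothing is known about the means at radii `r ≥ ρ`, but there `a + δ < r²` and the weight
  -- vanishes.
  by_cases hrρ : r < ρ
  · exact mul_le_mul_of_nonneg_left (hM r ⟨hr, hrρ⟩)
      (mul_nonneg (le_of_lt hr) (deriv_smoothStep_nonneg hδ _))
  · have : X' (r ^ 2) = 0 := by
      refine deriv_smoothStep_eq_zero hδ (haδ.trans_le ?_)
      exact pow_le_pow_left₀ hρ.le (not_lt.1 hrρ) 2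
    rw [this, show deriv (smoothStep a δ) (r ^ 2) = 0 from this]
    simp

end IsConvexDomain

/-! ### From smooth cut-offs to a removed disc. -/

theorem tendsto_integral_smoothStep_mul {X : Type*} [MeasurableSpace X] {μ : Measure X}
    [IsFiniteMeasure μ] {t k g : X → ℂ} (ht : Measurable t) (hk : Measurable k) {K : ℝ}
    (hK : ∀ x, ‖k x‖ * ‖t x‖ ≤ K) (hg : AEStronglyMeasurable g μ) {C : ℝ}
    (hC : ∀ᵐ x ∂μ, ‖g x‖ ≤ C) {ε : ℝ} (hε : 0 < ε) :
    Tendsto (fun δ => ∫ x, (smoothStep (ε ^ 2) δ (Complex.normSq (t x)) : ℂ) * k x * g x ∂μ)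
      (𝓝[>] 0) (𝓝 (∫ x in {x | ε < ‖t x‖}, k x * g x ∂μ)) := by
  have hS : MeasurableSet {x | ε < ‖t x‖} := measurableSet_lt measurable_const ht.norm
  have hq : ∀ x, ε ^ 2 < Complex.normSq (t x) ↔ ε < ‖t x‖ := fun x => by
    rw [Complex.normSq_eq_norm_sq, sq_lt_sq₀ hε.le (norm_nonneg _)]
  rw [← integral_indicator hS]
  refine tendsto_integral_filter_of_dominated_convergence (fun _ => K / ε * C) ?_ ?_
    (integrable_const _) ?_
  · refine Filter.Eventually.of_forall fun δ => AEStronglyMeasurable.mul ?_ hg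
    refine Measurable.aestronglyMeasurable (Measurable.mul ?_ hk)
    exact Complex.measurable_ofReal.comp ((smoothStep_contDiff _ _).continuous.measurable.comp
      (Complex.continuous_normSq.measurable.comp ht))
  · filter_upwards [self_mem_nhdsWithin] with δ hδ
    filter_upwards [hC] with x hx
    -- Where `|t| > ε` the kernel is at most `K / ε`; elsewhere the step is zero, its transition
    -- starting at `ε²`.
    by_cases hxt : ε < ‖t x‖
    · have h1 : ‖k x‖ ≤ K / ε := by
        rw [le_div_iff₀ hε]
        exact (mul_le_mul_of_nonneg_left hxt.le (norm_nonneg _)).trans (hK x)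
      rw [norm_mul, norm_mul, Complex.norm_real, Real.norm_eq_abs]
      have h2 := abs_smoothStep_le (ε ^ 2) δ (Complex.normSq (t x))
      have h3 : |smoothStep (ε ^ 2) δ (Complex.normSq (t x))| * ‖k x‖ ≤ K / ε :=
        (mul_le_of_le_one_left (norm_nonneg _) h2).trans h1
      exact mul_le_mul h3 hx (norm_nonneg _) ((norm_nonneg _).trans h1)
    · have h1 : Complex.normSq (t x) ≤ ε ^ 2 := not_lt.1 fun h' => hxt ((hq x).1 h')
      rw [(isCutoff_smoothStep (pow_pos hε 2) hδ).eq_zero _ h1]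
      have hK0 : 0 ≤ K := (by positivity : 0 ≤ ‖k x‖ * ‖t x‖).trans (hK x)
      have hC0 : 0 ≤ C := (norm_nonneg _).trans hx
      simp only [Complex.ofReal_zero, zero_mul, norm_zero]
      positivity
  · refine Filter.Eventually.of_forall fun x => ?_
    have h1 := (Complex.continuous_ofReal.tendsto _).comp
      (tendsto_smoothStep (ε ^ 2) (Complex.normSq (t x)))
    have h2 := (h1.mul_const (k x)).mul_const (g x)
    have h3 : {x | ε < ‖t x‖}.indicator (fun x => k x * g x) x =
        (((Ioi (ε ^ 2)).indicator (fun _ => (1 : ℝ)) (Complex.normSq (t x)) : ℝ) : ℂ) *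
          k x * g x := by
      by_cases hxt : ε < ‖t x‖
      · rw [indicator_of_mem (show x ∈ {x | ε < ‖t x‖} from hxt),
          indicator_of_mem (show Complex.normSq (t x) ∈ Ioi (ε ^ 2) from (hq x).2 hxt)]
        simp
      · rw [indicator_of_notMem (show x ∉ {x | ε < ‖t x‖} from hxt),
          indicator_of_notMem (show Complex.normSq (t x) ∉ Ioi (ε ^ 2) from
            fun h' => hxt ((hq x).1 h'))]
        simp
    rw [h3]
    exact h2

theorem tendsto_setIntegral_norm_gt {X : Type*} [MeasurableSpace X] {μ : Measure X} {f t : X → ℂ}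
    (hf : Integrable f μ) (ht : Measurable t) (ht0 : ∀ᵐ x ∂μ, t x ≠ 0) :
    Tendsto (fun ε : ℝ => ∫ x in {x | ε < ‖t x‖}, f x ∂μ) (𝓝[>] 0) (𝓝 (∫ x, f x ∂μ)) := by
  have hS : ∀ ε : ℝ, MeasurableSet {x | ε < ‖t x‖} := fun ε =>
    measurableSet_lt measurable_const ht.norm
  simp only [← integral_indicator (hS _)]
  refine tendsto_integral_filter_of_dominated_convergence (fun x => ‖f x‖) ?_ ?_ hf.norm ?_
  · exact Filter.Eventually.of_forall fun ε => hf.aestronglyMeasurable.indicator (hS ε)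
  · exact Filter.Eventually.of_forall fun ε => Filter.Eventually.of_forall fun x =>
      norm_indicator_le_norm_self _ _
  · filter_upwards [ht0] with x hx
    refine tendsto_const_nhds.congr' ?_
    filter_upwards [Ioo_mem_nhdsGT (norm_pos_iff.2 hx)] with ε hε
    rw [indicator_of_mem (show x ∈ {x | ε < ‖t x‖} from hε.2)]

/-- The Cauchy kernel `dζ / (ζ - z)` on the boundary curve. -/
def cauchyKernel (Ω : Set ℂ) (c z : ℂ) (θ : ℝ) : ℂ :=
  deriv (boundaryCurve Ω c) θ / (boundaryCurve Ω c θ - z)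

/-- The kernel `dζ / (ζ - z) - dζ̄ / (ζ̄ - z̄)` on the boundary curve. -/
def angularKernel (Ω : Set ℂ) (c z : ℂ) (θ : ℝ) : ℂ :=
  deriv (boundaryCurve Ω c) θ / (boundaryCurve Ω c θ - z) -
    conj (deriv (boundaryCurve Ω c) θ) / conj (boundaryCurve Ω c θ - z)

namespace IsConvexDomain
variable {Ω : Set ℂ} {c : ℂ}

theorem measurable_boundaryCurve_sub (h : IsConvexDomain Ω c) (z : ℂ) :
    Measurable fun θ => boundaryCurve Ω c θ - z :=
  h.continuous_boundaryCurve.measurable.sub_const z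

theorem measurable_cauchyKernel (h : IsConvexDomain Ω c) (z : ℂ) :
    Measurable (cauchyKernel Ω c z) :=
  (measurable_deriv _).div (h.measurable_boundaryCurve_sub z)

theorem angularKernel_eq (z : ℂ) (θ : ℝ) :
    angularKernel Ω c z θ = cauchyKernel Ω c z θ - conj (cauchyKernel Ω c z θ) := by
  simp only [angularKernel, cauchyKernel, map_div₀]

theorem measurable_angularKernel (h : IsConvexDomain Ω c) (z : ℂ) :
    Measurable (angularKernel Ω c z) := by
  have h1 := h.measurable_cauchyKernel z
  have h2 : angularKernel Ω c z = fun θ => cauchyKernel Ω c z θ - conj (cauchyKernel Ω c z θ) :=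
    funext fun θ => angularKernel_eq z θ
  rw [h2]
  exact h1.sub (Complex.continuous_conj.measurable.comp h1)

theorem norm_cauchyKernel_mul_le (z : ℂ) (θ : ℝ) :
    ‖cauchyKernel Ω c z θ‖ * ‖boundaryCurve Ω c θ - z‖ ≤ ‖deriv (boundaryCurve Ω c) θ‖ := by
  rw [cauchyKernel, norm_div]
  rcases (norm_nonneg (boundaryCurve Ω c θ - z)).eq_or_lt with h0 | h0
  · rw [← h0, mul_zero]
    exact norm_nonneg _
  · rw [div_mul_cancel₀ _ h0.ne']

theorem norm_angularKernel_le (z : ℂ) (θ : ℝ) :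
    ‖angularKernel Ω c z θ‖ ≤ 2 * ‖cauchyKernel Ω c z θ‖ := by
  rw [angularKernel_eq]
  refine (norm_sub_le _ _).trans ?_
  rw [RCLike.norm_conj]
  linarith

theorem isFiniteMeasure_restrict (h : IsConvexDomain Ω c) :
    IsFiniteMeasure ((volume : Measure ℂ).restrict Ω) :=
  ⟨by rw [Measure.restrict_apply_univ]; exact h.bounded.measure_lt_top⟩

/-- The Bukhgeim-Pompeiu identity with a small disc around the point removed. -/
theorem tendsto_removed_disc (h : IsConvexDomain Ω c) (z : ℂ) {v w : ℂ → EllOne}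
    (hwc : ContinuousOn w (closure Ω))
    (hv1 : ContDiffOn ℝ 1 v Ω) (hvc : ContinuousOn v (closure Ω))
    (hw : ∀ ζ ∈ Ω, ∀ m, w ζ m = dzbar v ζ m + dz v ζ (m + 2)) (n : ℕ) {M : ℂ}
    (hM : Tendsto (circleMean Ω v n z) (𝓝[>] 0) (𝓝 M)) :
    Tendsto (fun ε : ℝ =>
      (∫ θ in {θ | ε < ‖boundaryCurve Ω c θ - z‖}, angularKernel Ω c z θ *
        phaseSum n (phase (boundaryCurve Ω c θ - z)) (v (boundaryCurve Ω c θ))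
        ∂volume.restrict (Ioc 0 (2 * Real.pi))) -
      (∫ θ in {θ | ε < ‖boundaryCurve Ω c θ - z‖}, angularKernel Ω c z θ *
        v (boundaryCurve Ω c θ) n ∂volume.restrict (Ioc 0 (2 * Real.pi))) +
      (∫ θ in {θ | ε < ‖boundaryCurve Ω c θ - z‖}, cauchyKernel Ω c z θ *
        v (boundaryCurve Ω c θ) n ∂volume.restrict (Ioc 0 (2 * Real.pi))) -
      2 * Complex.I * ∫ ζ in {ζ | ε < ‖ζ - z‖}, (ζ - z)⁻¹ *
        phaseSum n (phase (ζ - z)) (w ζ) ∂volume.restrict Ω)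
      (𝓝[>] 0) (𝓝 (Complex.I * M)) := by
  obtain ⟨C, hC0, hC⟩ := h.exists_bound hvc
  obtain ⟨C', hC'0, hC'⟩ := h.exists_bound hwc
  obtain ⟨K, hK0, hK⟩ := h.exists_norm_deriv_boundaryCurve_le
  have := h.isFiniteMeasure_restrict
  have hφ : AEStronglyMeasurable (fun ζ => phase (ζ - z)) (volume.restrict Ω) :=
    (measurable_phase_sub z).aestronglyMeasurable
  have hφ' := (h.measurable_phase_boundaryCurve z).aestronglyMeasurable
    (μ := volume.restrict (Ioc 0 (2 * Real.pi)))
  have hvm : ∀ m, AEStronglyMeasurable (fun θ => v (boundaryCurve Ω c θ) m)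
      (volume.restrict (Ioc 0 (2 * Real.pi))) := fun m => ((continuous_apply m).comp
    (h.continuous_comp_boundaryCurve hvc)).aestronglyMeasurable
  have hcK : ∀ θ, ‖cauchyKernel Ω c z θ‖ * ‖boundaryCurve Ω c θ - z‖ ≤ K := fun θ =>
    (norm_cauchyKernel_mul_le z θ).trans (hK θ)
  have haK : ∀ θ, ‖angularKernel Ω c z θ‖ * ‖boundaryCurve Ω c θ - z‖ ≤ 2 * K := fun θ => by
    have h1 := mul_le_mul_of_nonneg_right (norm_angularKernel_le (Ω := Ω) (c := c) z θ)
      (norm_nonneg (boundaryCurve Ω c θ - z))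
    linarith [hcK θ]
  rw [Metric.tendsto_nhds]
  intro η hη
  obtain ⟨ρ, hρ0, hρ⟩ : ∃ ρ > 0, ∀ r ∈ Ioo 0 ρ, ‖circleMean Ω v n z r - M‖ ≤ η / 2 := by
    have h1 := (Metric.tendsto_nhds.1 hM) (η / 2) (by positivity)
    rw [eventually_nhdsWithin_iff] at h1
    obtain ⟨ρ, hρ0, hρ⟩ := Metric.eventually_nhds_iff.1 h1
    refine ⟨ρ, hρ0, fun r hr => ?_⟩
    rw [← dist_eq_norm]
    refine (hρ ?_ hr.1).le
    rw [Real.dist_eq, sub_zero, abs_of_pos hr.1]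
    exact hr.2
  filter_upwards [Ioo_mem_nhdsGT hρ0] with ε hε
  have hε0 : 0 < ε := hε.1
  have T₁ := tendsto_integral_smoothStep_mul (μ := volume.restrict (Ioc 0 (2 * Real.pi)))
    (h.measurable_boundaryCurve_sub z) (h.measurable_angularKernel z) haK
    (aestronglyMeasurable_phaseSum hφ' (fun _ => norm_phase_le _) hvm n)
    (Filter.Eventually.of_forall fun θ => (norm_phaseSum_le (norm_phase_le _) n _).trans
      (hC _ (h.boundaryCurve_mem_closure θ))) hε0
  have T₂ := tendsto_integral_smoothStep_mul (μ := volume.restrict (Ioc 0 (2 * Real.pi)))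
    (h.measurable_boundaryCurve_sub z) (h.measurable_angularKernel z) haK (hvm n)
    (Filter.Eventually.of_forall fun θ => (norm_apply_le _ n).trans
      (hC _ (h.boundaryCurve_mem_closure θ))) hε0
  have T₃ := tendsto_integral_smoothStep_mul (μ := volume.restrict (Ioc 0 (2 * Real.pi)))
    (h.measurable_boundaryCurve_sub z) (h.measurable_cauchyKernel z) hcK (hvm n)
    (Filter.Eventually.of_forall fun θ => (norm_apply_le _ n).trans
      (hC _ (h.boundaryCurve_mem_closure θ))) hε0
  have T₄ := tendsto_integral_smoothStep_mul (μ := volume.restrict Ω) (t := fun ζ => ζ - z)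
    (k := fun ζ => (ζ - z)⁻¹) (K := 1) (by fun_prop) (by fun_prop)
    (fun ζ => by rw [norm_inv]; exact inv_mul_le_one)
    (aestronglyMeasurable_phaseSum hφ (fun _ => norm_phase_le _)
      (h.aestronglyMeasurable_apply (hwc.mono subset_closure)) n)
    (h.ae_restrict_of_closure fun ζ hζ => (norm_phaseSum_le (norm_phase_le _) n _).trans
      (hC' _ hζ)) hε0
  have T := ((T₁.sub T₂).add T₃).sub (T₄.const_mul (2 * Complex.I))
  rw [dist_eq_norm]
  -- With the means within `η / 2` of `M`, the distance is at most `η / 2` for every small `δ`; the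
  -- bound survives `δ → 0⁺` and is strictly below `η`.
  refine lt_of_le_of_lt (le_of_tendsto (T.sub_const (Complex.I * M)).norm ?_) (half_lt_self hη)
  -- For `δ < ρ² - ε²` the transition layer `ε² ≤ |t|² ≤ ε² + δ` lies within radius `ρ`.
  have hd : 0 < ρ ^ 2 - ε ^ 2 := by nlinarith [hε.2]
  filter_upwards [Ioo_mem_nhdsGT hd] with δ hδ
  have hX := isCutoff_smoothStep (pow_pos hε0 2) hδ.1
  have hid := h.cutoff_identity hX z hwc hv1 hvc hw n
  have hmean := h.norm_integral_deriv_smoothStep_sub_le hvc n z (pow_pos hε0 2) hδ.1 hρ0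
    (by linarith [hδ.2]) hρ
  simp only [cutAngular, cutCauchy] at hid
  simp only [angularKernel, cauchyKernel]
  rw [← hid]
  set m := 2 * (∫ ζ in Ω, cutKernel (deriv (smoothStep (ε ^ 2) δ)) z 0 0 ζ *
        phaseSum n (phase (ζ - z)) (v ζ)) -
        ∫ ζ in Ω, cutKernel (deriv (smoothStep (ε ^ 2) δ)) z 0 0 ζ * v ζ n
  have hk : ∀ ζ, cutKernel (smoothStep (ε ^ 2) δ) z 0 1 ζ =
      smoothStep (ε ^ 2) δ (Complex.normSq (ζ - z)) * (ζ - z)⁻¹ := fun ζ => by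
    simp [cutKernel]
  simp only [hk]
  rw [mul_add, add_sub_cancel_right, show 2 * Complex.I * m - Complex.I * M =
    2 * Complex.I * (m - M / 2) by ring, norm_mul, norm_mul, Complex.norm_I, Complex.norm_ofNat]
  linarith

end IsConvexDomain

/-! ### Limits of the circle means at interior points and at tangent points. -/

theorem measurable_exp_neg_two_mul : Measurable fun α : ℝ => Complex.exp (-2 * α * Complex.I) :=
  (by fun_prop : Continuous fun α : ℝ => Complex.exp (-2 * α * Complex.I)).measurable

theorem intervalIntegrable_meanSum {b : ℝ → EllOne} (hb : ∀ m, Measurable fun α => b α m) {C : ℝ}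
    (hC : ∀ α, ‖b α‖ ≤ C) (n : ℕ) (x y : ℝ) :
    IntervalIntegrable (fun α => meanSum n (Complex.exp (-2 * α * Complex.I)) (b α))
      volume x y := by
  rw [intervalIntegrable_iff]
  refine Measure.integrableOn_of_bounded (M := 3 * C) measure_Ioc_lt_top.ne ?_ ?_
  · exact (((measurable_phaseSum measurable_exp_neg_two_mul
      (fun α => (norm_exp_neg_two_mul α).le) hb n).const_mul 2).sub (hb n)).aestronglyMeasurable
  · refine Filter.Eventually.of_forall fun α =>
      (norm_meanSum_le (norm_exp_neg_two_mul α).le n _).trans ?_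
    linarith [hC α]

theorem integral_meanSum (n : ℕ) (a : EllOne) :
    ∫ α in (0 : ℝ)..(2 * Real.pi), meanSum n (Complex.exp (-2 * α * Complex.I)) a =
      2 * Real.pi * a n := by
  have h1 : IntervalIntegrable (fun α : ℝ => phaseSum n (Complex.exp (-2 * α * Complex.I)) a)
      volume 0 (2 * Real.pi) := by
    rw [intervalIntegrable_iff]
    refine Measure.integrableOn_of_bounded (M := ‖a‖) measure_Ioc_lt_top.ne
      (measurable_phaseSum measurable_exp_neg_two_mul
        (fun α => (norm_exp_neg_two_mul α).le) (fun m => measurable_const) n).aestronglyMeasurable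
      (Filter.Eventually.of_forall fun α => norm_phaseSum_le (norm_exp_neg_two_mul α).le n _)
  simp only [meanSum]
  rw [intervalIntegral.integral_sub (h1.const_mul 2) (by simp), intervalIntegral.integral_const_mul,
    integral_phaseSum_exp, intervalIntegral.integral_const, Complex.real_smul]
  push_cast
  ring

theorem re_conj_mul_exp (ν : ℂ) (α : ℝ) :
    (conj ν * Complex.exp (α * Complex.I)).re = ‖ν‖ * Real.cos (α - ν.arg) := by
  conv_lhs => rw [← Complex.norm_mul_exp_arg_mul_I ν]
  rw [map_mul, Complex.conj_ofReal, ← Complex.exp_conj, map_mul, Complex.conj_ofReal,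
    Complex.conj_I, mul_assoc, ← Complex.exp_add, Complex.re_ofReal_mul,
    show (ν.arg : ℂ) * -Complex.I + α * Complex.I = ((α - ν.arg : ℝ) : ℂ) * Complex.I by
      push_cast; ring, Complex.exp_ofReal_mul_I_re]

theorem ae_re_conj_mul_exp_ne {ν : ℂ} (hν : ν ≠ 0) :
    ∀ᵐ α : ℝ, (conj ν * Complex.exp (α * Complex.I)).re ≠ 0 := by
  have hc : {α : ℝ | (conj ν * Complex.exp (α * Complex.I)).re = 0}.Countable := by
    refine (countable_range fun k : ℤ => (2 * k + 1) * Real.pi / 2 + ν.arg).mono fun α hα => ?_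
    rw [mem_ofPred_eq, re_conj_mul_exp, mul_eq_zero, norm_eq_zero, or_iff_right hν,
      Real.cos_eq_zero_iff] at hα
    obtain ⟨k, hk⟩ := hα
    exact ⟨k, by simp only; linarith⟩
  have := hc.measure_zero volume
  rw [← compl_mem_ae_iff] at this
  filter_upwards [this] with α hα h0
  exact hα h0

/-- The mean of a mean sum over a half circle. -/
theorem integral_meanSum_indicator {ν : ℂ} (hν : ν ≠ 0) (n : ℕ) (a : EllOne) :
    ∫ α in (0 : ℝ)..(2 * Real.pi), meanSum n (Complex.exp (-2 * α * Complex.I))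
      ({α : ℝ | (conj ν * Complex.exp (α * Complex.I)).re < 0}.indicator (fun _ => a) α) =
      Real.pi * a n := by
  set A := {α : ℝ | (conj ν * Complex.exp (α * Complex.I)).re < 0}
  set f : ℝ → ℂ := fun α => meanSum n (Complex.exp (-2 * α * Complex.I))
    (A.indicator (fun _ => a) α) with hf
  have hA : MeasurableSet A := measurableSet_lt (by fun_prop) measurable_const
  have hexp : ∀ α : ℝ, Complex.exp ((α + Real.pi : ℝ) * Complex.I) =
      -Complex.exp (α * Complex.I) := fun α => by
    push_cast
    rw [add_mul, Complex.exp_add, Complex.exp_pi_mul_I, mul_neg_one]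
  have hexp2 : ∀ α : ℝ, Complex.exp (-2 * (α + Real.pi : ℝ) * Complex.I) =
      Complex.exp (-2 * α * Complex.I) := fun α => by
    rw [Complex.exp_eq_exp_iff_exists_int]
    exact ⟨-1, by push_cast; ring⟩
  have hfi : ∀ x y, IntervalIntegrable f volume x y := by
    refine intervalIntegrable_meanSum (C := ‖a‖) (fun m => ?_) (fun α => ?_) n
    · have : (fun α => A.indicator (fun _ => a) α m) = A.indicator fun _ => a m := by
        ext α
        by_cases hα : α ∈ A <;> simp [hα]
      rw [this]
      exact measurable_const.indicator hA
    · exact norm_indicator_le_norm_self (fun _ => a) α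
  -- Almost every direction or its opposite, but not both, lies in the half-plane, and `e^{-2iα}`
  -- does not distinguish them. Hence the half circle carries half of the full mean.
  have hsum : ∀ᵐ α : ℝ, f α + f (α + Real.pi) = meanSum n (Complex.exp (-2 * α * Complex.I)) a := by
    filter_upwards [ae_re_conj_mul_exp_ne hν] with α hα
    have h1 : α + Real.pi ∈ A ↔ 0 < (conj ν * Complex.exp (α * Complex.I)).re := by
      simp only [A, mem_ofPred_eq, hexp, mul_neg, Complex.neg_re, neg_lt_zero]
    simp only [hf, hexp2]
    rcases hα.lt_or_gt with h2 | h2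
    · rw [indicator_of_mem (show α ∈ A from h2),
        indicator_of_notMem (fun h' => (h1.1 h').not_gt h2), meanSum_zero, add_zero]
    · rw [indicator_of_mem (h1.2 h2), indicator_of_notMem (show α ∉ A from fun h' => lt_asymm h2 h'),
        meanSum_zero, zero_add]
  have hper : Function.Periodic f (2 * Real.pi) := by
    intro α
    have h1 : α + 2 * Real.pi = (α + Real.pi) + Real.pi := by ring
    have h2 : α + 2 * Real.pi ∈ A ↔ α ∈ A := by
      simp only [A, mem_ofPred_eq, h1, hexp, neg_neg]
    simp only [hf]
    congr 1
    · rw [h1, hexp2, hexp2]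
    · by_cases hα : α ∈ A
      · rw [indicator_of_mem hα, indicator_of_mem (h2.2 hα)]
      · rw [indicator_of_notMem hα, indicator_of_notMem (fun h' => hα (h2.1 h'))]
  have hshift : ∫ α in (0 : ℝ)..(2 * Real.pi), f (α + Real.pi) =
      ∫ α in (0 : ℝ)..(2 * Real.pi), f α := by
    rw [intervalIntegral.integral_comp_add_right, zero_add, add_comm (2 * Real.pi)]
    have := hper.intervalIntegral_add_eq Real.pi 0
    rwa [zero_add] at this
  have htot : ∫ α in (0 : ℝ)..(2 * Real.pi), (f α + f (α + Real.pi)) = 2 * Real.pi * a n := by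
    rw [← integral_meanSum n a]
    exact intervalIntegral.integral_congr_ae (hsum.mono fun α hα _ => hα)
  have hfi' : IntervalIntegrable (fun α => f (α + Real.pi)) volume 0 (2 * Real.pi) := by
    have := (hfi (0 + Real.pi) (2 * Real.pi + Real.pi)).comp_add_right Real.pi
    simpa using this
  rw [intervalIntegral.integral_add (hfi _ _) hfi', hshift] at htot
  linear_combination htot / 2

namespace IsConvexDomain
variable {Ω : Set ℂ} {c : ℂ}

/-- By dominated convergence it is enough to know, for each direction separately, whether the ray
from `z` starts inside or outside `Ω`; no uniformity in the direction is needed. -/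
theorem tendsto_circleMean (h : IsConvexDomain Ω c) {v : ℂ → EllOne}
    (hvc : ContinuousOn v (closure Ω)) (n : ℕ) {z : ℂ} (hz : z ∈ closure Ω) {A : Set ℝ}
    (hA : ∀ α ∈ A, ∀ᶠ r : ℝ in 𝓝[>] 0, z + r * Complex.exp (α * Complex.I) ∈ Ω)
    (hA' : ∀ α ∉ A, ∀ᶠ r : ℝ in 𝓝[>] 0, z + r * Complex.exp (α * Complex.I) ∉ Ω) :
    Tendsto (circleMean Ω v n z) (𝓝[>] 0) (𝓝 (∫ α in (0 : ℝ)..(2 * Real.pi),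
      meanSum n (Complex.exp (-2 * α * Complex.I)) (A.indicator (fun _ => v z) α))) := by
  obtain ⟨C, hC0, hC⟩ := h.exists_bound hvc
  refine intervalIntegral.tendsto_integral_filter_of_dominated_convergence (fun _ => 3 * C)
    (Filter.Eventually.of_forall fun r => ?_) (Filter.Eventually.of_forall fun r =>
      Filter.Eventually.of_forall fun α _ => ?_) (by simp)
    (Filter.Eventually.of_forall fun α _ => ?_)
  · have h1 : ∀ m, Measurable fun α : ℝ => Ω.indicator v (z + r * Complex.exp (α * Complex.I)) m :=
      fun m => (h.measurable_indicator_apply (hvc.mono subset_closure) m).comp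
        (by fun_prop : Measurable fun α : ℝ => z + r * Complex.exp (α * Complex.I))
    exact (((measurable_phaseSum measurable_exp_neg_two_mul
      (fun α => (norm_exp_neg_two_mul α).le) h1 n).const_mul 2).sub (h1 n)).aestronglyMeasurable
  · refine (norm_meanSum_le (norm_exp_neg_two_mul α).le n _).trans ?_
    linarith [norm_indicator_le hC0 hC (z + r * Complex.exp (α * Complex.I))]
  · refine ((continuous_meanSum (norm_exp_neg_two_mul α).le n).tendsto _).comp ?_
    by_cases hα : α ∈ A
    · rw [indicator_of_mem hα]
      have h1 : Tendsto (fun r : ℝ => z + r * Complex.exp (α * Complex.I)) (𝓝[>] 0) (𝓝 z) := by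
        have : Continuous fun r : ℝ => z + r * Complex.exp (α * Complex.I) := by fun_prop
        have h2 := this.tendsto 0
        rw [Complex.ofReal_zero, zero_mul, add_zero] at h2
        exact h2.mono_left nhdsWithin_le_nhds
      have h2 : Tendsto (fun r : ℝ => z + r * Complex.exp (α * Complex.I)) (𝓝[>] 0)
          (𝓝[closure Ω] z) :=
        tendsto_nhdsWithin_iff.2 ⟨h1, (hA α hα).mono fun r hr => subset_closure hr⟩
      refine ((hvc z hz).tendsto.comp h2).congr' ((hA α hα).mono fun r hr => ?_)
      exact (indicator_of_mem hr v).symm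
    · rw [indicator_of_notMem hα]
      refine tendsto_const_nhds.congr' ((hA' α hα).mono fun r hr => ?_)
      exact (indicator_of_notMem hr v).symm

theorem tendsto_circleMean_of_mem (h : IsConvexDomain Ω c) {v : ℂ → EllOne}
    (hvc : ContinuousOn v (closure Ω)) (n : ℕ) {z : ℂ} (hz : z ∈ Ω) :
    Tendsto (circleMean Ω v n z) (𝓝[>] 0) (𝓝 (2 * Real.pi * v z n)) := by
  have := h.tendsto_circleMean hvc n (subset_closure hz) (A := univ) (fun α _ => ?_)
    (fun α hα => absurd (mem_univ α) hα)
  · simpa only [indicator_univ, integral_meanSum] using this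
  · have h1 : Continuous fun r : ℝ => z + r * Complex.exp (α * Complex.I) := by fun_prop
    have h2 := h1.continuousAt (x := 0)
    exact nhdsWithin_le_nhds (h2.preimage_mem_nhds (h.isOpen.mem_nhds (by simpa using hz)))

/-- A point of the open set can be moved slightly along `ν` without leaving it, so equality in the
support inequality is impossible. -/
theorem re_conj_mul_sub_neg (h : IsConvexDomain Ω c) {z ν : ℂ} (hν0 : ν ≠ 0)
    (hν : ∀ ζ ∈ Ω, (conj ν * (ζ - z)).re ≤ 0) {ζ : ℂ} (hζ : ζ ∈ Ω) :
    (conj ν * (ζ - z)).re < 0 := by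
  have h1 : Continuous fun s : ℝ => ζ + s * ν := by fun_prop
  have h2 : ∀ᶠ s : ℝ in 𝓝[>] 0, ζ + s * ν ∈ Ω := nhdsWithin_le_nhds
    (h1.continuousAt.preimage_mem_nhds (h.isOpen.mem_nhds (by simpa using hζ)))
  obtain ⟨s, hs, hs0⟩ := (h2.and self_mem_nhdsWithin).exists
  have h3 := hν _ hs
  have h4 : conj ν * (ζ + s * ν - z) = conj ν * (ζ - z) + ((s * Complex.normSq ν : ℝ) : ℂ) := by
    rw [Complex.ofReal_mul, Complex.normSq_eq_conj_mul_self]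
    ring
  rw [h4, Complex.add_re, Complex.ofReal_re] at h3
  have h5 : 0 < s * Complex.normSq ν := mul_pos hs0 (Complex.normSq_pos.2 hν0)
  linarith

/-- If an inward ray from `z` missed `Ω`, a functional would separate them. Its normalised vector
would be an outer normal at `z`, hence `ν`; but the functional is nonnegative on `e`, against `he`.
-/
theorem exists_mem_of_hasTangentAt (h : IsConvexDomain Ω c) {z ν e : ℂ} (hz : z ∈ closure Ω)
    (hν : ∀ μ : ℂ, (‖μ‖ = 1 ∧ ∀ ζ ∈ Ω, (conj μ * (ζ - z)).re ≤ 0) → μ = ν)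
    (he : (conj ν * e).re < 0) : ∃ r : ℝ, 0 < r ∧ z + r * e ∈ Ω := by
  by_contra! hcon
  have hconv : Convex ℝ ((fun r : ℝ => z + r * e) '' Ioi 0) := by
    have := (convex_Ioi (0 : ℝ)).is_linear_image (f := fun r : ℝ => (r : ℂ) * e)
      ⟨fun x y => by push_cast; ring, fun x y => by
        rw [smul_eq_mul, Complex.real_smul]; push_cast; ring⟩
    have h2 := this.translate z
    rwa [image_image] at h2
  have hdis : Disjoint Ω ((fun r : ℝ => z + r * e) '' Ioi 0) := by
    rw [Set.disjoint_right]
    rintro _ ⟨r, hr, rfl⟩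
    exact hcon r hr
  obtain ⟨f, u, hf, hu⟩ := geometric_hahn_banach_open h.convex h.isOpen hconv hdis
  obtain ⟨μ, hμ⟩ := exists_eq_re_conj_mul f
  have hray : ∀ r : ℝ, 0 < r → u ≤ f z + r * f e := fun r hr => by
    have := hu _ ⟨r, hr, rfl⟩
    simpa only [map_add, ← Complex.real_smul, map_smul, smul_eq_mul] using this
  have hzu : f z ≤ u := closure_minimal (fun ζ hζ => (hf ζ hζ).le)
    (isClosed_le f.continuous continuous_const) hz
  have hfe : 0 ≤ f e := by
    have := hray 1 one_pos
    linarith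
  -- Letting the ray parameter tend to zero shows that the separating line passes through `z`. The
  -- parameter `ε / (f e + 1)` costs at most `ε` and avoids division by zero when `f e = 0`.
  have hzu' : u ≤ f z := by
    refine le_of_forall_pos_le_add fun ε hε => ?_
    have h1 := hray (ε / (f e + 1)) (by positivity)
    have h2 : ε / (f e + 1) * f e ≤ ε := by
      rw [div_mul_eq_mul_div, div_le_iff₀ (by positivity)]
      nlinarith
    linarith
  have hμ0 : μ ≠ 0 := by
    rintro rfl
    have h1 := hf c h.mem
    rw [hμ, map_zero, zero_mul, Complex.zero_re] at h1
    have h2 := hμ z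
    rw [map_zero, zero_mul, Complex.zero_re] at h2
    linarith
  have hμn : 0 < ‖μ‖ := norm_pos_iff.2 hμ0
  have hscale : ∀ x : ℂ, (conj ((‖μ‖⁻¹ : ℝ) * μ) * x).re = ‖μ‖⁻¹ * f x := fun x => by
    rw [hμ, map_mul, Complex.conj_ofReal, mul_assoc, Complex.re_ofReal_mul]
  have := hν ((‖μ‖⁻¹ : ℝ) * μ) ⟨?_, fun ζ hζ => ?_⟩
  · rw [← this, hscale] at he
    exact (mul_nonneg (inv_nonneg.2 hμn.le) hfe).not_gt he
  · rw [norm_mul, Complex.norm_real, norm_inv, norm_norm, inv_mul_cancel₀ hμn.ne']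
  · rw [hscale, map_sub]
    exact mul_nonpos_of_nonneg_of_nonpos (inv_nonneg.2 hμn.le) (by linarith [hf ζ hζ])

theorem tendsto_circleMean_of_hasTangentAt (h : IsConvexDomain Ω c) {v : ℂ → EllOne}
    (hvc : ContinuousOn v (closure Ω)) (n : ℕ) {z : ℂ} (hz : z ∈ closure Ω)
    (ht : HasTangentAt Ω z) :
    Tendsto (circleMean Ω v n z) (𝓝[>] 0) (𝓝 (Real.pi * v z n)) := by
  obtain ⟨ν, ⟨hν1, hν⟩, huniq⟩ := ht
  have hν0 : ν ≠ 0 := by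
    rintro rfl
    simp at hν1
  rw [← integral_meanSum_indicator hν0 n (v z)]
  refine h.tendsto_circleMean hvc n hz (fun α hα => ?_) fun α hα => ?_
  · obtain ⟨r₀, hr₀, hmem⟩ := h.exists_mem_of_hasTangentAt hz huniq hα
    -- With the point found on the ray as new centre, `shrink_mem` puts the whole open segment
    -- towards `z` into `Ω`.
    have h' : IsConvexDomain Ω (z + r₀ * Complex.exp (α * Complex.I)) :=
      ⟨h.isOpen, h.convex, h.bounded, hmem⟩
    filter_upwards [Ioo_mem_nhdsGT hr₀] with r hr
    have h2 := h'.shrink_mem (s := 1 - r / r₀) (sub_nonneg.2 ((div_le_one hr₀).2 hr.2.le))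
      (by linarith [div_pos hr.1 hr₀]) hz
    convert h2 using 1
    have : (r₀ : ℂ) ≠ 0 := Complex.ofReal_ne_zero.2 hr₀.ne'
    push_cast
    field_simp
    ring
  · filter_upwards [self_mem_nhdsWithin] with r hr hmem
    have h1 := h.re_conj_mul_sub_neg hν0 hν hmem
    rw [add_sub_cancel_left, mul_left_comm, Complex.re_ofReal_mul] at h1
    exact hα (by
      by_contra hge
      exact h1.not_ge (mul_nonneg (le_of_lt hr) (not_lt.1 hge)))

end IsConvexDomain

/-! ### Integrability of the boundary and area kernels. -/

theorem phaseSum_single (φ : ℂ) :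
    phaseSum 0 φ (lp.single 1 (0 : ℕ) (1 : ℂ) : EllOne) = 1 := by
  rw [phaseSum, tsum_eq_single 0]
  · simp
  · intro j hj
    simp [hj]

namespace IsConvexDomain
variable {Ω : Set ℂ} {c : ℂ}

/-- The kernel is `2i` times the imaginary part of the Cauchy kernel, which convexity makes
nonnegative. Its absolute value is therefore linear in the Cauchy kernel and can be integrated
exactly. -/
theorem norm_angularKernel_eq (h : IsConvexDomain Ω c) {z : ℂ} (hz : z ∈ closure Ω) (θ : ℝ) :
    ‖angularKernel Ω c z θ‖ = 2 * (cauchyKernel Ω c z θ).im := by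
  have h1 : 0 ≤ (cauchyKernel Ω c z θ).im := by
    have h2 : cauchyKernel Ω c z θ = ((Complex.normSq (boundaryCurve Ω c θ - z))⁻¹ : ℝ) *
        (conj (boundaryCurve Ω c θ - z) * deriv (boundaryCurve Ω c) θ) := by
      rw [cauchyKernel, div_eq_mul_inv, Complex.inv_def]
      push_cast
      ring
    rw [h2, Complex.im_ofReal_mul]
    exact mul_nonneg (inv_nonneg.2 (Complex.normSq_nonneg _)) (h.im_conj_mul_deriv_nonneg hz θ)
  rw [angularKernel_eq, Complex.sub_conj, norm_mul, Complex.norm_I, mul_one, Complex.norm_real,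
    Real.norm_of_nonneg (by positivity)]

theorem integrableOn_cauchyKernel (h : IsConvexDomain Ω c) (z : ℂ) {ε : ℝ} (hε : 0 < ε) :
    Integrable (cauchyKernel Ω c z) ((volume.restrict (Ioc 0 (2 * Real.pi))).restrict
      {θ | ε < ‖boundaryCurve Ω c θ - z‖}) := by
  obtain ⟨K, hK0, hK⟩ := h.exists_norm_deriv_boundaryCurve_le
  refine Integrable.of_bound (C := K / ε) (h.measurable_cauchyKernel z).aestronglyMeasurable ?_
  refine ae_restrict_of_forall_mem (measurableSet_lt measurable_const
    (h.measurable_boundaryCurve_sub z).norm) fun θ hθ => ?_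
  rw [le_div_iff₀ hε]
  exact (mul_le_mul_of_nonneg_left (le_of_lt hθ) (norm_nonneg _)).trans
    ((norm_cauchyKernel_mul_le z θ).trans (hK θ))

theorem integrable_cauchyKernel (h : IsConvexDomain Ω c) {z : ℂ} (hz : z ∈ Ω) :
    Integrable (cauchyKernel Ω c z) (volume.restrict (Ioc 0 (2 * Real.pi))) := by
  obtain ⟨ε, hε, hball⟩ := Metric.isOpen_iff.1 h.isOpen z hz
  have h1 := h.integrableOn_cauchyKernel z (half_pos hε)
  have h2 : {θ | ε / 2 < ‖boundaryCurve Ω c θ - z‖} = univ := by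
    refine eq_univ_of_forall fun θ => ?_
    by_contra hθ
    have h3 : ‖boundaryCurve Ω c θ - z‖ ≤ ε / 2 := not_lt.1 hθ
    have h4 : boundaryCurve Ω c θ ∈ Ω := hball (by
      rw [Metric.mem_ball, dist_eq_norm]; linarith)
    have h5 := h.boundaryCurve_mem_frontier θ
    rw [h.isOpen.frontier_eq] at h5
    exact h5.2 h4
  rwa [h2, Measure.restrict_univ] at h1

theorem integrable_inv_sub (h : IsConvexDomain Ω c) (z : ℂ) :
    IntegrableOn (fun ζ => (ζ - z)⁻¹) Ω := by
  obtain ⟨D, hD0, hD⟩ := h.exists_norm_sub_le z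
  have h1 : IntegrableOn (fun ζ : ℂ => ‖ζ‖⁻¹) (Metric.ball 0 (D + 1)) := by
    rw [integrableOn_fun_norm_addHaar volume (f := fun r => r⁻¹)]
    -- In the plane the radial weight `r` cancels `r⁻¹`, leaving the constant 1.
    refine (integrableOn_const (C := (1 : ℝ)) (s := Ioo (0 : ℝ) (D + 1))
      measure_Ioo_lt_top.ne).congr_fun (fun r hr => ?_) measurableSet_Ioo
    simp [Complex.finrank_real_complex, mul_inv_cancel₀ hr.1.ne']
  have h2 : IntegrableOn (fun ζ : ℂ => ‖ζ - z‖⁻¹) ((fun ζ => ζ - z) ⁻¹' Metric.ball 0 (D + 1)) :=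
    ((measurePreserving_sub_right volume z).integrableOn_comp_preimage
      (MeasurableEquiv.subRight z).measurableEmbedding).2 h1
  have h3 : IntegrableOn (fun ζ : ℂ => ‖ζ - z‖⁻¹) Ω := h2.mono_set fun ζ hζ => by
    have := hD ζ (subset_closure hζ)
    rw [mem_preimage, mem_ball_zero_iff]
    linarith
  refine h3.mono' (by fun_prop) (Filter.Eventually.of_forall fun ζ => ?_)
  rw [norm_inv]

/-- For the constant sequence `⟨1, 0, 0, …⟩` and `n = 0` the phase sum is `1`, so the two angular
integrals cancel; the area term vanishes with `w = 0`, and only the Cauchy integral remains. -/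
theorem tendsto_integral_cauchyKernel (h : IsConvexDomain Ω c) {z M : ℂ}
    (hM : Tendsto (circleMean Ω (fun _ => lp.single 1 (0 : ℕ) (1 : ℂ)) 0 z) (𝓝[>] 0) (𝓝 M)) :
    Tendsto (fun ε : ℝ => ∫ θ in {θ | ε < ‖boundaryCurve Ω c θ - z‖}, cauchyKernel Ω c z θ
        ∂volume.restrict (Ioc 0 (2 * Real.pi))) (𝓝[>] 0) (𝓝 (Complex.I * M)) := by
  have h1 := h.tendsto_removed_disc z (w := fun _ => 0) continuousOn_const contDiffOn_const
    continuousOn_const (fun ζ _ m => by simp [dz, dzbar]) 0 hM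
  simpa [phaseSum_single, phaseSum_zero] using h1

/-- The truncated integrals of the absolute value are twice the imaginary parts of truncated Cauchy
integrals, hence converge; by monotone exhaustion the kernel is integrable even when `z` lies on the
boundary. -/
theorem integrable_angularKernel (h : IsConvexDomain Ω c) {z M : ℂ} (hz : z ∈ closure Ω)
    (hM : Tendsto (circleMean Ω (fun _ => lp.single 1 (0 : ℕ) (1 : ℂ)) 0 z) (𝓝[>] 0) (𝓝 M)) :
    Integrable (angularKernel Ω c z) (volume.restrict (Ioc 0 (2 * Real.pi))) := by
  have hε : Tendsto (fun N : ℕ => 1 / ((N : ℝ) + 1)) atTop (𝓝[>] 0) :=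
    tendsto_nhdsWithin_iff.2 ⟨tendsto_one_div_add_atTop_nhds_zero_nat,
      Filter.Eventually.of_forall fun N => mem_Ioi.2 Nat.one_div_pos_of_nat⟩
  have hS : ∀ ε : ℝ, MeasurableSet {θ | ε < ‖boundaryCurve Ω c θ - z‖} := fun ε =>
    measurableSet_lt measurable_const (h.measurable_boundaryCurve_sub z).norm
  have hcov : AECover (volume.restrict (Ioc 0 (2 * Real.pi))) atTop
      fun N : ℕ => {θ | 1 / ((N : ℝ) + 1) < ‖boundaryCurve Ω c θ - z‖} := by
    refine ⟨?_, fun N => hS _⟩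
    filter_upwards [ae_restrict_of_ae (h.ae_boundaryCurve_ne z)] with θ hθ
    exact hε.eventually (nhdsWithin_le_nhds (Iio_mem_nhds (norm_pos_iff.2 hθ)))
  refine hcov.integrable_of_integral_norm_tendsto (2 * (Complex.I * M).im) (fun N => ?_) ?_
  · have h1 := h.integrableOn_cauchyKernel z (Nat.one_div_pos_of_nat (α := ℝ) (n := N))
    refine (h1.norm.const_mul 2).mono' (h.measurable_angularKernel z).aestronglyMeasurable
      (Filter.Eventually.of_forall fun θ => norm_angularKernel_le z θ)
  · have h2 := (((Complex.continuous_im.tendsto _).comp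
      (h.tendsto_integral_cauchyKernel hM)).const_mul 2).comp hε
    refine h2.congr fun N => ?_
    have h1 := h.integrableOn_cauchyKernel z (Nat.one_div_pos_of_nat (α := ℝ) (n := N))
    simp only [h.norm_angularKernel_eq hz, Function.comp_apply]
    rw [integral_const_mul]
    congr 1
    exact (integral_im h1).symm

end IsConvexDomain

/-! ### Convergence of the operators and the formulas inside and on the boundary. -/

theorem angularIntegrand_eq (Ω : Set ℂ) (c : ℂ) (g : ℂ → EllOne) (n j : ℕ) (z : ℂ) (θ : ℝ) :
    angularIntegrand Ω c g n j z θ = angularKernel Ω c z θ *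
      (g (boundaryCurve Ω c θ) (n + 2 * j) * phase (boundaryCurve Ω c θ - z) ^ j) := by
  rw [angularIntegrand, angularKernel, phase, mul_assoc]

theorem cauchyIntegrand_eq (Ω : Set ℂ) (c : ℂ) (g : ℂ → EllOne) (n : ℕ) (z : ℂ) (θ : ℝ) :
    cauchyIntegrand Ω c g n z θ = cauchyKernel Ω c z θ * g (boundaryCurve Ω c θ) n := by
  rw [cauchyIntegrand, cauchyKernel]
  ring

theorem areaIntegrand_eq (w : ℂ → EllOne) (n j : ℕ) (z ζ : ℂ) :
    areaIntegrand w n j z ζ = (ζ - z)⁻¹ * (w ζ (n + 2 * j) * phase (ζ - z) ^ j) := by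
  rw [areaIntegrand, phase, one_div]
  ring

namespace IsConvexDomain
variable {Ω : Set ℂ} {c : ℂ}

theorem areaOperatorConverges (h : IsConvexDomain Ω c) {w : ℂ → EllOne}
    (hwc : ContinuousOn w (closure Ω)) (n : ℕ) (z : ℂ) : AreaOperatorConverges Ω w n z := by
  obtain ⟨C, hC0, hC⟩ := h.exists_bound hwc
  have hφ := (measurable_phase_sub z).aestronglyMeasurable (μ := volume.restrict Ω)
  have hm := h.aestronglyMeasurable_apply (hwc.mono subset_closure)
  refine ⟨fun j => ?_, ?_⟩
  · simp only [funext (areaIntegrand_eq w n j z)]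
    exact integrable_mul_apply_mul_pow (h.integrable_inv_sub z) hφ (fun _ => norm_phase_le _) hm
      (h.ae_restrict_of_closure hC) _ j
  · simp only [areaIntegrand_eq]
    exact (hasSum_integral_phaseSum (h.integrable_inv_sub z) hφ (fun _ => norm_phase_le _) hm
      (h.ae_restrict_of_closure hC) n).summable

theorem areaOperator_eq (h : IsConvexDomain Ω c) {w : ℂ → EllOne}
    (hwc : ContinuousOn w (closure Ω)) (n : ℕ) (z : ℂ) :
    areaOperator Ω w n z =
      -(1 / Real.pi) * ∫ ζ in Ω, (ζ - z)⁻¹ * phaseSum n (phase (ζ - z)) (w ζ) := by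
  obtain ⟨C, hC0, hC⟩ := h.exists_bound hwc
  rw [areaOperator]
  simp only [areaIntegrand_eq]
  rw [(hasSum_integral_phaseSum (h.integrable_inv_sub z)
    (measurable_phase_sub z).aestronglyMeasurable (fun _ => norm_phase_le _)
    (h.aestronglyMeasurable_apply (hwc.mono subset_closure)) (h.ae_restrict_of_closure hC)
    n).tsum_eq]

section Boundary

variable {v : ℂ → EllOne} {z : ℂ}

theorem hasSum_angularIntegrand (h : IsConvexDomain Ω c) (hvc : ContinuousOn v (closure Ω))
    (hk : Integrable (angularKernel Ω c z) (volume.restrict (Ioc 0 (2 * Real.pi)))) (n : ℕ) :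
    HasSum (fun j : ℕ => ∫ θ in (0 : ℝ)..(2 * Real.pi), angularIntegrand Ω c v n (j + 1) z θ)
      ((∫ θ in Ioc 0 (2 * Real.pi), angularKernel Ω c z θ *
        phaseSum n (phase (boundaryCurve Ω c θ - z)) (v (boundaryCurve Ω c θ))) -
      ∫ θ in Ioc 0 (2 * Real.pi), angularKernel Ω c z θ * v (boundaryCurve Ω c θ) n) := by
  obtain ⟨C, hC0, hC⟩ := h.exists_bound hvc
  have h1 := hasSum_integral_phaseSum hk
    (h.measurable_phase_boundaryCurve z).aestronglyMeasurable (fun _ => norm_phase_le _)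
    (fun m => ((continuous_apply m).comp (h.continuous_comp_boundaryCurve hvc)).aestronglyMeasurable)
    (Filter.Eventually.of_forall fun θ => hC _ (h.boundaryCurve_mem_closure θ)) n
  -- The operator sums from `j = 1`, the phase sum from `j = 0`; the zeroth term is the subtracted
  -- integral.
  have h2 := (hasSum_nat_add_iff' 1).2 h1
  simp only [Finset.sum_range_one, mul_zero, add_zero, pow_zero, mul_one] at h2
  simp only [intervalIntegral.integral_of_le Real.two_pi_pos.le, angularIntegrand_eq]
  exact h2

theorem angularSeriesConverges (h : IsConvexDomain Ω c) (hvc : ContinuousOn v (closure Ω))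
    (hk : Integrable (angularKernel Ω c z) (volume.restrict (Ioc 0 (2 * Real.pi)))) (n : ℕ) :
    AngularSeriesConverges Ω c v n z := by
  obtain ⟨C, hC0, hC⟩ := h.exists_bound hvc
  refine ⟨fun j => ?_, (h.hasSum_angularIntegrand hvc hk n).summable⟩
  rw [intervalIntegrable_iff_integrableOn_Ioc_of_le Real.two_pi_pos.le,
    funext (angularIntegrand_eq Ω c v n (j + 1) z)]
  exact integrable_mul_apply_mul_pow hk
    (h.measurable_phase_boundaryCurve z).aestronglyMeasurable (fun _ => norm_phase_le _)
    (fun m => ((continuous_apply m).comp (h.continuous_comp_boundaryCurve hvc)).aestronglyMeasurable)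
    (Filter.Eventually.of_forall fun θ => hC _ (h.boundaryCurve_mem_closure θ)) _ _

/-- In the identity with a removed disc all terms except the Cauchy integral have integrable
integrands, so their truncations converge; this forces the truncated Cauchy integrals to converge as
well. It serves inside and on the boundary alike, with different `M`. -/
theorem tendsto_integral_cauchyIntegrand (h : IsConvexDomain Ω c) {w : ℂ → EllOne}
    (hwc : ContinuousOn w (closure Ω))
    (hv1 : ContDiffOn ℝ 1 v Ω) (hvc : ContinuousOn v (closure Ω))
    (hw : ∀ ζ ∈ Ω, ∀ m, w ζ m = dzbar v ζ m + dz v ζ (m + 2))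
    (hk : Integrable (angularKernel Ω c z) (volume.restrict (Ioc 0 (2 * Real.pi)))) (n : ℕ) {M : ℂ}
    (hM : Tendsto (circleMean Ω v n z) (𝓝[>] 0) (𝓝 M)) :
    Tendsto (fun ε : ℝ => ∫ θ in {θ | ε < ‖boundaryCurve Ω c θ - z‖}, cauchyIntegrand Ω c v n z θ
        ∂volume.restrict (Ioc 0 (2 * Real.pi))) (𝓝[>] 0)
      (𝓝 (Complex.I * M -
        2 * Real.pi * Complex.I * (angularSeries Ω c v n z + areaOperator Ω w n z))) := by
  obtain ⟨C, hC0, hC⟩ := h.exists_bound hvc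
  obtain ⟨C', hC'0, hC'⟩ := h.exists_bound hwc
  have hvm : ∀ m, AEStronglyMeasurable (fun θ => v (boundaryCurve Ω c θ) m)
      (volume.restrict (Ioc 0 (2 * Real.pi))) := fun m => ((continuous_apply m).comp
    (h.continuous_comp_boundaryCurve hvc)).aestronglyMeasurable
  have hne := ae_restrict_of_ae (s := Ioc 0 (2 * Real.pi)) (h.ae_boundaryCurve_ne z)
  have hne' : ∀ᵐ ζ ∂volume.restrict Ω, ζ - z ≠ 0 := by
    refine ae_restrict_of_ae ?_
    filter_upwards [compl_mem_ae_iff.2 (measure_singleton (μ := (volume : Measure ℂ)) z)] with ζ hζ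
    exact sub_ne_zero.2 hζ
  have T₁ := tendsto_setIntegral_norm_gt (integrable_mul_phaseSum hk
    (h.measurable_phase_boundaryCurve z).aestronglyMeasurable (fun _ => norm_phase_le _) hvm
    (Filter.Eventually.of_forall fun θ => hC _ (h.boundaryCurve_mem_closure θ)) n)
    (h.measurable_boundaryCurve_sub z) hne
  have T₂ := tendsto_setIntegral_norm_gt (hk.mul_bdd (c := C) (hvm n)
    (Filter.Eventually.of_forall fun θ => (norm_apply_le _ n).trans
      (hC _ (h.boundaryCurve_mem_closure θ)))) (h.measurable_boundaryCurve_sub z) hne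
  have T₄ := tendsto_setIntegral_norm_gt (integrable_mul_phaseSum (h.integrable_inv_sub z)
    (measurable_phase_sub z).aestronglyMeasurable (fun _ => norm_phase_le _)
    (h.aestronglyMeasurable_apply (hwc.mono subset_closure)) (h.ae_restrict_of_closure hC') n)
    (by fun_prop : Measurable fun ζ : ℂ => ζ - z) hne'
  have T := ((h.tendsto_removed_disc z hwc hv1 hvc hw n hM).sub (T₁.sub T₂)).add
    (T₄.const_mul (2 * Complex.I))
  have hpi : (Real.pi : ℂ) ≠ 0 := Complex.ofReal_ne_zero.2 Real.pi_ne_zero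
  convert T using 2 with ε
  · simp only [cauchyIntegrand_eq]
    ring
  · rw [angularSeries, (h.hasSum_angularIntegrand hvc hk n).tsum_eq, h.areaOperator_eq hwc]
    field_simp
    ring

theorem intervalIntegrable_cauchyIntegrand (h : IsConvexDomain Ω c)
    (hvc : ContinuousOn v (closure Ω)) (n : ℕ) (hz : z ∈ Ω) :
    IntervalIntegrable (cauchyIntegrand Ω c v n z) volume 0 (2 * Real.pi) := by
  obtain ⟨C, hC0, hC⟩ := h.exists_bound hvc
  rw [intervalIntegrable_iff_integrableOn_Ioc_of_le Real.two_pi_pos.le,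
    funext (cauchyIntegrand_eq Ω c v n z)]
  exact (h.integrable_cauchyKernel hz).mul_bdd (c := C)
    ((continuous_apply n).comp (h.continuous_comp_boundaryCurve hvc)).aestronglyMeasurable
    (Filter.Eventually.of_forall fun θ => (norm_apply_le _ n).trans
      (hC _ (h.boundaryCurve_mem_closure θ)))

theorem integrable_angularKernel_of_mem (h : IsConvexDomain Ω c) (hz : z ∈ Ω) :
    Integrable (angularKernel Ω c z) (volume.restrict (Ioc 0 (2 * Real.pi))) :=
  h.integrable_angularKernel (subset_closure hz)
    (h.tendsto_circleMean_of_mem continuousOn_const 0 hz)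

theorem integrable_angularKernel_of_hasTangentAt (h : IsConvexDomain Ω c) (hz : z ∈ closure Ω)
    (ht : HasTangentAt Ω z) :
    Integrable (angularKernel Ω c z) (volume.restrict (Ioc 0 (2 * Real.pi))) :=
  h.integrable_angularKernel hz
    (h.tendsto_circleMean_of_hasTangentAt continuousOn_const 0 hz ht)

/-- The Bukhgeim-Pompeiu formula. -/
theorem eq_bukhgeimCauchy_add_areaOperator (h : IsConvexDomain Ω c) {w : ℂ → EllOne}
    (hwc : ContinuousOn w (closure Ω))
    (hv1 : ContDiffOn ℝ 1 v Ω) (hvc : ContinuousOn v (closure Ω))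
    (hw : ∀ ζ ∈ Ω, ∀ m, w ζ m = dzbar v ζ m + dz v ζ (m + 2)) (n : ℕ) (hz : z ∈ Ω) :
    v z n = bukhgeimCauchy Ω c v n z + areaOperator Ω w n z := by
  have h1 := h.tendsto_integral_cauchyIntegrand hwc hv1 hvc hw
    (h.integrable_angularKernel_of_mem hz) n (h.tendsto_circleMean_of_mem hvc n hz)
  have h2 := tendsto_setIntegral_norm_gt
    ((intervalIntegrable_iff_integrableOn_Ioc_of_le Real.two_pi_pos.le).1
      (h.intervalIntegrable_cauchyIntegrand hvc n hz)) (h.measurable_boundaryCurve_sub z)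
    (ae_restrict_of_ae (h.ae_boundaryCurve_ne z))
  have h3 := tendsto_nhds_unique h2 h1
  have hpi : (Real.pi : ℂ) ≠ 0 := Complex.ofReal_ne_zero.2 Real.pi_ne_zero
  rw [bukhgeimCauchy, intervalIntegral.integral_of_le Real.two_pi_pos.le, h3]
  field_simp
  ring

/-- Here `M = π v₋ₙ(z)`, half the interior value; this is the source of the summand `v₋ₙ(z₀)/2` in
the boundary formula. -/
theorem hasCauchyPV (h : IsConvexDomain Ω c) {w : ℂ → EllOne}
    (hwc : ContinuousOn w (closure Ω))
    (hv1 : ContDiffOn ℝ 1 v Ω) (hvc : ContinuousOn v (closure Ω))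
    (hw : ∀ ζ ∈ Ω, ∀ m, w ζ m = dzbar v ζ m + dz v ζ (m + 2)) (n : ℕ) (hz : z ∈ closure Ω)
    (ht : HasTangentAt Ω z) :
    HasCauchyPV Ω c v n z (Complex.I * (Real.pi * v z n) -
      2 * Real.pi * Complex.I * (angularSeries Ω c v n z + areaOperator Ω w n z)) := by
  have h1 := h.tendsto_integral_cauchyIntegrand hwc hv1 hvc hw
    (h.integrable_angularKernel_of_hasTangentAt hz ht) n
    (h.tendsto_circleMean_of_hasTangentAt hvc n hz ht)
  refine h1.congr fun ε => ?_
  rw [Measure.restrict_restrict (measurableSet_lt measurable_const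
    (h.measurable_boundaryCurve_sub z).norm), inter_comm]
  rfl

end Boundary

end IsConvexDomain

/-! ### Continuity of the area operator with values in `l^∞`. -/

namespace IsConvexDomain
variable {Ω : Set ℂ} {c : ℂ} {w : ℂ → EllOne}

theorem aestronglyMeasurable_indicator_add (h : IsConvexDomain Ω c)
    (hwc : ContinuousOn w (closure Ω)) (z : ℂ) :
    AEStronglyMeasurable (fun t => Ω.indicator w (z + t)) volume := by
  have h1 : AEStronglyMeasurable (Ω.indicator w) volume :=
    (aestronglyMeasurable_indicator_iff h.isOpen.measurableSet).2
      ((hwc.mono subset_closure).aestronglyMeasurable h.isOpen.measurableSet)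
  exact h1.comp_measurePreserving (measurePreserving_add_left volume z)

/-- After the substitution `t = ζ - z` the singular kernel no longer depends on `z`; continuity
becomes a question about translates of `w` extended by zero. -/
theorem areaOperator_eq_integral_add (h : IsConvexDomain Ω c) (hwc : ContinuousOn w (closure Ω))
    (n : ℕ) (z : ℂ) :
    areaOperator Ω w n z =
      -(1 / Real.pi) * ∫ t, t⁻¹ * phaseSum n (phase t) (Ω.indicator w (z + t)) := by
  rw [h.areaOperator_eq hwc, ← integral_indicator h.isOpen.measurableSet,
    ← integral_add_left_eq_self _ z]
  congr 2 with t
  by_cases ht : z + t ∈ Ω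
  · simp [ht]
  · simp [ht, phaseSum_zero]

theorem exists_integrable_bound (h : IsConvexDomain Ω c) {C : ℝ} (hC0 : 0 ≤ C)
    (hC : ∀ ζ ∈ closure Ω, ‖w ζ‖ ≤ C) :
    ∃ b : ℂ → ℝ, Integrable b ∧ ∀ z ∈ closure Ω, ∀ t,
      ‖t‖⁻¹ * ‖Ω.indicator w (z + t)‖ ≤ b t := by
  obtain ⟨D, hD0, hD⟩ := h.exists_norm_sub_le 0
  have h1 : IntegrableOn (fun ζ : ℂ => ‖ζ‖⁻¹) (Metric.ball 0 (2 * D + 1)) := by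
    rw [integrableOn_fun_norm_addHaar volume (f := fun r => r⁻¹)]
    refine (integrableOn_const (C := (1 : ℝ)) (s := Ioo (0 : ℝ) (2 * D + 1))
      measure_Ioo_lt_top.ne).congr_fun (fun r hr => ?_) measurableSet_Ioo
    simp [Complex.finrank_real_complex, mul_inv_cancel₀ hr.1.ne']
  -- If `z` and `z + t` both lie in the closure, then `|t| ≤ 2D`; the extra 1 places `t` in an open
  -- ball.
  refine ⟨(Metric.ball 0 (2 * D + 1)).indicator fun t => ‖t‖⁻¹ * C,
    (integrable_indicator_iff Metric.isOpen_ball.measurableSet).2 (h1.mul_const C),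
    fun z hz t => ?_⟩
  by_cases ht : z + t ∈ Ω
  · have h2 := hD _ (subset_closure ht)
    have h3 := hD _ hz
    rw [sub_zero] at h2 h3
    have h4 : ‖t‖ ≤ ‖z + t‖ + ‖z‖ := by
      simpa using norm_sub_le (z + t) z
    rw [indicator_of_mem (show t ∈ Metric.ball (0 : ℂ) (2 * D + 1) by
      rw [mem_ball_zero_iff]; linarith), indicator_of_mem ht]
    exact mul_le_mul_of_nonneg_left (hC _ (subset_closure ht)) (inv_nonneg.2 (norm_nonneg _))
  · rw [indicator_of_notMem ht, norm_zero, mul_zero]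
    exact indicator_nonneg (fun t _ => by positivity) t

theorem integrable_inv_mul_norm_indicator (h : IsConvexDomain Ω c)
    (hwc : ContinuousOn w (closure Ω)) {z : ℂ} (hz : z ∈ closure Ω) :
    Integrable fun t : ℂ => ‖t‖⁻¹ * ‖Ω.indicator w (z + t)‖ := by
  obtain ⟨C, hC0, hC⟩ := h.exists_bound hwc
  obtain ⟨b, hb, hle⟩ := h.exists_integrable_bound hC0 hC
  refine hb.mono' (AEStronglyMeasurable.mul (by fun_prop)
    (h.aestronglyMeasurable_indicator_add hwc z).norm) (Filter.Eventually.of_forall fun t => ?_)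
  rw [Real.norm_of_nonneg (by positivity)]
  exact hle z hz t

theorem integrable_inv_mul_phaseSum_indicator (h : IsConvexDomain Ω c)
    (hwc : ContinuousOn w (closure Ω)) (n : ℕ) {z : ℂ} (hz : z ∈ closure Ω) :
    Integrable fun t : ℂ => t⁻¹ * phaseSum n (phase t) (Ω.indicator w (z + t)) := by
  refine (h.integrable_inv_mul_norm_indicator hwc hz).mono' ?_
    (Filter.Eventually.of_forall fun t => ?_)
  · refine AEStronglyMeasurable.mul (by fun_prop) (aestronglyMeasurable_phaseSum
      measurable_phase.aestronglyMeasurable (fun _ => norm_phase_le _) (fun m => ?_) n)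
    exact (continuous_apply m).comp_aestronglyMeasurable
      (h.aestronglyMeasurable_indicator_add hwc z)
  · rw [norm_mul, norm_inv]
    exact mul_le_mul_of_nonneg_left (norm_phaseSum_le (norm_phase_le _) n _)
      (inv_nonneg.2 (norm_nonneg _))

theorem norm_areaOperator_le (h : IsConvexDomain Ω c) (hwc : ContinuousOn w (closure Ω)) (n : ℕ)
    {z : ℂ} (hz : z ∈ closure Ω) :
    ‖areaOperator Ω w n z‖ ≤ 1 / Real.pi * ∫ t, ‖t‖⁻¹ * ‖Ω.indicator w (z + t)‖ := by
  rw [h.areaOperator_eq_integral_add hwc, norm_mul, norm_neg, norm_div, norm_one,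
    Complex.norm_real, Real.norm_of_nonneg Real.pi_pos.le]
  refine mul_le_mul_of_nonneg_left (norm_integral_le_of_norm_le
    (h.integrable_inv_mul_norm_indicator hwc hz) (Filter.Eventually.of_forall fun t => ?_))
    (by positivity)
  rw [norm_mul, norm_inv]
  exact mul_le_mul_of_nonneg_left (norm_phaseSum_le (norm_phase_le _) n _)
    (inv_nonneg.2 (norm_nonneg _))

theorem integrable_inv_mul_norm_indicator_sub (h : IsConvexDomain Ω c)
    (hwc : ContinuousOn w (closure Ω)) {z z' : ℂ} (hz : z ∈ closure Ω) (hz' : z' ∈ closure Ω) :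
    Integrable fun t : ℂ => ‖t‖⁻¹ * ‖Ω.indicator w (z + t) - Ω.indicator w (z' + t)‖ := by
  refine ((h.integrable_inv_mul_norm_indicator hwc hz).add
    (h.integrable_inv_mul_norm_indicator hwc hz')).mono' (AEStronglyMeasurable.mul (by fun_prop)
    ((h.aestronglyMeasurable_indicator_add hwc z).sub
      (h.aestronglyMeasurable_indicator_add hwc z')).norm) (Filter.Eventually.of_forall fun t => ?_)
  rw [Real.norm_of_nonneg (by positivity), Pi.add_apply, ← mul_add]
  exact mul_le_mul_of_nonneg_left (norm_sub_le _ _) (inv_nonneg.2 (norm_nonneg _))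

theorem norm_areaOperator_sub_le (h : IsConvexDomain Ω c) (hwc : ContinuousOn w (closure Ω)) (n : ℕ)
    {z z' : ℂ} (hz : z ∈ closure Ω) (hz' : z' ∈ closure Ω) :
    ‖areaOperator Ω w n z - areaOperator Ω w n z'‖ ≤
      1 / Real.pi * ∫ t, ‖t‖⁻¹ * ‖Ω.indicator w (z + t) - Ω.indicator w (z' + t)‖ := by
  rw [h.areaOperator_eq_integral_add hwc, h.areaOperator_eq_integral_add hwc, ← mul_sub,
    ← integral_sub (h.integrable_inv_mul_phaseSum_indicator hwc n hz)
      (h.integrable_inv_mul_phaseSum_indicator hwc n hz'), norm_mul, norm_neg, norm_div, norm_one,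
    Complex.norm_real, Real.norm_of_nonneg Real.pi_pos.le]
  refine mul_le_mul_of_nonneg_left (norm_integral_le_of_norm_le
    (h.integrable_inv_mul_norm_indicator_sub hwc hz hz') (Filter.Eventually.of_forall fun t => ?_))
    (by positivity)
  rw [← mul_sub, ← phaseSum_sub (norm_phase_le _), norm_mul, norm_inv]
  exact mul_le_mul_of_nonneg_left (norm_phaseSum_le (norm_phase_le _) n _)
    (inv_nonneg.2 (norm_nonneg _))

/-- The zero extension of `w` jumps only on the boundary of `Ω`, a null set by convexity, so
dominated convergence applies. The integral no longer involves `n`, which makes the convergence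
uniform over the components. -/
theorem tendsto_integral_indicator_sub (h : IsConvexDomain Ω c) (hwc : ContinuousOn w (closure Ω))
    {z₀ : ℂ} (hz₀ : z₀ ∈ closure Ω) :
    Tendsto (fun z => ∫ t : ℂ, ‖t‖⁻¹ * ‖Ω.indicator w (z + t) - Ω.indicator w (z₀ + t)‖)
      (𝓝[closure Ω] z₀) (𝓝 0) := by
  obtain ⟨C, hC0, hC⟩ := h.exists_bound hwc
  obtain ⟨b, hb, hle⟩ := h.exists_integrable_bound hC0 hC
  rw [← integral_zero ℂ ℝ (μ := volume)]
  refine tendsto_integral_filter_of_dominated_convergence (fun t => b t + b t) ?_ ?_ (hb.add hb) ?_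
  · filter_upwards [self_mem_nhdsWithin] with z hz
    exact (h.integrable_inv_mul_norm_indicator_sub hwc hz hz₀).aestronglyMeasurable
  · filter_upwards [self_mem_nhdsWithin] with z hz
    refine Filter.Eventually.of_forall fun t => ?_
    rw [Real.norm_of_nonneg (by positivity)]
    refine le_trans ?_ (add_le_add (hle z hz t) (hle z₀ hz₀ t))
    rw [← mul_add]
    exact mul_le_mul_of_nonneg_left (norm_sub_le _ _) (inv_nonneg.2 (norm_nonneg _))
  · have hfr : ∀ᵐ t : ℂ, z₀ + t ∉ frontier Ω :=
      (measurePreserving_add_left volume z₀).quasiMeasurePreserving.ae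
        (compl_mem_ae_iff.2 (h.convex.addHaar_frontier volume))
    filter_upwards [hfr] with t ht
    have hcont : ContinuousAt (Ω.indicator w) (z₀ + t) := by
      by_cases h1 : z₀ + t ∈ Ω
      · have h2 := (hwc.mono subset_closure).continuousAt (h.isOpen.mem_nhds h1)
        refine h2.congr ?_
        filter_upwards [h.isOpen.mem_nhds h1] with ζ hζ
        exact (indicator_of_mem hζ w).symm
      · have h2 : z₀ + t ∉ closure Ω := fun h3 => ht (by
          rw [h.isOpen.frontier_eq]; exact ⟨h3, h1⟩)
        refine (continuousAt_const (y := (0 : EllOne))).congr ?_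
        filter_upwards [isClosed_closure.isOpen_compl.mem_nhds h2] with ζ hζ
        exact (indicator_of_notMem (fun h3 => hζ (subset_closure h3)) w).symm
    have h3 : ContinuousAt (fun z => ‖t‖⁻¹ * ‖Ω.indicator w (z + t) - Ω.indicator w (z₀ + t)‖)
        z₀ := by
      have h4 : ContinuousAt (fun z => Ω.indicator w (z + t)) z₀ :=
        ContinuousAt.comp (f := fun z => z + t) hcont (by fun_prop)
      exact continuousAt_const.mul (h4.sub continuousAt_const).norm
    have h5 := h3.tendsto
    simp only [sub_self, norm_zero, mul_zero] at h5
    exact h5.mono_left nhdsWithin_le_nhds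

/-- The area operator maps into the continuous `l^∞`-valued functions. -/
theorem exists_continuousOn_areaOperator (h : IsConvexDomain Ω c)
    (hwc : ContinuousOn w (closure Ω)) :
    ∃ G : ℂ → EllInfty, ContinuousOn G (closure Ω) ∧
      ∀ z ∈ closure Ω, ∀ n : ℕ, G z n = areaOperator Ω w n z := by
  classical
  have hmem : ∀ z ∈ closure Ω, Memℓp (fun n => areaOperator Ω w n z) ∞ := fun z hz =>
    memℓp_infty ⟨_, by
      rintro _ ⟨n, rfl⟩
      exact h.norm_areaOperator_le hwc n hz⟩
  let G : ℂ → EllInfty := fun z => if hz : z ∈ closure Ω then ⟨_, hmem z hz⟩ else 0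
  have hG : ∀ z ∈ closure Ω, ∀ n : ℕ, G z n = areaOperator Ω w n z := fun z hz n => by
    simp only [G, dif_pos hz]
  refine ⟨G, fun z₀ hz₀ => ?_, hG⟩
  rw [ContinuousWithinAt, tendsto_iff_norm_sub_tendsto_zero]
  have h1 := (h.tendsto_integral_indicator_sub hwc hz₀).const_mul (1 / Real.pi)
  rw [mul_zero] at h1
  refine squeeze_zero' (Filter.Eventually.of_forall fun z => norm_nonneg _) ?_ h1
  filter_upwards [self_mem_nhdsWithin] with z hz
  refine lp.norm_le_of_forall_le (mul_nonneg (by positivity)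
    (integral_nonneg fun t => by positivity)) fun n => ?_
  rw [lp.coeFn_sub, Pi.sub_apply, hG z hz, hG z₀ hz₀]
  exact h.norm_areaOperator_sub_le hwc n hz hz₀

end IsConvexDomain

/-- The inclusion of `l¹` into `l^∞`. -/
def toEllInfty (a : EllOne) : EllInfty := ⟨a, (lp.memℓp a).of_exponent_ge le_top⟩

theorem continuous_toEllInfty : Continuous toEllInfty := by
  refine (LipschitzWith.of_dist_le_mul (K := 1) fun a b => ?_).continuous
  rw [dist_eq_norm, dist_eq_norm, NNReal.coe_one, one_mul]
  exact lp.norm_le_of_forall_le (norm_nonneg _) fun n => norm_apply_le (a - b) n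

end BukhgeimPompeiu

end

/-! ### The theorem. -/

theorem proposition1 (Ω : Set ℂ) (hopen : IsOpen Ω) (hconv : Convex ℝ Ω)
    (hbdd : Bornology.IsBounded Ω) (c : ℂ) (hc : c ∈ Ω)
    (v w : ℂ → BukhgeimPompeiu.EllOne)
    (hw : ContinuousOn w (closure Ω))
    (hv1 : ContDiffOn ℝ 1 v Ω) (hv : ContinuousOn v (closure Ω))
    (heq : ∀ z ∈ Ω, BukhgeimPompeiu.dzbar v z +
      BukhgeimPompeiu.leftShift (BukhgeimPompeiu.leftShift (BukhgeimPompeiu.dz v z)) = w z) :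
    -- the operator `𝓑` is well defined in `Ω`, and `𝓑[v|∂Ω] ∈ C(cl Ω; l^∞)`
    (∀ z ∈ Ω, ∀ n : ℕ,
      IntervalIntegrable (BukhgeimPompeiu.cauchyIntegrand Ω c v n z) volume 0 (2 * Real.pi) ∧
      BukhgeimPompeiu.AngularSeriesConverges Ω c v n z) ∧
    (∃ F : ℂ → BukhgeimPompeiu.EllInfty, ContinuousOn F (closure Ω) ∧
      ∀ z ∈ Ω, ∀ n : ℕ, F z n = BukhgeimPompeiu.bukhgeimCauchy Ω c v n z) ∧
    -- the operator `𝓣` is well defined in the closure, and `𝓣 w ∈ C(cl Ω; l^∞)`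
    (∀ z ∈ closure Ω, ∀ n : ℕ, BukhgeimPompeiu.AreaOperatorConverges Ω w n z) ∧
    (∃ G : ℂ → BukhgeimPompeiu.EllInfty, ContinuousOn G (closure Ω) ∧
      ∀ z ∈ closure Ω, ∀ n : ℕ, G z n = BukhgeimPompeiu.areaOperator Ω w n z) ∧
    -- the Bukhgeim-Pompeiu formula
    (∀ z ∈ Ω, ∀ n : ℕ,
      v z n = BukhgeimPompeiu.bukhgeimCauchy Ω c v n z +
        BukhgeimPompeiu.areaOperator Ω w n z) ∧
    -- the boundary limit
    (∀ z₀ ∈ frontier Ω, BukhgeimPompeiu.HasTangentAt Ω z₀ → ∀ n : ℕ,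
      BukhgeimPompeiu.AngularSeriesConverges Ω c v n z₀ ∧
      ∃ P : ℂ, BukhgeimPompeiu.HasCauchyPV Ω c v n z₀ P ∧
        Tendsto (fun z => v z n) (𝓝[Ω] z₀)
          (𝓝 (1 / (2 * Real.pi * Complex.I) * P + 1 / 2 * v z₀ n +
            BukhgeimPompeiu.angularSeries Ω c v n z₀ +
            BukhgeimPompeiu.areaOperator Ω w n z₀))) := by
  have h : BukhgeimPompeiu.IsConvexDomain Ω c := ⟨hopen, hconv, hbdd, hc⟩
  have hcomp : ∀ ζ ∈ Ω, ∀ m, w ζ m = BukhgeimPompeiu.dzbar v ζ m +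
      BukhgeimPompeiu.dz v ζ (m + 2) := fun ζ hζ m => by
    rw [← heq ζ hζ]
    rfl
  obtain ⟨G, hGc, hG⟩ := h.exists_continuousOn_areaOperator hw
  have hformula := fun z (hz : z ∈ Ω) n =>
    h.eq_bukhgeimCauchy_add_areaOperator hw hv1 hv hcomp n hz
  refine ⟨fun z hz n => ⟨h.intervalIntegrable_cauchyIntegrand hv n hz,
    h.angularSeriesConverges hv (h.integrable_angularKernel_of_mem hz) n⟩,
    -- By the formula inside `Ω` the Bukhgeim-Cauchy operator equals `v - 𝓣w`, and this difference
    -- is already continuous on the closure.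
    ⟨fun z => BukhgeimPompeiu.toEllInfty (v z) - G z,
      (BukhgeimPompeiu.continuous_toEllInfty.comp_continuousOn hv).sub hGc, fun z hz n => ?_⟩,
    fun z _ n => h.areaOperatorConverges hw n z, ⟨G, hGc, hG⟩, hformula,
    fun z₀ hz₀ ht n => ?_⟩
  · have h1 : BukhgeimPompeiu.toEllInfty (v z) n = v z n := rfl
    rw [lp.coeFn_sub, Pi.sub_apply, hG z (subset_closure hz), h1, hformula z hz n,
      add_sub_cancel_right]
  · have hz := frontier_subset_closure hz₀
    refine ⟨h.angularSeriesConverges hv (h.integrable_angularKernel_of_hasTangentAt hz ht) n,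
      _, h.hasCauchyPV hw hv1 hv hcomp n hz ht, ?_⟩
    -- The limit is `v₋ₙ(z₀)` by continuity. The stated expression equals it because the principal
    -- value from `hasCauchyPV` contains `v₋ₙ(z₀)/2` and cancels the series and area terms.
    have h1 : Tendsto (fun z => v z n) (𝓝[Ω] z₀) (𝓝 (v z₀ n)) :=
      ((BukhgeimPompeiu.continuous_apply n).tendsto _).comp
        ((hv z₀ hz).tendsto.mono_left (nhdsWithin_mono _ subset_closure))
    convert h1 using 2
    have hpi : (Real.pi : ℂ) ≠ 0 := Complex.ofReal_ne_zero.2 Real.pi_ne_zero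
    field_simp
    ring
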